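/- Let $V:[0,1]\to\mathbb R$ be continuous and strictly positive. Let $\mathcal P_1$ be the set of (continuous representatives of) functions $f$ on $[0,1]$ that are strictly positive on $[0,1]$, square integrable as well as their first weak derivative, and satisfy $\int_0^1 f=1$. Write $\|\cdot\|$ for the norm of $L^2([0,1])$. (a) The Neumann problem $e''-Ve=-\mu e$, $e'(0)=e'(1)=0$ on $[0,1]$ has an infinite sequence of eigenvalues $\mu_0\le\mu_1\le\cdots$ with $L^2$-orthonormal eigenfunctions $e_0,e_1,\dots$ that is exhaustive, i.e. an eigenfunction orthogonal to all the $e_n$ vanishes. Fix any such system. (The signs of the $e_n$ are arbitrary; in particular one may take $e_0>0$.) Then $\mu_0<\mu_1$. Put $$c_n(w)=\int_0^1 e_nw,\qquad p_q=\frac{\int_0^1e_q}{\int_0^1e_0},\qquad \rho(w)=\frac{\|w-c_0(w)e_0\|\,\|1-c_0(1)e_0\|}{c_0(w)\int_0^1e_0},$$ $$\tau_{\mathcal N}(w)=\frac{\log\rho(w)}{\mu_1-\mu_0}\in[-\infty,\infty)\quad(\log 0=-\infty),\qquad \Omega_{\mathcal N}=\{w\in\mathcal P_1:\rho(w)<1\},$$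 and, for $m\in\mathbb N$ and $\nu=(q_0,q_1,\dots,q_m)\in\mathbb N\times(\mathbb N\setminus\{0\})^m$, $$\lambda_\nu=\sum_{i=0}^m(\mu_{q_i}-\mu_0),\qquad \psi_\nu(w)=\prod_{i=0}^m\frac{c_{q_i}(w)}{c_0(w)},\qquad b_\nu(x)=(-1)^m\,\frac{\prod_{i=1}^mp_{q_i}}{\int_0^1e_0}\,e_{q_0}(x)$$ (an empty product is $1$). (b) $\Omega_{\mathcal N}$ is a neighbourhood in $\mathcal P_1$, for the $L^2$ distance and hence for the $H^1$ distance, of the sink $\tilde f_0=e_0/\int_0^1e_0\in\mathcal P_1$. (c) For every $\tilde v_0\in\mathcal P_1$ the equation $$\partial_t\tilde v=(\partial_{xx}^2-V)\tilde v+\Big(\int_0^1V(\xi)\tilde v(t,\xi)\,d\xi\Big)\tilde v,\qquad \partial_x\tilde v(t,0)=\partial_x\tilde v(t,1)=0,\qquad \tilde v(0,\cdot)=\tilde v_0$$ has a unique global classical solution $\tilde v$ (continuous on $[0,\infty)\times[0,1]$, and $C^1$ in $t$ and $C^2$ in $x$ with jointly continuous derivatives on $(0,\infty)\times[0,1]$),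 and $\tilde v(t,\cdot)\in\mathcal P_1$ for all $t\ge0$. Moreover $c_0(\tilde v_0)\int_0^1e_0>0$ and, for every $t\ge0$ with $t>\tau_{\mathcal N}(\tilde v_0)$ and every $x\in[0,1]$, $$\tilde v(t,x)=\sum_{q_0=0}^\infty\ \sum_{m=0}^\infty\ \sum_{(q_1,\dots,q_m)\in(\mathbb N\setminus\{0\})^m}e^{-\lambda_\nu t}\,\psi_\nu(\tilde v_0)\,b_\nu(x),$$ where the sums converge in the indicated order: the innermost sum over $m$-tuples converges unconditionally, and the sums over $m$ and over $q_0$ are limits of partial sums. (d) If $\tilde v_0\in\Omega_{\mathcal N}$, then $\tau_{\mathcal N}(\tilde v_0)<0$, and the decomposition in (c) holds for all $t\ge0$ and all $x\in[0,1]$. -/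

import Mathlib

open Set Filter Topology MeasureTheory

namespace KoopmanHeat

/-! ### Function spaces on `[0,1]`

Functions on `[0,1]` are represented by functions `ℝ → ℝ`; only their values on `[0,1]` matter. -/

/-- The `L²([0,1])` norm. -/
noncomputable def l2Norm (f : ℝ → ℝ) : ℝ :=
  Real.sqrt (∫ x in (0 : ℝ)..1, f x ^ 2)

/-- `g` is a weak derivative of `f` on `]0,1[`, tested against smooth functions with compact
support in `]0,1[`. -/
def HasWeakDeriv (f g : ℝ → ℝ) : Prop :=
  ∀ φ : ℝ → ℝ, ContDiff ℝ (⊤ : ℕ∞) φ → HasCompactSupport φ → tsupport φ ⊆ Ioo 0 1 →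
    ∫ x in (0 : ℝ)..1, f x * deriv φ x = -∫ x in (0 : ℝ)..1, g x * φ x

/-- The (continuous representatives of) functions that are strictly positive on `[0,1]` and square
integrable as well as their first weak derivative. -/
def PPlus : Set (ℝ → ℝ) :=
  {f | ContinuousOn f (Icc 0 1) ∧ (∀ x ∈ Icc (0 : ℝ) 1, 0 < f x) ∧
    MemLp f 2 (volume.restrict (Icc 0 1)) ∧
    ∃ g : ℝ → ℝ, MemLp g 2 (volume.restrict (Icc 0 1)) ∧ HasWeakDeriv f g}

/-- The elements of `PPlus` with integral one. -/
def POne : Set (ℝ → ℝ) :=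
  {f | f ∈ PPlus ∧ ∫ x in (0 : ℝ)..1, f x = 1}

/-! ### The Neumann eigenvalue problem for `-∂ₓₓ + V` -/

/-- `f'' - V f = -lam f` on `[0,1]` with `f'(0) = f'(1) = 0` (one-sided derivatives at the end
points); `f = 0` is allowed. -/
def IsNeumannEigenfunction (V : ℝ → ℝ) (lam : ℝ) (f : ℝ → ℝ) : Prop :=
  ∃ f' f'' : ℝ → ℝ,
    (∀ x ∈ Icc (0 : ℝ) 1, HasDerivWithinAt f (f' x) (Icc 0 1) x) ∧
    (∀ x ∈ Icc (0 : ℝ) 1, HasDerivWithinAt f' (f'' x) (Icc 0 1) x) ∧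
    (∀ x ∈ Icc (0 : ℝ) 1, f'' x - V x * f x = -lam * f x) ∧
    f' 0 = 0 ∧ f' 1 = 0

/-- `mu 0 ≤ mu 1 ≤ …` is the list of all Neumann eigenvalues of `-∂ₓₓ + V`, and `e 0, e 1, …` are
corresponding orthonormal eigenfunctions: the list is exhaustive in the sense that an eigenfunction
orthogonal to all the `e n` vanishes. -/
structure IsNeumannEigensystem (V : ℝ → ℝ) (mu : ℕ → ℝ) (e : ℕ → ℝ → ℝ) : Prop where
  monotone : Monotone mu
  eigen : ∀ n, IsNeumannEigenfunction V (mu n) (e n)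
  orthonormal : ∀ m n, ∫ x in (0 : ℝ)..1, e m x * e n x = if m = n then 1 else 0
  exhaustive : ∀ (lam : ℝ) (f : ℝ → ℝ), IsNeumannEigenfunction V lam f →
    (∀ n, ∫ x in (0 : ℝ)..1, e n x * f x = 0) → ∀ x ∈ Icc (0 : ℝ) 1, f x = 0

/-! ### The nonlinear nonlocal heat equation -/

/-- `v` is a (global, classical) solution of
`∂ₜ v = ∂ₓₓ v - V v + (∫₀¹ V v) v`, `∂ₓ v (t,0) = ∂ₓ v (t,1) = 0`, `v (0,·) = v₀`:
it is continuous on `[0,∞[ × [0,1]`, and `C¹` in `t` and `C²` in `x` on `]0,∞[ × [0,1]`. -/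
structure IsSolution (V v₀ : ℝ → ℝ) (v : ℝ → ℝ → ℝ) : Prop where
  continuousOn : ContinuousOn (fun p : ℝ × ℝ => v p.1 p.2) (Ici 0 ×ˢ Icc 0 1)
  initial : ∀ x ∈ Icc (0 : ℝ) 1, v 0 x = v₀ x
  equation : ∃ vt vx vxx : ℝ → ℝ → ℝ,
    ContinuousOn (fun p : ℝ × ℝ => vt p.1 p.2) (Ioi 0 ×ˢ Icc 0 1) ∧
    ContinuousOn (fun p : ℝ × ℝ => vx p.1 p.2) (Ioi 0 ×ˢ Icc 0 1) ∧
    ContinuousOn (fun p : ℝ × ℝ => vxx p.1 p.2) (Ioi 0 ×ˢ Icc 0 1) ∧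
    ∀ t : ℝ, 0 < t →
      (∀ x ∈ Icc (0 : ℝ) 1,
        HasDerivAt (fun s => v s x) (vt t x) t ∧
        HasDerivWithinAt (v t) (vx t x) (Icc 0 1) x ∧
        HasDerivWithinAt (vx t) (vxx t x) (Icc 0 1) x ∧
        vt t x = vxx t x - V x * v t x + (∫ ξ in (0 : ℝ)..1, V ξ * v t ξ) * v t x) ∧
      vx t 0 = 0 ∧ vx t 1 = 0

/-! ### The ingredients of the Koopman decomposition -/

/-- `c_n(w) = ∫₀¹ e_n w`. -/
noncomputable def coeff (e : ℕ → ℝ → ℝ) (n : ℕ) (w : ℝ → ℝ) : ℝ :=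
  ∫ x in (0 : ℝ)..1, e n x * w x

/-- `p_q = ∫₀¹ e_q / ∫₀¹ e_0`. -/
noncomputable def meanRatio (e : ℕ → ℝ → ℝ) (q : ℕ) : ℝ :=
  (∫ x in (0 : ℝ)..1, e q x) / ∫ x in (0 : ℝ)..1, e 0 x

/-- The multi-index `ν = (q₀, q₁, …, q_m)` with `q₀ ∈ ℕ` and `q₁, …, q_m ∈ ℕ \ {0}`. -/
def multiIndex (q₀ : ℕ) {m : ℕ} (q : Fin m → ℕ+) : Fin (m + 1) → ℕ :=
  Fin.cons q₀ (fun i => (q i : ℕ))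

/-- `λ_ν = ∑_{i=0}^m (μ_{q_i} - μ_0)`. -/
def koopmanExponent (mu : ℕ → ℝ) {m : ℕ} (ν : Fin (m + 1) → ℕ) : ℝ :=
  ∑ i, (mu (ν i) - mu 0)

/-- `ψ_ν(w) = ∏_{i=0}^m c_{q_i}(w) / c_0(w)`. -/
noncomputable def koopmanObservable (e : ℕ → ℝ → ℝ) {m : ℕ} (ν : Fin (m + 1) → ℕ)
    (w : ℝ → ℝ) : ℝ :=
  ∏ i, coeff e (ν i) w / coeff e 0 w

/-- `b_ν(x) = (-1)^m (∏_{i=1}^m p_{q_i} / ∫₀¹ e_0) e_{q₀}(x)`. -/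
noncomputable def koopmanMode (e : ℕ → ℝ → ℝ) {m : ℕ} (ν : Fin (m + 1) → ℕ) (x : ℝ) : ℝ :=
  (-1) ^ m * ((∏ i : Fin m, meanRatio e (ν i.succ)) / ∫ ξ in (0 : ℝ)..1, e 0 ξ) * e (ν 0) x

/-- `s = ∑_{q₀=0}^∞ ∑_{m=0}^∞ ∑_{(q₁,…,q_m) ∈ (ℕ \ {0})^m} e^{-λ_ν t} ψ_ν(v₀) b_ν(x)`, all sums
being convergent, in this order: the innermost sum is an (unconditionally convergent) sum over all
`m`-tuples, the sums over `m` and over `q₀` are limits of partial sums. -/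
def HasKoopmanSum (mu : ℕ → ℝ) (e : ℕ → ℝ → ℝ) (v₀ : ℝ → ℝ) (t x s : ℝ) : Prop :=
  ∃ (S : ℕ → ℕ → ℝ) (R : ℕ → ℝ),
    (∀ q₀ m, HasSum (fun q : Fin m → ℕ+ =>
      Real.exp (-koopmanExponent mu (multiIndex q₀ q) * t) *
        koopmanObservable e (multiIndex q₀ q) v₀ * koopmanMode e (multiIndex q₀ q) x) (S q₀ m)) ∧
    (∀ q₀, Tendsto (fun M => ∑ m ∈ Finset.range M, S q₀ m) atTop (𝓝 (R q₀))) ∧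
    Tendsto (fun N => ∑ q₀ ∈ Finset.range N, R q₀) atTop (𝓝 s)

/-- `‖w - c_0(w) e_0‖ ‖1 - c_0(1) e_0‖ / (c_0(w) ∫₀¹ e_0)`, with `L²` norms. -/
noncomputable def sinkRatio (e : ℕ → ℝ → ℝ) (w : ℝ → ℝ) : ℝ :=
  l2Norm (fun x => w x - coeff e 0 w * e 0 x) *
      l2Norm (fun x => 1 - coeff e 0 (fun _ => 1) * e 0 x) /
    (coeff e 0 w * ∫ x in (0 : ℝ)..1, e 0 x)

/-- The threshold time `log (sinkRatio) / (μ_1 - μ_0)`, equal to `-∞` when the ratio is `0`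
(`ENNReal.log` is the extended logarithm, with `log 0 = ⊥`). -/
noncomputable def tauN (mu : ℕ → ℝ) (e : ℕ → ℝ → ℝ) (w : ℝ → ℝ) : EReal :=
  ((1 / (mu 1 - mu 0) : ℝ) : EReal) * ENNReal.log (ENNReal.ofReal (sinkRatio e w))

/-- The set `Ω` of those elements of `POne` for which the ratio is less than one. -/
def OmegaN (e : ℕ → ℝ → ℝ) : Set (ℝ → ℝ) :=
  {w | w ∈ POne ∧ sinkRatio e w < 1}

/-- The sink `e_0 / ∫₀¹ e_0`. -/
noncomputable def sink (e : ℕ → ℝ → ℝ) : ℝ → ℝ :=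
  fun x => e 0 x / ∫ ξ in (0 : ℝ)..1, e 0 ξ

end KoopmanHeat

open KoopmanHeat

namespace KoopmanHeat

/-! ### Calculus on `[0,1]` -/

/-! The nonlocal term only rescales. If `u` solves the linear equation `∂ₜu = ∂ₓₓu - Vu` with
Neumann conditions and the same initial value, then `(∫u)' = -∫Vu`, so `u / ∫u` solves the nonlinear
equation. Conversely, the coefficients of any solution against the `e n` satisfy scalar linear ODEs
sharing one time-dependent factor, so the solution is a multiple of `u`, and its integral, which
stays 1, fixes the multiple (`IsSolution.eq_normalizedHeat`, `isSolution_normalizedHeat`).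

Write `u = ∑ e^{-μₙt} cₙ eₙ` and divide `u` and `∫u` by `e^{-μ₀t} c₀ ∫e₀`. The denominator becomes
`1 - A`, where `-A` is a sum over `n ≥ 1`. Cauchy–Schwarz and Bessel give `|A| ≤ ρ e^{-(μ₁-μ₀)t}`,
which is below 1 exactly when `t` exceeds the threshold. Expanding `1/(1-A)` geometrically, and
`A^m` as a sum over `m`-tuples, gives the decomposition (`sum_abs_ratio_le`, `hasSum_prod_tuple`,
`hasKoopmanSum_normalizedHeat`).

The rest is spectral theory. Totality of the eigenfunctions comes from the spectral theorem for the
compact self-adjoint operator `J A⁻¹ J†`, with `J` the embedding of `H¹` in `L²` and `A` the energy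
form (`eq_zero_of_orthogonal_eigenfunctions`). Eigenvalues are simple by ODE uniqueness. The Sobolev
inequality yields `∑ eᵢ(x)²/μᵢ ≤ C`, hence `∑ 1/μᵢ < ∞`. Together with `∑ μₙ cₙ² < ∞` for `H¹` data
this makes the heat series converge uniformly down to `t = 0`. A minimum principle keeps `u`
positive. Since `e^{μ₀t} u → c₀ e₀`, the first eigenfunction has a fixed sign, whence `c₀(w) ∫e₀ >
0`. -/

lemma intervalIntegrable_unit {f : ℝ → ℝ} (hf : ContinuousOn f (Icc 0 1)) :
    IntervalIntegrable f volume 0 1 :=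
  hf.intervalIntegrable_of_Icc zero_le_one

lemma integral_unit_congr {f g : ℝ → ℝ} (h : ∀ x ∈ Icc (0 : ℝ) 1, f x = g x) :
    ∫ x in (0 : ℝ)..1, f x = ∫ x in (0 : ℝ)..1, g x :=
  intervalIntegral.integral_congr (by rw [uIcc_of_le (zero_le_one' ℝ)]; exact h)

/-- A solution of `f'' = q f` with vanishing Cauchy data at some point vanishes. -/
lemma eq_zero_of_cauchy_data {f f' q : ℝ → ℝ} (hq : ContinuousOn q (Icc 0 1))
    (h1 : ∀ x ∈ Icc (0 : ℝ) 1, HasDerivWithinAt f (f' x) (Icc 0 1) x)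
    (h2 : ∀ x ∈ Icc (0 : ℝ) 1, HasDerivWithinAt f' (q x * f x) (Icc 0 1) x)
    {x₀ : ℝ} (hx₀ : x₀ ∈ Icc (0 : ℝ) 1) (h0 : f x₀ = 0) (h0' : f' x₀ = 0) :
    ∀ x ∈ Icc (0 : ℝ) 1, f x = 0 := by
  obtain ⟨C, hC⟩ := isCompact_Icc.exists_bound_of_continuousOn hq
  -- The equation as a first-order system for `(f, f')`, Lipschitz with constant `max 1 C`.
  -- Uniqueness against the zero solution is applied on each side of `x₀`.
  let v : ℝ → ℝ × ℝ → ℝ × ℝ := fun t p => (p.2, q t * p.1)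
  let F : ℝ → ℝ × ℝ := fun t => (f t, f' t)
  have hv : ∀ t ∈ Icc (0 : ℝ) 1, LipschitzOnWith (max 1 C.toNNReal) (v t) univ := by
    intro t ht
    refine LipschitzWith.lipschitzOnWith (LipschitzWith.of_dist_le_mul fun p r => ?_)
    have hC0 : 0 ≤ C := (norm_nonneg _).trans (hC t ht)
    have hp1 : dist p.1 r.1 ≤ dist p r := by simp [Prod.dist_eq]
    have hp2 : dist p.2 r.2 ≤ dist p r := by simp [Prod.dist_eq]
    have h1 : (1 : ℝ) ≤ ((max 1 C.toNNReal : NNReal) : ℝ) := by simp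
    have h2 : C ≤ ((max 1 C.toNNReal : NNReal) : ℝ) := by simp [hC0]
    have h3 : dist (q t * p.1) (q t * r.1) = ‖q t‖ * dist p.1 r.1 := by
      rw [Real.dist_eq, Real.dist_eq, ← mul_sub, abs_mul, Real.norm_eq_abs]
    rw [Prod.dist_eq (x := v t p)]
    refine max_le ?_ ?_
    · calc dist p.2 r.2 ≤ 1 * dist p r := by simpa using hp2
        _ ≤ _ := by gcongr
    · change dist (q t * p.1) (q t * r.1) ≤ _
      rw [h3]
      have := hC t ht
      gcongr
      exact this.trans h2
  have hF : ∀ t ∈ Icc (0 : ℝ) 1, HasDerivWithinAt F (v t (F t)) (Icc 0 1) t :=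
    fun t ht => (h1 t ht).prodMk (h2 t ht)
  have hFc : ContinuousOn F (Icc 0 1) := fun t ht => (hF t ht).continuousWithinAt
  have hz : ∀ (t : ℝ) (s : Set ℝ), HasDerivWithinAt (fun _ : ℝ => (0 : ℝ × ℝ)) (v t 0) s t := by
    intro t s
    have : v t 0 = 0 := by simp [v]
    rw [this]; exact hasDerivWithinAt_const _ _ _
  have hF0 : F x₀ = 0 := by simp [F, h0, h0']
  have hright : EqOn F (fun _ => 0) (Icc x₀ 1) := by
    refine ODE_solution_unique_of_mem_Icc_right (v := v) (s := fun _ => univ)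
      (K := max 1 C.toNNReal) (fun t ht => hv t ⟨hx₀.1.trans ht.1, ht.2.le⟩)
      (hFc.mono (Icc_subset_Icc_left hx₀.1)) (fun t ht => ?_) (fun _ _ => mem_univ _)
      continuousOn_const (fun t _ => hz t _) (fun _ _ => mem_univ _) hF0
    exact (hF t ⟨hx₀.1.trans ht.1, ht.2.le⟩).mono_of_mem_nhdsWithin
      (mem_of_superset (Icc_mem_nhdsGE ht.2) (Icc_subset_Icc_left (hx₀.1.trans ht.1)))
  have hleft : EqOn F (fun _ => 0) (Icc 0 x₀) := by
    refine ODE_solution_unique_of_mem_Icc_left (v := v) (s := fun _ => univ)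
      (K := max 1 C.toNNReal) (fun t ht => hv t ⟨ht.1.le, ht.2.trans hx₀.2⟩)
      (hFc.mono (Icc_subset_Icc_right hx₀.2)) (fun t ht => ?_) (fun _ _ => mem_univ _)
      continuousOn_const (fun t _ => hz t _) (fun _ _ => mem_univ _) hF0
    exact (hF t ⟨ht.1.le, ht.2.trans hx₀.2⟩).mono_of_mem_nhdsWithin
      (mem_of_superset (Icc_mem_nhdsLE ht.1) (Icc_subset_Icc_right (ht.2.trans hx₀.2)))
  intro x hx
  rcases le_total x x₀ with h | h
  · exact congrArg Prod.fst (hleft ⟨hx.1, h⟩)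
  · exact congrArg Prod.fst (hright ⟨h, hx.2⟩)

/-- A bounded derivative makes `H` Lipschitz. Absolute continuity is what integration by parts needs
when the other factor is the primitive of a merely integrable function, differentiable only almost
everywhere. -/
lemma absolutelyContinuousOnInterval_of_deriv {H H' : ℝ → ℝ}
    (hH : ∀ x ∈ Icc (0 : ℝ) 1, HasDerivWithinAt H (H' x) (Icc 0 1) x)
    (hH' : ContinuousOn H' (Icc 0 1)) : AbsolutelyContinuousOnInterval H 0 1 := by
  obtain ⟨C, hC⟩ := isCompact_Icc.exists_bound_of_continuousOn hH'
  refine LipschitzOnWith.absolutelyContinuousOnInterval (K := C.toNNReal) ?_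
  rw [uIcc_of_le zero_le_one]
  refine (convex_Icc (0 : ℝ) 1).lipschitzOnWith_of_nnnorm_hasDerivWithin_le hH fun x hx => ?_
  rw [← NNReal.coe_le_coe, coe_nnnorm]
  exact (hC x hx).trans (Real.le_coe_toNNReal C)

/-- Integration by parts against a primitive of an integrable function. -/
lemma integral_primitive_mul_deriv {g H H' : ℝ → ℝ} (c : ℝ)
    (hg : IntervalIntegrable g volume 0 1)
    (hH : ∀ x ∈ Icc (0 : ℝ) 1, HasDerivWithinAt H (H' x) (Icc 0 1) x)
    (hH' : ContinuousOn H' (Icc 0 1)) :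
    ∫ x in (0 : ℝ)..1, (c + ∫ y in (0 : ℝ)..x, g y) * H' x =
      (c + ∫ y in (0 : ℝ)..1, g y) * H 1 - c * H 0 - ∫ x in (0 : ℝ)..1, g x * H x := by
  have hG : AbsolutelyContinuousOnInterval (fun x => ∫ y in (0 : ℝ)..x, g y) 0 1 :=
    hg.absolutelyContinuousOnInterval_intervalIntegral (by simp)
  have hc : AbsolutelyContinuousOnInterval (fun _ : ℝ => c) 0 1 :=
    (LipschitzWith.const (α := ℝ) c).lipschitzOnWith.absolutelyContinuousOnInterval
  have hHa := absolutelyContinuousOnInterval_of_deriv hH hH'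
  have key := (hc.add hG).integral_mul_deriv_eq_deriv_mul hHa
  have e1 : ∫ x in (0 : ℝ)..1, (c + ∫ y in (0 : ℝ)..x, g y) * H' x =
      ∫ x in (0 : ℝ)..1, ((fun _ : ℝ => c) + fun x : ℝ => ∫ y in (0 : ℝ)..x, g y) x * deriv H x := by
    refine intervalIntegral.integral_congr_ae ?_
    have : ∀ᵐ x : ℝ, x ≠ 1 := by simp [ae_iff]
    filter_upwards [this] with x hx1 hx
    rw [uIoc_of_le zero_le_one] at hx
    have hx' : x ∈ Ioo (0 : ℝ) 1 := ⟨hx.1, lt_of_le_of_ne hx.2 hx1⟩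
    rw [((hH x ⟨hx.1.le, hx.2⟩).hasDerivAt (Icc_mem_nhds hx'.1 hx'.2)).deriv]
    rfl
  have e2 : ∫ x in (0 : ℝ)..1, g x * H x =
      ∫ x in (0 : ℝ)..1, deriv ((fun _ : ℝ => c) + fun x : ℝ => ∫ y in (0 : ℝ)..x, g y) x * H x := by
    refine intervalIntegral.integral_congr_ae ?_
    filter_upwards [hg.ae_hasDerivAt_integral] with x hx1 hx
    have h3 : HasDerivAt ((fun _ : ℝ => c) + fun x : ℝ => ∫ y in (0 : ℝ)..x, g y) (g x) x := by
      simpa using (hasDerivAt_const x c).add (hx1 (uIoc_subset_uIcc hx) 0 (by simp))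
    rw [h3.deriv]
  rw [e1, key, e2]
  simp

/-- At a minimum point on `[0,1]` where the derivative vanishes, the second derivative is
nonnegative. -/
lemma second_deriv_nonneg_of_min {f f' : ℝ → ℝ} {d x₀ : ℝ}
    (h1 : ∀ x ∈ Icc (0 : ℝ) 1, HasDerivWithinAt f (f' x) (Icc 0 1) x)
    (hx₀ : x₀ ∈ Icc (0 : ℝ) 1) (h2 : HasDerivWithinAt f' d (Icc 0 1) x₀) (h0 : f' x₀ = 0)
    (hmin : ∀ x ∈ Icc (0 : ℝ) 1, f x₀ ≤ f x) : 0 ≤ d := by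
  by_contra! hd
  -- If `d < 0`, then near `x₀` the sign of `f'` is negative on the right and positive on the left.
  -- The mean value theorem between `x₀` and a nearby point contradicts minimality. The left side is
  -- needed only for `x₀ = 1`.
  have hs := (hasDerivWithinAt_iff_tendsto_slope.1 h2).eventually (gt_mem_nhds hd)
  rw [eventually_nhdsWithin_iff, Metric.eventually_nhds_iff] at hs
  obtain ⟨ε, hε, hs⟩ := hs
  have hcont : ContinuousOn f (Icc 0 1) := fun x hx => (h1 x hx).continuousWithinAt
  have hder : ∀ x ∈ Ioo (0 : ℝ) 1, HasDerivAt f (f' x) x := fun x hx =>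
    (h1 x (Ioo_subset_Icc_self hx)).hasDerivAt (Icc_mem_nhds hx.1 hx.2)
  rcases lt_or_ge x₀ 1 with hlt | hge
  · set y := min 1 (x₀ + ε / 2) with hy
    have hxy : x₀ < y := lt_min hlt (by linarith)
    have hy1 : y ≤ 1 := min_le_left _ _
    have hye : y ≤ x₀ + ε / 2 := min_le_right _ _
    obtain ⟨c, hc, hceq⟩ := exists_hasDerivAt_eq_slope f f' hxy
      (hcont.mono (Icc_subset_Icc hx₀.1 hy1))
      (fun x hx => hder x ⟨hx₀.1.trans_lt hx.1, hx.2.trans_le hy1⟩)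
    have hc' := @hs c (by rw [Real.dist_eq, abs_of_pos (by linarith [hc.1])]; linarith [hc.2])
      ⟨⟨hx₀.1.trans hc.1.le, hc.2.le.trans hy1⟩, by simpa using hc.1.ne'⟩
    rw [slope_def_field, h0, sub_zero, div_neg_iff] at hc'
    have h3 : 0 ≤ f' c := by
      rw [hceq]
      exact div_nonneg (by linarith [hmin y ⟨hx₀.1.trans hxy.le, hy1⟩]) (by linarith)
    rcases hc' with h | h
    · linarith [h.2, hc.1]
    · linarith [h.1]
  · have hx1 : x₀ = 1 := le_antisymm hx₀.2 hge
    set y := max 0 (x₀ - ε / 2) with hy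
    have hxy : y < x₀ := max_lt (by linarith) (by linarith)
    have hy0 : 0 ≤ y := le_max_left _ _
    have hye : x₀ - ε / 2 ≤ y := le_max_right _ _
    obtain ⟨c, hc, hceq⟩ := exists_hasDerivAt_eq_slope f f' hxy
      (hcont.mono (Icc_subset_Icc hy0 hx₀.2))
      (fun x hx => hder x ⟨hy0.trans_lt hx.1, hx.2.trans_le hx₀.2⟩)
    have hc' := @hs c (by rw [Real.dist_eq, abs_of_neg (by linarith [hc.2])]; linarith [hc.1])
      ⟨⟨hy0.trans hc.1.le, hc.2.le.trans hx₀.2⟩, by simpa using hc.2.ne⟩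
    rw [slope_def_field, h0, sub_zero, div_neg_iff] at hc'
    have h3 : f' c ≤ 0 := by
      rw [hceq]
      exact div_nonpos_of_nonpos_of_nonneg
        (by linarith [hmin y ⟨hy0, hxy.le.trans hx₀.2⟩]) (by linarith)
    rcases hc' with h | h
    · linarith [h.1]
    · linarith [h.2, hc.2]

/-! ### Functions satisfying the Neumann condition -/

/-- `f` is twice continuously differentiable on `[0,1]`, with derivatives `f'` and `f''`, and
satisfies the Neumann boundary conditions. -/
structure NeumannC2 (f f' f'' : ℝ → ℝ) : Prop where
  deriv_one : ∀ x ∈ Icc (0 : ℝ) 1, HasDerivWithinAt f (f' x) (Icc 0 1) x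
  deriv_two : ∀ x ∈ Icc (0 : ℝ) 1, HasDerivWithinAt f' (f'' x) (Icc 0 1) x
  continuousOn_two : ContinuousOn f'' (Icc 0 1)
  left : f' 0 = 0
  right : f' 1 = 0

namespace NeumannC2

variable {f f' f'' : ℝ → ℝ}

lemma continuousOn (h : NeumannC2 f f' f'') : ContinuousOn f (Icc 0 1) :=
  fun x hx => (h.deriv_one x hx).continuousWithinAt

lemma continuousOn_one (h : NeumannC2 f f' f'') : ContinuousOn f' (Icc 0 1) :=
  fun x hx => (h.deriv_two x hx).continuousWithinAt

lemma sum {ι : Type*} (s : Finset ι) (a : ι → ℝ) {f f' f'' : ι → ℝ → ℝ}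
    (h : ∀ i, NeumannC2 (f i) (f' i) (f'' i)) :
    NeumannC2 (fun x => ∑ i ∈ s, a i * f i x) (fun x => ∑ i ∈ s, a i * f' i x)
      (fun x => ∑ i ∈ s, a i * f'' i x) where
  deriv_one x hx := HasDerivWithinAt.fun_sum fun i _ => ((h i).deriv_one x hx).const_mul (a i)
  deriv_two x hx := HasDerivWithinAt.fun_sum fun i _ => ((h i).deriv_two x hx).const_mul (a i)
  continuousOn_two := continuousOn_finsetSum _ fun i _ => (h i).continuousOn_two.const_mul (a i)
  left := by simp [(h _).left]
  right := by simp [(h _).right]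

lemma integral_primitive_mul (h : NeumannC2 f f' f'') {g : ℝ → ℝ} (c : ℝ)
    (hg : IntervalIntegrable g volume 0 1) :
    ∫ x in (0 : ℝ)..1, (c + ∫ y in (0 : ℝ)..x, g y) * f'' x =
      - ∫ x in (0 : ℝ)..1, g x * f' x := by
  rw [integral_primitive_mul_deriv c hg h.deriv_two h.continuousOn_two, h.left, h.right]
  ring

lemma integral_mul_second (h : NeumannC2 f f' f'') {g g' : ℝ → ℝ}
    (hg : ∀ x ∈ Icc (0 : ℝ) 1, HasDerivWithinAt g (g' x) (Icc 0 1) x)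
    (hg' : ContinuousOn g' (Icc 0 1)) :
    ∫ x in (0 : ℝ)..1, g x * f'' x = - ∫ x in (0 : ℝ)..1, g' x * f' x := by
  rw [intervalIntegral.integral_mul_deriv_eq_deriv_mul_of_hasDerivWithinAt (u' := g')
    (v := f') (v' := f'') (by simpa using hg) (by simpa using h.deriv_two)
    (intervalIntegrable_unit hg') (intervalIntegrable_unit h.continuousOn_two), h.left, h.right]
  ring

lemma integral_symm (h : NeumannC2 f f' f'') {g g' g'' : ℝ → ℝ} (hg : NeumannC2 g g' g'') :
    ∫ x in (0 : ℝ)..1, g x * f'' x = ∫ x in (0 : ℝ)..1, f x * g'' x := by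
  rw [h.integral_mul_second hg.deriv_one hg.continuousOn_one,
    hg.integral_mul_second h.deriv_one h.continuousOn_one]
  simp only [mul_comm]

lemma integral_second (h : NeumannC2 f f' f'') : ∫ x in (0 : ℝ)..1, f'' x = 0 := by
  have := h.integral_mul_second (g := fun _ => 1) (g' := fun _ => 0)
    (fun x _ => hasDerivWithinAt_const _ _ _) continuousOn_const
  simpa using this

end NeumannC2

/-! ### Neumann eigenfunctions -/

/-- The definition asks no continuity of `f''`; the equation supplies it, since `f''` equals the
continuous function `(V - lam) f` on `[0,1]`. -/
lemma IsNeumannEigenfunction.exists_neumannC2 {V f : ℝ → ℝ} {lam : ℝ}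
    (hV : ContinuousOn V (Icc 0 1)) (h : IsNeumannEigenfunction V lam f) :
    ∃ f' : ℝ → ℝ, NeumannC2 f f' (fun x => (V x - lam) * f x) := by
  obtain ⟨f', f'', h1, h2, h3, h4, h5⟩ := h
  have hf : ContinuousOn f (Icc 0 1) := fun x hx => (h1 x hx).continuousWithinAt
  refine ⟨f', h1, fun x hx => ?_, (hV.sub continuousOn_const).mul hf, h4, h5⟩
  have : (V x - lam) * f x = f'' x := by linarith [h3 x hx]
  rw [this]
  exact h2 x hx

lemma IsNeumannEigenfunction.continuousOn {V f : ℝ → ℝ} {lam : ℝ}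
    (h : IsNeumannEigenfunction V lam f) : ContinuousOn f (Icc 0 1) := by
  obtain ⟨f', f'', h1, -⟩ := h
  exact fun x hx => (h1 x hx).continuousWithinAt

lemma IsNeumannEigenfunction.linear_combination {V f g : ℝ → ℝ} {lam : ℝ}
    (hf : IsNeumannEigenfunction V lam f) (hg : IsNeumannEigenfunction V lam g) (a b : ℝ) :
    IsNeumannEigenfunction V lam (fun x => a * f x + b * g x) := by
  obtain ⟨f', f'', h1, h2, h3, h4, h5⟩ := hf
  obtain ⟨g', g'', k1, k2, k3, k4, k5⟩ := hg
  refine ⟨fun x => a * f' x + b * g' x, fun x => a * f'' x + b * g'' x,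
    fun x hx => ((h1 x hx).const_mul a).add ((k1 x hx).const_mul b),
    fun x hx => ((h2 x hx).const_mul a).add ((k2 x hx).const_mul b), fun x hx => ?_,
    by simp [h4, k4], by simp [h5, k5]⟩
  linear_combination a * h3 x hx + b * k3 x hx

lemma IsNeumannEigenfunction.eq_zero_of_cauchy_data {V f f' f'' : ℝ → ℝ} {lam x₀ : ℝ}
    (hV : ContinuousOn V (Icc 0 1)) (h : NeumannC2 f f' f'')
    (hf : ∀ x ∈ Icc (0 : ℝ) 1, f'' x = (V x - lam) * f x)
    (hx₀ : x₀ ∈ Icc (0 : ℝ) 1) (h0 : f x₀ = 0) (h0' : f' x₀ = 0) :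
    ∀ x ∈ Icc (0 : ℝ) 1, f x = 0 :=
  KoopmanHeat.eq_zero_of_cauchy_data (hV.sub (continuousOn_const (c := lam))) h.deriv_one
    (fun x hx => hf x hx ▸ h.deriv_two x hx) hx₀ h0 h0'

/-- Neumann eigenvalues are simple. -/
lemma IsNeumannEigenfunction.exists_eq_mul {V f g : ℝ → ℝ} {lam : ℝ}
    (hV : ContinuousOn V (Icc 0 1)) (hf : IsNeumannEigenfunction V lam f)
    (hg : IsNeumannEigenfunction V lam g) (hg0 : ∃ x ∈ Icc (0 : ℝ) 1, g x ≠ 0) :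
    ∃ c : ℝ, ∀ x ∈ Icc (0 : ℝ) 1, f x = c * g x := by
  have h00 : (0 : ℝ) ∈ Icc (0 : ℝ) 1 := by simp
  -- The Neumann condition already gives `g'(0) = 0`, so `g 0 = 0` would make all Cauchy data at 0
  -- vanish. The same argument then kills `f - (f 0 / g 0) g`.
  have hg00 : g 0 ≠ 0 := by
    intro h0
    obtain ⟨g', hg'⟩ := hg.exists_neumannC2 hV
    obtain ⟨x, hx, hgx⟩ := hg0
    exact hgx (IsNeumannEigenfunction.eq_zero_of_cauchy_data hV hg' (fun _ _ => rfl) h00 h0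
      hg'.left x hx)
  refine ⟨f 0 / g 0, fun x hx => ?_⟩
  obtain ⟨k', hk⟩ := (hf.linear_combination hg 1 (-(f 0 / g 0))).exists_neumannC2 hV
  have := IsNeumannEigenfunction.eq_zero_of_cauchy_data hV hk (fun _ _ => rfl) h00
    (by field_simp; ring) hk.left x hx
  linarith

/-- Green's identity without boundary terms gives `(nu - lam) ∫ f g = 0`. -/
lemma IsNeumannEigenfunction.integral_mul_eq_zero {V f g : ℝ → ℝ} {lam nu : ℝ}
    (hV : ContinuousOn V (Icc 0 1)) (hf : IsNeumannEigenfunction V lam f)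
    (hg : IsNeumannEigenfunction V nu g) (hne : lam ≠ nu) :
    ∫ x in (0 : ℝ)..1, f x * g x = 0 := by
  obtain ⟨f', hf'⟩ := hf.exists_neumannC2 hV
  obtain ⟨g', hg'⟩ := hg.exists_neumannC2 hV
  have h := hf'.integral_symm hg'
  have i1 := intervalIntegrable_unit (hf'.continuousOn.fun_mul hg'.continuousOn_two)
  have i2 := intervalIntegrable_unit (hg'.continuousOn.fun_mul hf'.continuousOn_two)
  rw [← sub_eq_zero, ← intervalIntegral.integral_sub i2 i1,
    integral_unit_congr (g := fun x => (nu - lam) * (f x * g x)) (fun x _ => by ring),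
    intervalIntegral.integral_const_mul, mul_eq_zero] at h
  exact h.resolve_left (sub_ne_zero.2 hne.symm)


/-! ### Sobolev functions on `[0,1]` -/

lemma intervalIntegrable_of_memLp {g : ℝ → ℝ} (hg : MemLp g 2 (volume.restrict (Icc 0 1))) :
    IntervalIntegrable g volume 0 1 := by
  rw [intervalIntegrable_iff_integrableOn_Icc_of_le zero_le_one]
  exact hg.integrable (by norm_num)

lemma continuousOn_primitive_unit {g : ℝ → ℝ} (hg : IntervalIntegrable g volume 0 1) :
    ContinuousOn (fun x => ∫ y in (0 : ℝ)..x, g y) (Icc 0 1) := by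
  have := intervalIntegral.continuousOn_primitive_interval' hg (a := 0) (by simp)
  rwa [uIcc_of_le zero_le_one] at this

lemma exists_Icc_of_isCompact {K : Set ℝ} (hK : IsCompact K) (h : K ⊆ Ioo 0 1) :
    ∃ a b : ℝ, 0 < a ∧ b < 1 ∧ K ⊆ Icc a b := by
  rcases K.eq_empty_or_nonempty with rfl | hne
  · exact ⟨1 / 2, 1 / 2, by norm_num, by norm_num, empty_subset _⟩
  · obtain ⟨a, ha⟩ := hK.exists_isLeast hne
    obtain ⟨b, hb⟩ := hK.exists_isGreatest hne
    exact ⟨a, b, (h ha.1).1, (h hb.1).2, fun x hx => ⟨ha.2 hx, hb.2 hx⟩⟩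

lemma integral_eq_integral_unit {f : ℝ → ℝ} (h : ∀ x, x ∉ Ioo (0 : ℝ) 1 → f x = 0) :
    ∫ x, f x = ∫ x in (0 : ℝ)..1, f x := by
  refine (intervalIntegral.integral_eq_integral_of_support_subset fun x hx => ?_).symm
  by_contra hx'
  exact hx (h x fun h2 => hx' (Ioo_subset_Ioc_self h2))

/-- A test function of vanishing integral is the derivative of a test function. -/
lemma exists_test_primitive {χ : ℝ → ℝ} (h1 : ContDiff ℝ (⊤ : ℕ∞) χ)
    (h2 : HasCompactSupport χ) (h3 : tsupport χ ⊆ Ioo 0 1) (h4 : ∫ x, χ x = 0) :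
    ∃ φ : ℝ → ℝ, ContDiff ℝ (⊤ : ℕ∞) φ ∧ HasCompactSupport φ ∧ tsupport φ ⊆ Ioo 0 1 ∧
      deriv φ = χ := by
  obtain ⟨a, b, ha, hb, hab⟩ := exists_Icc_of_isCompact h2 h3
  have hz : ∀ x, x ∉ Icc a b → χ x = 0 := fun x hx => image_eq_zero_of_notMem_tsupport
    fun h => hx (hab h)
  have hd : ∀ x, HasDerivAt (fun x => ∫ y in (0 : ℝ)..x, χ y) (χ x) x := fun x =>
    intervalIntegral.integral_hasDerivAt_right (h1.continuous.intervalIntegrable _ _)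
      h1.continuous.aestronglyMeasurable.stronglyMeasurableAtFilter h1.continuous.continuousAt
  have hdφ : deriv (fun x => ∫ y in (0 : ℝ)..x, χ y) = χ := funext fun x => (hd x).deriv
  have h01 : ∫ x in (0 : ℝ)..1, χ x = 0 := by
    rw [← integral_eq_integral_unit, h4]
    exact fun x hx => image_eq_zero_of_notMem_tsupport fun h => hx (h3 h)
  have hsupp : tsupport (fun x => ∫ y in (0 : ℝ)..x, χ y) ⊆ Icc a b := by
    refine closure_minimal (fun x hx => ?_) isClosed_Icc
    by_contra hx'
    refine hx ?_
    rw [mem_Icc, not_and_or, not_le, not_le] at hx'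
    rcases hx' with h | h
    · have : ∫ y in (0 : ℝ)..x, χ y = ∫ y in (0 : ℝ)..x, (0 : ℝ) :=
        intervalIntegral.integral_congr fun y hy => hz y fun hy' => by
          rcases mem_uIcc.1 hy with h' | h' <;> linarith [h'.1, h'.2, hy'.1]
      simpa using this
    -- To the right of the support, the primitive from 0 is the integral over `[0,1]`, which
    -- vanishes by hypothesis, plus the integral from 1 to `x`, where `χ` is zero.
    · have : ∫ y in (1 : ℝ)..x, χ y = ∫ y in (1 : ℝ)..x, (0 : ℝ) :=
        intervalIntegral.integral_congr fun y hy => hz y fun hy' => by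
          rcases mem_uIcc.1 hy with h' | h' <;> linarith [h'.1, h'.2, hy'.2]
      change ∫ y in (0 : ℝ)..x, χ y = 0
      rw [← intervalIntegral.integral_add_adjacent_intervals
        (h1.continuous.intervalIntegrable 0 1) (h1.continuous.intervalIntegrable 1 x), h01, this]
      simp
  refine ⟨_, contDiff_infty_iff_deriv.2 ⟨fun x => (hd x).differentiableAt, by rwa [hdφ]⟩,
    isCompact_Icc.of_isClosed_subset (isClosed_tsupport _) hsupp,
    hsupp.trans (Icc_subset_Ioo ha hb), hdφ⟩

/-- The **du Bois-Reymond lemma**: a continuous function with vanishing weak derivative is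
constant. -/
lemma exists_eq_const_of_weakDeriv_zero {h : ℝ → ℝ} (hc : ContinuousOn h (Icc 0 1))
    (hw : ∀ φ : ℝ → ℝ, ContDiff ℝ (⊤ : ℕ∞) φ → HasCompactSupport φ → tsupport φ ⊆ Ioo 0 1 →
      ∫ x in (0 : ℝ)..1, h x * deriv φ x = 0) :
    ∃ c : ℝ, ∀ x ∈ Icc (0 : ℝ) 1, h x = c := by
  let B : ContDiffBump (1 / 2 : ℝ) := ⟨1 / 8, 1 / 4, by norm_num, by norm_num⟩
  set ψ : ℝ → ℝ := B.normed volume with hψ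
  have hψ1 : ContDiff ℝ (⊤ : ℕ∞) ψ := B.contDiff_normed
  have hψ2 : HasCompactSupport ψ := B.hasCompactSupport_normed
  have hψ3 : tsupport ψ ⊆ Ioo 0 1 := by
    rw [hψ, B.tsupport_normed_eq, Real.closedBall_eq_Icc]
    exact Icc_subset_Ioo (by simp [B]; norm_num) (by simp [B]; norm_num)
  have hψ4 : ∫ x, ψ x = 1 := B.integral_normed
  refine ⟨∫ x in (0 : ℝ)..1, h x * ψ x, ?_⟩
  set c := ∫ x in (0 : ℝ)..1, h x * ψ x with hcdef
  have hloc : LocallyIntegrableOn (fun x => h x - c) (Ioo 0 1) volume :=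
    ((hc.mono Ioo_subset_Icc_self).sub continuousOn_const).locallyIntegrableOn measurableSet_Ioo
  have hae := isOpen_Ioo.ae_eq_zero_of_integral_contDiff_smul_eq_zero hloc (by
    intro g hg1 hg2 hg3
    set k := ∫ x, g x with hk
    have hts : tsupport (fun x => g x - k * ψ x) ⊆ tsupport g ∪ tsupport ψ := by
      refine closure_minimal (fun x hx => ?_) ((isClosed_tsupport _).union (isClosed_tsupport _))
      by_contra hx'
      rw [mem_union, not_or] at hx'
      exact hx (by simp [image_eq_zero_of_notMem_tsupport hx'.1,
        image_eq_zero_of_notMem_tsupport hx'.2])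
    -- Subtracting `(∫ g) ψ` from a test function `g` leaves integral zero, hence the derivative of
    -- a test function. Testing with it yields `∫ h g = c ∫ g`.
    obtain ⟨φ, hφ1, hφ2, hφ3, hφ4⟩ := exists_test_primitive (χ := fun x => g x - k * ψ x)
      (hg1.sub (contDiff_const.mul hψ1))
      ((hg2.isCompact.union hψ2.isCompact).of_isClosed_subset (isClosed_tsupport _) hts)
      (hts.trans (union_subset hg3 hψ3)) (by
        rw [integral_sub (hg1.continuous.integrable_of_hasCompactSupport hg2)
          ((hψ1.continuous.integrable_of_hasCompactSupport hψ2).const_mul k),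
          integral_const_mul, hψ4, ← hk]
        ring)
    have h0 := hw φ hφ1 hφ2 hφ3
    rw [hφ4] at h0
    rw [integral_eq_integral_unit (fun x hx => by
      simp [image_eq_zero_of_notMem_tsupport fun h => hx (hg3 h)])]
    have hk' : k = ∫ x in (0 : ℝ)..1, g x := integral_eq_integral_unit
      (fun x hx => image_eq_zero_of_notMem_tsupport fun h => hx (hg3 h))
    have ig := intervalIntegrable_unit (hc.fun_mul hg1.continuous.continuousOn)
    have ip := intervalIntegrable_unit (hc.fun_mul hψ1.continuous.continuousOn)
    have ig' := hg1.continuous.intervalIntegrable (μ := volume) 0 1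
    have e1 : ∫ x in (0 : ℝ)..1, h x * (g x - k * ψ x) =
        (∫ x in (0 : ℝ)..1, h x * g x) - k * c := by
      rw [hcdef, ← intervalIntegral.integral_const_mul,
        ← intervalIntegral.integral_sub ig (ip.const_mul k)]
      exact integral_unit_congr fun x _ => by ring
    have e2 : ∫ x in (0 : ℝ)..1, g x • (h x - c) =
        (∫ x in (0 : ℝ)..1, h x * g x) - k * c := by
      rw [hk', mul_comm _ c, ← intervalIntegral.integral_const_mul,
        ← intervalIntegral.integral_sub ig (ig'.const_mul c)]
      exact integral_unit_congr fun x _ => by simp only [smul_eq_mul]; ring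
    rw [e2, ← e1, h0])
  refine Measure.eqOn_Icc_of_ae_eq (μ := volume) zero_ne_one ?_ hc continuousOn_const
  rw [← restrict_Ioo_eq_restrict_Icc, EventuallyEq, ae_restrict_iff' measurableSet_Ioo]
  filter_upwards [hae] with x hx hx'
  linarith [hx hx']

/-- `f` minus the primitive of `g` has zero weak derivative, so du Bois-Reymond applies. This turns
the weak definition of `H¹` into the concrete form `c + ∫₀ˣ g` used from here on. -/
lemma HasWeakDeriv.exists_eq_primitive {f g : ℝ → ℝ} (hf : ContinuousOn f (Icc 0 1))
    (hg : IntervalIntegrable g volume 0 1) (h : HasWeakDeriv f g) :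
    ∃ c : ℝ, ∀ x ∈ Icc (0 : ℝ) 1, f x = c + ∫ y in (0 : ℝ)..x, g y := by
  have hG := continuousOn_primitive_unit hg
  obtain ⟨c, hc⟩ := exists_eq_const_of_weakDeriv_zero (hf.sub hG) (by
    intro φ h1 h2 h3
    have hφz : ∀ x, x ∉ Ioo (0 : ℝ) 1 → φ x = 0 := fun x hx =>
      image_eq_zero_of_notMem_tsupport fun h => hx (h3 h)
    have hd : Continuous (deriv φ) := h1.continuous_deriv (by simp)
    have hb := integral_primitive_mul_deriv (H := φ) (H' := deriv φ) 0 hg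
      (fun x _ => ((h1.differentiable (by simp)) x).hasDerivAt.hasDerivWithinAt) hd.continuousOn
    rw [hφz 1 (by simp), hφz 0 (by simp)] at hb
    simp only [zero_add, mul_zero, sub_self] at hb
    simp only [Pi.sub_apply, sub_mul]
    rw [intervalIntegral.integral_sub (intervalIntegrable_unit (hf.fun_mul hd.continuousOn))
      (intervalIntegrable_unit (hG.fun_mul hd.continuousOn)), h φ h1 h2 h3, hb]
    ring)
  exact ⟨c, fun x hx => by linarith [show f x - _ = c from hc x hx]⟩

lemma hasWeakDeriv_of_deriv {f f' : ℝ → ℝ}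
    (h1 : ∀ x ∈ Icc (0 : ℝ) 1, HasDerivWithinAt f (f' x) (Icc 0 1) x)
    (h2 : ContinuousOn f' (Icc 0 1)) : HasWeakDeriv f f' := by
  intro φ k1 k2 k3
  have hφz : ∀ x, x ∉ Ioo (0 : ℝ) 1 → φ x = 0 := fun x hx =>
    image_eq_zero_of_notMem_tsupport fun h => hx (k3 h)
  rw [intervalIntegral.integral_mul_deriv_eq_deriv_mul_of_hasDerivWithinAt (by simpa using h1)
    (fun x _ => ((k1.differentiable (by simp)) x).hasDerivAt.hasDerivWithinAt)
    (intervalIntegrable_unit h2) ((k1.continuous_deriv (by simp)).intervalIntegrable _ _),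
    hφz 0 (by simp), hφz 1 (by simp)]
  ring

lemma memLp_unit {f : ℝ → ℝ} (hf : ContinuousOn f (Icc 0 1)) :
    MemLp f 2 (volume.restrict (Icc 0 1)) := by
  obtain ⟨C, hC⟩ := isCompact_Icc.exists_bound_of_continuousOn hf
  exact MemLp.of_bound (hf.aestronglyMeasurable measurableSet_Icc) C
    ((ae_restrict_iff' measurableSet_Icc).2 (Eventually.of_forall hC))

lemma mem_PPlus_of_deriv {f f' : ℝ → ℝ}
    (h1 : ∀ x ∈ Icc (0 : ℝ) 1, HasDerivWithinAt f (f' x) (Icc 0 1) x)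
    (h2 : ContinuousOn f' (Icc 0 1)) (h3 : ∀ x ∈ Icc (0 : ℝ) 1, 0 < f x) : f ∈ PPlus :=
  have hf : ContinuousOn f (Icc 0 1) := fun x hx => (h1 x hx).continuousWithinAt
  ⟨hf, h3, memLp_unit hf, f', memLp_unit h2, hasWeakDeriv_of_deriv h1 h2⟩

lemma mem_POne_congr {f g : ℝ → ℝ} (hf : f ∈ POne) (h : ∀ x ∈ Icc (0 : ℝ) 1, g x = f x) :
    g ∈ POne := by
  obtain ⟨⟨h1, h2, h3, k, h4, h5⟩, h6⟩ := hf
  refine ⟨⟨h1.congr h, fun x hx => h x hx ▸ h2 x hx, h3.ae_eq ?_, k, h4, ?_⟩, ?_⟩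
  · exact (ae_restrict_iff' measurableSet_Icc).2 (Eventually.of_forall fun x hx => (h x hx).symm)
  · intro φ k1 k2 k3
    rw [← h5 φ k1 k2 k3]
    exact integral_unit_congr fun x hx => by rw [h x hx]
  · exact (integral_unit_congr h).trans h6


/-! ### An abstract completeness theorem -/

section Abstract

variable {X H : Type*} [NormedAddCommGroup X] [InnerProductSpace ℝ X] [CompleteSpace X]
  [NormedAddCommGroup H] [InnerProductSpace ℝ H] [CompleteSpace H]

open ContinuousLinearMap in
/-- Let `J : X → H` be compact with dense range, and let `A` be a symmetric coercive operator on
`X`. A vector which is orthogonal to `J w` for all weak solutions `w` of `A w = lam J† J w`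
vanishes. -/
theorem eq_zero_of_orthogonal_weak_eigenvectors (J : X →L[ℝ] H) (hJ : IsCompactOperator J)
    (hJd : ∀ f : H, (∀ x, inner ℝ f (J x) = 0) → f = 0) (A : X →L[ℝ] X)
    (hA : ∀ x y, inner ℝ (A x) y = inner ℝ x (A y)) {C : ℝ} (hC : 0 < C)
    (hAC : ∀ x, C * ‖x‖ * ‖x‖ ≤ inner ℝ (A x) x) (F : H)
    (hF : ∀ (w : X) (lam : ℝ), (∀ y, inner ℝ (A w) y = lam * inner ℝ (J w) (J y)) →
      inner ℝ (J w) F = 0) : F = 0 := by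
  let B : X →L[ℝ] X →L[ℝ] ℝ := LinearMap.mkContinuous₂ ((innerₗ X).comp A.toLinearMap) ‖A‖ (by
    intro x y
    simp only [LinearMap.coe_comp, ContinuousLinearMap.coe_coe, Function.comp_apply,
      innerₗ_apply_apply]
    exact (norm_inner_le_norm _ _).trans (by gcongr; exact A.le_opNorm x))
  have hB : ∀ x y, B x y = inner ℝ (A x) y := fun x y => rfl
  have hBc : IsCoercive B := ⟨C, hC, fun x => by rw [hB]; exact hAC x⟩
  let T := hBc.continuousLinearEquivOfBilin
  have hT : ∀ x, T x = A x := fun x => ext_inner_right ℝ fun y => by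
    rw [hBc.continuousLinearEquivOfBilin_apply, hB]
  have hTs : ∀ z, A (T.symm z) = z := fun z => by rw [← hT, T.apply_symm_apply]
  -- `T` is `A`, inverted by Lax–Milgram. The operator `J A⁻¹ J†` is compact and symmetric, so its
  -- eigenspaces span a dense subspace; it remains to see that `F` is orthogonal to each of them.
  let K : H →L[ℝ] H := J ∘L (T.symm : X →L[ℝ] X) ∘L adjoint J
  have hKa : ∀ f, K f = J (T.symm (adjoint J f)) := fun f => rfl
  have hK : IsCompactOperator K := hJ.comp_clm ((T.symm : X →L[ℝ] X) ∘L adjoint J)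
  have hKs : (K : H →ₗ[ℝ] H).IsSymmetric := by
    intro f g
    change inner ℝ (K f) g = inner ℝ f (K g)
    have h1 : inner ℝ (K f) g = inner ℝ (T.symm (adjoint J f)) (A (T.symm (adjoint J g))) := by
      rw [hKa, hTs, adjoint_inner_right]
    have h2 : inner ℝ f (K g) = inner ℝ (A (T.symm (adjoint J f))) (T.symm (adjoint J g)) := by
      rw [hKa, hTs, adjoint_inner_left]
    rw [h1, h2, hA]
  have key := orthogonalComplement_iSup_eigenspaces_eq_bot hK hKs
  have hmem : F ∈ (⨆ μ, Module.End.eigenspace (K : Module.End ℝ H) μ)ᗮ := by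
    rw [← Submodule.iInf_orthogonal, Submodule.mem_iInf]
    intro κ
    rw [Submodule.mem_orthogonal]
    intro G hG
    rw [Module.End.mem_eigenspace_iff] at hG
    have hG' : J (T.symm (adjoint J G)) = κ • G := hG
    set z := T.symm (adjoint J G) with hz
    have hAz : A z = adjoint J G := hTs _
    -- For `κ = 0` coercivity gives `z = 0`, and the dense range of `J` then gives `G = 0`. For `κ ≠
    -- 0` the vector `κ⁻¹ z` is a weak eigenvector with eigenvalue `κ⁻¹`, mapped by `J` to `G`.
    by_cases hκ : κ = 0
    · rw [hκ, zero_smul] at hG'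
      have h1 : inner ℝ (A z) z = 0 := by
        rw [hAz, adjoint_inner_left, hG', inner_zero_right]
      have h2 : z = 0 := by
        by_contra hne
        have h3 : 0 < ‖z‖ := norm_pos_iff.2 hne
        have := hAC z
        rw [h1] at this
        exact absurd this (not_le.2 (by positivity))
      have h3 : G = 0 := hJd G fun x => by
        rw [← adjoint_inner_left, ← hAz, h2, map_zero, inner_zero_left]
      rw [h3, inner_zero_left]
    · have h1 : J (κ⁻¹ • z) = G := by rw [map_smul, hG', inv_smul_smul₀ hκ]
      have h2 := hF (κ⁻¹ • z) κ⁻¹ fun y => by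
        rw [h1, map_smul, hAz, real_inner_smul_left, adjoint_inner_left]
      rwa [h1] at h2
  rw [key] at hmem
  exact hmem

end Abstract

/-! ### The Hilbert spaces -/

/-- The Hilbert space `L²(]0,1])`. -/
noncomputable abbrev L2Unit := Lp ℝ 2 (volume.restrict (Ioc (0 : ℝ) 1))

/-- The pairs `(c, g)`, which represent the functions `c + ∫₀ˣ g`. -/
noncomputable abbrev H1Data := WithLp 2 (ℝ × L2Unit)

/-- The indicator function of `]0,t]`. -/
noncomputable def indicatorL2 (t : ℝ) : L2Unit :=
  indicatorConstLp 2 (measurableSet_Ioc (a := (0 : ℝ)) (b := t)) (by finiteness) (1 : ℝ)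

/-- The vector representing the evaluation of `c + ∫₀ˣ g` at `t`. -/
noncomputable def evalKernel (t : ℝ) : H1Data := WithLp.toLp 2 (1, indicatorL2 t)

lemma inner_indicatorL2 {t : ℝ} (ht : t ∈ Icc (0 : ℝ) 1) (g : L2Unit) :
    inner ℝ (indicatorL2 t) g = ∫ y in (0 : ℝ)..t, g y := by
  rw [indicatorL2, L2.inner_indicatorConstLp_one, Measure.restrict_restrict measurableSet_Ioc,
    intervalIntegral.integral_of_le ht.1, Ioc_inter_Ioc]
  simp [ht.2]

lemma inner_evalKernel {t : ℝ} (ht : t ∈ Icc (0 : ℝ) 1) (x : H1Data) :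
    inner ℝ (evalKernel t) x = x.fst + ∫ y in (0 : ℝ)..t, x.snd y := by
  rw [WithLp.prod_inner_apply, ← inner_indicatorL2 ht]
  simp [evalKernel]

lemma inner_indicatorL2_indicatorL2 {s t : ℝ} (hs : s ∈ Icc (0 : ℝ) 1) (ht : t ∈ Icc (0 : ℝ) 1) :
    inner ℝ (indicatorL2 s) (indicatorL2 t) = min s t := by
  rw [indicatorL2, indicatorL2, L2.real_inner_indicatorConstLp_one_indicatorConstLp_one,
    Measure.real, Measure.restrict_apply (measurableSet_Ioc.inter measurableSet_Ioc),
    Ioc_inter_Ioc, Ioc_inter_Ioc]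
  have h : min (min s t) 1 = min s t := min_eq_left (min_le_of_left_le hs.2)
  rw [h, Real.volume_Ioc, max_self, max_self, sub_zero, ENNReal.toReal_ofReal (le_min hs.1 ht.1)]

/-- Point evaluation on `H¹` is Hölder continuous of exponent `1/2` in the point. The compactness of
the embedding rests on this. -/
lemma norm_sq_evalKernel_sub {s t : ℝ} (hs : s ∈ Icc (0 : ℝ) 1) (ht : t ∈ Icc (0 : ℝ) 1) :
    ‖evalKernel s - evalKernel t‖ ^ 2 = |s - t| := by
  rw [← real_inner_self_eq_norm_sq, WithLp.prod_inner_apply]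
  simp only [evalKernel, WithLp.ofLp_sub, Prod.fst_sub, Prod.snd_sub, sub_self, inner_zero_left,
    zero_add]
  rw [real_inner_sub_sub_self, inner_indicatorL2_indicatorL2 hs hs,
    inner_indicatorL2_indicatorL2 ht ht, inner_indicatorL2_indicatorL2 hs ht, min_self, min_self]
  rcases le_total s t with h | h
  · rw [min_eq_left h, abs_of_nonpos (by linarith)]; ring
  · rw [min_eq_right h, abs_of_nonneg (by linarith)]; ring

lemma continuousOn_evalKernel : ContinuousOn evalKernel (Icc 0 1) := by
  intro t ht
  rw [ContinuousWithinAt, tendsto_iff_norm_sub_tendsto_zero]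
  have h1 : Tendsto (fun s : ℝ => √|s - t|) (𝓝[Icc 0 1] t) (𝓝 0) := by
    have : Continuous fun s : ℝ => √|s - t| := by fun_prop
    simpa using (this.tendsto t).mono_left nhdsWithin_le_nhds
  refine h1.congr' ?_
  filter_upwards [self_mem_nhdsWithin] with s hs
  rw [← norm_sq_evalKernel_sub hs ht, Real.sqrt_sq (norm_nonneg _)]

lemma ae_unit {p : ℝ → Prop} (h : ∀ x ∈ Icc (0 : ℝ) 1, p x) :
    ∀ᵐ x ∂(volume.restrict (Ioc (0 : ℝ) 1)), p x :=
  (ae_restrict_iff' measurableSet_Ioc).2 (Eventually.of_forall fun x hx =>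
    h x (Ioc_subset_Icc_self hx))

lemma memLp_Ioc {f : ℝ → ℝ} (hf : ContinuousOn f (Icc 0 1)) :
    MemLp f 2 (volume.restrict (Ioc 0 1)) :=
  (memLp_unit hf).mono_measure (Measure.restrict_mono_set _ Ioc_subset_Icc_self)

lemma norm_toLp_le {f : ℝ → ℝ} (hf : MemLp f 2 (volume.restrict (Ioc (0 : ℝ) 1))) {C : ℝ}
    (hC : 0 ≤ C) (h : ∀ x ∈ Icc (0 : ℝ) 1, |f x| ≤ C) : ‖hf.toLp f‖ ≤ C := by
  have h1 : ∀ᵐ x ∂(volume.restrict (Ioc (0 : ℝ) 1)), ‖hf.toLp f x‖ ≤ C := by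
    filter_upwards [hf.coeFn_toLp, ae_unit h] with x hx hx'
    rw [hx]
    exact hx'
  have := Lp.norm_le_of_ae_bound hC h1
  have hu : measureUnivNNReal (volume.restrict (Ioc (0 : ℝ) 1)) = 1 := by
    simp [measureUnivNNReal]
  simpa [hu] using this

lemma inner_toLp {f g : ℝ → ℝ} (hf : MemLp f 2 (volume.restrict (Ioc (0 : ℝ) 1)))
    (hg : MemLp g 2 (volume.restrict (Ioc (0 : ℝ) 1))) :
    inner ℝ (hf.toLp f) (hg.toLp g) = ∫ x in (0 : ℝ)..1, f x * g x := by
  rw [L2.inner_def, intervalIntegral.integral_of_le zero_le_one]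
  refine integral_congr_ae ?_
  filter_upwards [hf.coeFn_toLp, hg.coeFn_toLp] with x h1 h2
  rw [h1, h2, real_inner_eq_re_inner, RCLike.inner_apply]
  simp [mul_comm]

lemma inner_toLp_left {f : ℝ → ℝ} (hf : MemLp f 2 (volume.restrict (Ioc (0 : ℝ) 1)))
    (g : L2Unit) : inner ℝ g (hf.toLp f) = ∫ x in (0 : ℝ)..1, g x * f x := by
  rw [← inner_toLp (Lp.memLp g) hf, Lp.toLp_coeFn]

lemma continuousOn_weight_eval {w : ℝ → ℝ} (hw : ContinuousOn w (Icc 0 1)) (x : H1Data) :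
    ContinuousOn (fun t => w t * inner ℝ (evalKernel t) x) (Icc 0 1) :=
  hw.mul (continuousOn_evalKernel.inner continuousOn_const)

/-- The operator `(c, g) ↦ w (c + ∫₀ˣ g)`. -/
noncomputable def weightedEval {w : ℝ → ℝ} (hw : ContinuousOn w (Icc 0 1)) :
    H1Data →L[ℝ] L2Unit :=
  LinearMap.mkContinuousOfExistsBound
    { toFun := fun x => (memLp_Ioc (continuousOn_weight_eval hw x)).toLp _
      map_add' := fun x y => by
        rw [← MemLp.toLp_add]
        congr 1
        ext t
        simp [inner_add_right, mul_add]
      map_smul' := fun a x => by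
        rw [RingHom.id_apply, ← MemLp.toLp_const_smul]
        congr 1
        ext t
        simp only [inner_smul_right, Pi.smul_apply, smul_eq_mul]
        ring } (by
    obtain ⟨C, hC⟩ := isCompact_Icc.exists_bound_of_continuousOn
      (hw.smul continuousOn_evalKernel)
    have hC0 : 0 ≤ C := (norm_nonneg _).trans (hC 0 (by simp))
    refine ⟨C, fun x => norm_toLp_le (memLp_Ioc (continuousOn_weight_eval hw x)) (by positivity)
      fun t ht => ?_⟩
    rw [← real_inner_smul_left]
    exact (abs_real_inner_le_norm _ _).trans (by gcongr; exact hC t ht))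

lemma weightedEval_apply {w : ℝ → ℝ} (hw : ContinuousOn w (Icc 0 1)) (x : H1Data) :
    weightedEval hw x = (memLp_Ioc (continuousOn_weight_eval hw x)).toLp _ := rfl

/-- The kernel `t ↦ w t • evalKernel t` is uniformly continuous, so sampling it on a fine grid
approximates the operator in norm by operators of finite rank. -/
lemma isCompactOperator_weightedEval {w : ℝ → ℝ} (hw : ContinuousOn w (Icc 0 1)) :
    IsCompactOperator (weightedEval hw) := by
  have hk : ContinuousOn (fun t => w t • evalKernel t) (Icc 0 1) := hw.smul continuousOn_evalKernel
  have huc := isCompact_Icc.uniformContinuousOn_of_continuous hk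
  refine isClosed_setOfPred_isCompactOperator.closure_subset (Metric.mem_closure_iff.2 ?_)
  intro ε hε
  obtain ⟨δ, hδ, hδε⟩ := Metric.uniformContinuousOn_iff.1 huc (ε / 2) (by positivity)
  obtain ⟨n, hn⟩ := exists_nat_one_div_lt hδ
  let N : ℕ := n + 1
  have hN : (0 : ℝ) < N := by positivity
  -- The index of the grid point just left of `t`. The point `t = 1` has index `N`, so there are `N
  -- + 1` of them; the minimum only serves to define `idx` on all of `ℝ`.
  let idx : ℝ → Fin (N + 1) := fun t => ⟨min N ⌊N * t⌋₊, by omega⟩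
  have hidx : Measurable idx := by
    have h1 : Measurable fun t : ℝ => ⌊N * t⌋₊ := by fun_prop
    exact (measurable_of_countable fun m : ℕ => (⟨min N m, by omega⟩ : Fin (N + 1))).comp h1
  let ev : H1Data →L[ℝ] (Fin (N + 1) → ℝ) := ContinuousLinearMap.pi fun j =>
    innerSL ℝ (w ((j : ℝ) / N) • evalKernel ((j : ℝ) / N))
  have hm : ∀ y : Fin (N + 1) → ℝ, MemLp (fun t => y (idx t)) 2 (volume.restrict (Ioc (0 : ℝ) 1)) :=
    fun y => MemLp.of_bound ((measurable_of_countable y).comp hidx).aestronglyMeasurable ‖y‖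
      (Eventually.of_forall fun t => norm_le_pi_norm y _)
  let L : (Fin (N + 1) → ℝ) →ₗ[ℝ] L2Unit :=
    { toFun := fun y => (hm y).toLp _
      map_add' := fun x y => by rw [← MemLp.toLp_add]; rfl
      map_smul' := fun a x => by rw [RingHom.id_apply, ← MemLp.toLp_const_smul]; rfl }
  refine ⟨L.toContinuousLinearMap ∘L ev, ?_, ?_⟩
  · exact (isCompactOperator_of_locallyCompactSpace_rng
      L.toContinuousLinearMap).comp_clm ev
  · rw [dist_eq_norm]
    refine lt_of_le_of_lt (ContinuousLinearMap.opNorm_le_bound _ (by positivity : 0 ≤ ε / 2)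
      fun x => ?_) (half_lt_self hε)
    change ‖weightedEval hw x - (hm (ev x)).toLp _‖ ≤ _
    rw [weightedEval_apply, ← MemLp.toLp_sub]
    refine norm_toLp_le _ (by positivity) fun t ht => ?_
    have h1 : ⌊N * t⌋₊ ≤ N := by
      have : N * t ≤ N := by nlinarith [ht.2]
      exact Nat.floor_le_of_le this
    have h0 : 0 ≤ N * t := mul_nonneg hN.le ht.1
    have h2 : ((idx t : ℕ) : ℝ) = ⌊N * t⌋₊ := by simp [idx, h1]
    have h3 := Nat.floor_le h0
    have h4 := Nat.lt_floor_add_one (N * t)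
    have hs : ((idx t : ℕ) : ℝ) / N ∈ Icc (0 : ℝ) 1 :=
      ⟨by positivity, by rw [div_le_one hN, h2]; exact_mod_cast h1⟩
    have hd : dist t (((idx t : ℕ) : ℝ) / N) < δ := by
      refine lt_of_le_of_lt ?_ hn
      have e : ((n : ℝ) + 1) = N := by simp [N]
      rw [Real.dist_eq, h2, e, abs_of_nonneg (by rw [sub_nonneg, div_le_iff₀ hN]; linarith),
        le_div_iff₀ hN, sub_mul, div_mul_cancel₀ _ hN.ne']
      linarith
    have hlt := hδε t ht _ hs hd
    rw [dist_eq_norm] at hlt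
    have e2 : (fun t => w t * inner ℝ (evalKernel t) x) t - ev x (idx t) =
        inner ℝ (w t • evalKernel t - w (((idx t : ℕ) : ℝ) / N) •
          evalKernel (((idx t : ℕ) : ℝ) / N)) x := by
      rw [inner_sub_left, real_inner_smul_left]
      rfl
    change |(fun t => w t * inner ℝ (evalKernel t) x) t - ev x (idx t)| ≤ _
    rw [e2]
    exact (abs_real_inner_le_norm _ _).trans (by gcongr)


/-! ### Completeness of the Neumann eigenfunctions -/

lemma hasDerivWithinAt_primitive {F : ℝ → ℝ} (hF : ContinuousOn F (Icc 0 1)) {x : ℝ}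
    (hx : x ∈ Icc (0 : ℝ) 1) :
    HasDerivWithinAt (fun x => ∫ y in (0 : ℝ)..x, F y) (F x) (Icc 0 1) x := by
  let G : ℝ → ℝ := IccExtend zero_le_one ((Icc (0 : ℝ) 1).domRestrict F)
  have hG : Continuous G := (continuousOn_iff_continuous_domRestrict.1 hF).Icc_extend'
  have hGF : ∀ y ∈ Icc (0 : ℝ) 1, G y = F y := fun y hy => by
    simp only [G, IccExtend_of_mem _ _ hy]
    rfl
  have h := (hG.integral_hasStrictDerivAt 0 x).hasDerivAt.hasDerivWithinAt (s := Icc 0 1)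
  rw [hGF x hx] at h
  have hcongr : ∀ y ∈ Icc (0 : ℝ) 1, ∫ z in (0 : ℝ)..y, F z = ∫ z in (0 : ℝ)..y, G z := by
    intro y hy
    refine intervalIntegral.integral_congr fun z hz => ?_
    rw [uIcc_of_le hy.1] at hz
    exact (hGF z ⟨hz.1, hz.2.trans hy.2⟩).symm
  exact h.congr hcongr (hcongr x hx)

lemma eq_zero_of_ae_eq_zero {f : ℝ → ℝ} (hf : ContinuousOn f (Icc 0 1))
    (h : f =ᵐ[volume.restrict (Ioc 0 1)] 0) : ∀ x ∈ Icc (0 : ℝ) 1, f x = 0 := by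
  rw [Measure.restrict_congr_set Ioc_ae_eq_Icc] at h
  exact Measure.eqOn_Icc_of_ae_eq (μ := volume) zero_ne_one h hf continuousOn_const

lemma eq_zero_of_integral_sq_eq_zero {f : ℝ → ℝ} (hf : ContinuousOn f (Icc 0 1))
    (h : ∫ x in (0 : ℝ)..1, f x * f x = 0) : ∀ x ∈ Icc (0 : ℝ) 1, f x = 0 := by
  rw [intervalIntegral.integral_of_le zero_le_one,
    integral_eq_zero_iff_of_nonneg (fun x => mul_self_nonneg _)
      ((intervalIntegrable_iff_integrableOn_Ioc_of_le zero_le_one).1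
        (intervalIntegrable_unit (hf.mul hf)))] at h
  refine eq_zero_of_ae_eq_zero hf ?_
  filter_upwards [h] with x hx
  simpa using hx

lemma L2Unit.intervalIntegrable (g : L2Unit) : IntervalIntegrable g volume 0 1 := by
  rw [intervalIntegrable_iff_integrableOn_Ioc_of_le zero_le_one]
  exact (Lp.memLp g).integrable (by norm_num)

lemma integral_weightedEval_left {w : ℝ → ℝ} (hw : ContinuousOn w (Icc 0 1)) (f : L2Unit)
    (x : H1Data) : inner ℝ f (weightedEval hw x) =
      ∫ t in (0 : ℝ)..1, f t * (w t * (x.fst + ∫ y in (0 : ℝ)..t, x.snd y)) := by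
  rw [weightedEval_apply, inner_toLp_left]
  exact integral_unit_congr fun t ht => by rw [inner_evalKernel ht]

lemma inner_weightedEval {w z : ℝ → ℝ} (hw : ContinuousOn w (Icc 0 1))
    (hz : ContinuousOn z (Icc 0 1)) (x y : H1Data) :
    inner ℝ (weightedEval hw x) (weightedEval hz y) =
      ∫ t in (0 : ℝ)..1, (w t * (x.fst + ∫ y in (0 : ℝ)..t, x.snd y)) *
        (z t * (y.fst + ∫ s in (0 : ℝ)..t, y.snd s)) := by
  rw [weightedEval_apply, weightedEval_apply, inner_toLp]
  exact integral_unit_congr fun t ht => by rw [inner_evalKernel ht, inner_evalKernel ht]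

/-- This is the density of `H¹` in `L²`. With `P` the primitive of `f`, testing against `∫₀ˣ (P - P
1)` and integrating by parts gives `∫ (P - P 1)² = 0`. So `P` is constant, equal to `P 0 = 0`, and
its derivative `f` vanishes almost everywhere. -/
lemma eq_zero_of_inner_weightedEval_one (f : L2Unit)
    (h : ∀ x, inner ℝ f (weightedEval (continuousOn_const (c := (1 : ℝ))) x) = 0) : f = 0 := by
  have hf := L2Unit.intervalIntegrable f
  set P : ℝ → ℝ := fun x => ∫ y in (0 : ℝ)..x, f y with hP
  have hPc : ContinuousOn P (Icc 0 1) := continuousOn_primitive_unit hf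
  have hkc : ContinuousOn (fun x => P x - P 1) (Icc 0 1) := hPc.sub continuousOn_const
  have hk2 := memLp_Ioc hkc
  have hH : ∀ x ∈ Icc (0 : ℝ) 1, ∫ y in (0 : ℝ)..x, (hk2.toLp _ : L2Unit) y =
      ∫ y in (0 : ℝ)..x, (P y - P 1) := by
    intro x hx
    rw [intervalIntegral.integral_of_le hx.1, intervalIntegral.integral_of_le hx.1]
    exact integral_congr_ae (ae_restrict_of_ae_restrict_of_subset (Ioc_subset_Ioc_right hx.2)
      hk2.coeFn_toLp)
  have h1 := h (WithLp.toLp 2 (0, hk2.toLp _))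
  rw [integral_weightedEval_left] at h1
  have h2 : ∫ t in (0 : ℝ)..1, f t * ∫ y in (0 : ℝ)..t, (P y - P 1) = 0 := by
    refine Eq.trans (integral_unit_congr fun t ht => ?_) h1
    simp only [WithLp.toLp_fst, WithLp.toLp_snd, zero_add, one_mul]
    rw [hH t ht]
  have h3 := integral_primitive_mul_deriv 0 hf
    (fun x hx => hasDerivWithinAt_primitive hkc hx) hkc
  rw [h2] at h3
  simp only [zero_add, zero_mul, sub_zero] at h3
  have i1 := intervalIntegrable_unit (hPc.fun_mul hkc)
  have h4 : ∫ x in (0 : ℝ)..1, (P x - P 1) * (P x - P 1) = 0 := by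
    have : ∫ x in (0 : ℝ)..1, (P x - P 1) * (P x - P 1) =
        (∫ x in (0 : ℝ)..1, P x * (P x - P 1)) - P 1 * ∫ x in (0 : ℝ)..1, (P x - P 1) := by
      rw [← intervalIntegral.integral_const_mul, ← intervalIntegral.integral_sub i1
        ((intervalIntegrable_unit hkc).const_mul _)]
      exact integral_unit_congr fun x _ => by ring
    rw [this, h3]
    simp [hP]
  have h5 := eq_zero_of_integral_sq_eq_zero hkc h4
  have h6 : ∀ x ∈ Icc (0 : ℝ) 1, P x = 0 := by
    have h0 : P 0 = 0 := by simp [hP]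
    intro x hx
    linarith [h5 x hx, h5 0 (by simp)]
  rw [Lp.eq_zero_iff_ae_eq_zero, EventuallyEq, ae_restrict_iff' measurableSet_Ioc]
  have hne : ∀ᵐ x : ℝ, x ≠ 1 := by simp [ae_iff]
  filter_upwards [hf.ae_hasDerivAt_integral, hne] with x hx hx1 hxI
  have hx' : x ∈ Ioo (0 : ℝ) 1 := ⟨hxI.1, lt_of_le_of_ne hxI.2 hx1⟩
  have hx2 := hx (by rw [uIcc_of_le zero_le_one]; exact Ioo_subset_Icc_self hx') 0 (by simp)
  have hx3 : HasDerivAt P 0 x := (hasDerivAt_const x (0 : ℝ)).congr_of_eventuallyEq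
    (by filter_upwards [Icc_mem_nhds hx'.1 hx'.2] with y hy using h6 y hy)
  exact hx2.unique hx3

/-- A weak solution of the Neumann eigenvalue problem is an eigenfunction. -/
lemma isNeumannEigenfunction_of_weak {V : ℝ → ℝ} (hV : ContinuousOn V (Icc 0 1)) {lam c : ℝ}
    {g : L2Unit}
    (h : ∀ (d : ℝ) (k : L2Unit), inner ℝ g k + ∫ t in (0 : ℝ)..1,
      (V t - lam) * (c + ∫ y in (0 : ℝ)..t, g y) * (d + ∫ y in (0 : ℝ)..t, k y) = 0) :
    IsNeumannEigenfunction V lam (fun t => c + ∫ y in (0 : ℝ)..t, g y) := by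
  set F : ℝ → ℝ := fun t => (V t - lam) * (c + ∫ y in (0 : ℝ)..t, g y) with hF
  have hFc : ContinuousOn F (Icc 0 1) := (hV.sub continuousOn_const).mul
    (continuousOn_const.add (continuousOn_primitive_unit (L2Unit.intervalIntegrable g)))
  set Φ : ℝ → ℝ := fun x => ∫ y in (0 : ℝ)..x, F y with hΦ
  have hΦd : ∀ x ∈ Icc (0 : ℝ) 1, HasDerivWithinAt Φ (F x) (Icc 0 1) x :=
    fun x hx => hasDerivWithinAt_primitive hFc hx
  have hΦc : ContinuousOn Φ (Icc 0 1) := fun x hx => (hΦd x hx).continuousWithinAt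
  have hΦ0 : Φ 0 = 0 := by simp [hΦ]
  -- Testing with the constant 1 produces the natural boundary condition at 1; the one at 0 holds
  -- because `Φ` is a primitive from 0.
  have hΦ1 : Φ 1 = 0 := by
    have := h 1 0
    rw [inner_zero_right, zero_add] at this
    rw [← this]
    refine integral_unit_congr fun t ht => ?_
    have h0 : ∫ y in (0 : ℝ)..t, (0 : L2Unit) y = 0 := by
      rw [← inner_indicatorL2 ht, inner_zero_right]
    rw [h0, add_zero, mul_one]
  have hΦm := memLp_Ioc hΦc
  -- Testing with functions vanishing at 0 and integrating by parts identifies the weak derivative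
  -- `g` with `Φ`, which is itself `C¹` with derivative `F`.
  have hg : g = hΦm.toLp _ := by
    refine ext_inner_right ℝ fun k => ?_
    have h1 := h 0 k
    have h2 := integral_primitive_mul_deriv 0 (L2Unit.intervalIntegrable k) hΦd hFc
    rw [hΦ1, hΦ0] at h2
    simp only [zero_add, mul_zero, sub_self, zero_sub] at h1 h2
    have h3 : ∫ t in (0 : ℝ)..1, F t * ∫ y in (0 : ℝ)..t, k y =
        ∫ t in (0 : ℝ)..1, (∫ y in (0 : ℝ)..t, k y) * F t :=
      integral_unit_congr fun x _ => mul_comm _ _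
    rw [real_inner_comm k (hΦm.toLp _), inner_toLp_left]
    linarith
  have hu : ∀ x ∈ Icc (0 : ℝ) 1, (c + ∫ y in (0 : ℝ)..x, g y) = c + ∫ y in (0 : ℝ)..x, Φ y := by
    intro x hx
    rw [hg, intervalIntegral.integral_of_le hx.1, intervalIntegral.integral_of_le hx.1]
    congr 1
    exact integral_congr_ae (ae_restrict_of_ae_restrict_of_subset (Ioc_subset_Ioc_right hx.2)
      hΦm.coeFn_toLp)
  refine ⟨Φ, F, fun x hx => ?_, hΦd, fun x hx => by simp only [hF]; ring, hΦ0, hΦ1⟩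
  exact ((hasDerivWithinAt_primitive hΦc hx).const_add c).congr hu (hu x hx)

lemma abs_inner_indicatorL2_le {t : ℝ} (ht : t ∈ Icc (0 : ℝ) 1) (g : L2Unit) :
    |∫ y in (0 : ℝ)..t, g y| ≤ ‖g‖ := by
  rw [← inner_indicatorL2 ht]
  have h1 : ‖indicatorL2 t‖ ^ 2 ≤ 1 := by
    rw [← real_inner_self_eq_norm_sq, inner_indicatorL2_indicatorL2 ht ht, min_self]
    exact ht.2
  have h2 : ‖indicatorL2 t‖ ≤ 1 := by nlinarith [norm_nonneg (indicatorL2 t)]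
  exact (abs_real_inner_le_norm _ _).trans (mul_le_of_le_one_left (norm_nonneg _) h2)

/-- The eigenfunctions of the Neumann problem are total in `L²`. -/
theorem eq_zero_of_orthogonal_eigenfunctions {V : ℝ → ℝ} (hV : ContinuousOn V (Icc 0 1))
    (hVpos : ∀ x ∈ Icc (0 : ℝ) 1, 0 < V x) {f : ℝ → ℝ} (hf : ContinuousOn f (Icc 0 1))
    (h : ∀ (lam : ℝ) (φ : ℝ → ℝ), IsNeumannEigenfunction V lam φ →
      ∫ x in (0 : ℝ)..1, φ x * f x = 0) : ∀ x ∈ Icc (0 : ℝ) 1, f x = 0 := by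
  obtain ⟨x₀, hx₀, hmin⟩ := isCompact_Icc.exists_isMinOn (nonempty_Icc.2 zero_le_one) hV
  have hm := hVpos x₀ hx₀
  set m := V x₀
  have hmin' : ∀ x ∈ Icc (0 : ℝ) 1, m ≤ V x := fun x hx => hmin hx
  have hs : ContinuousOn (fun x => √(V x)) (Icc 0 1) := hV.sqrt
  have h1c : ContinuousOn (fun _ : ℝ => (1 : ℝ)) (Icc 0 1) := continuousOn_const
  let S : H1Data →L[ℝ] L2Unit := (ContinuousLinearMap.snd ℝ ℝ L2Unit) ∘L
    (WithLp.prodContinuousLinearEquiv 2 ℝ ℝ L2Unit : H1Data →L[ℝ] ℝ × L2Unit)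
  have hS : ∀ x, S x = x.snd := fun x => rfl
  -- The operator representing `∫ f'g' + ∫ V f g`; the weight `√V` puts the potential term in the
  -- form `⟨Wf, Wg⟩`, so symmetry is evident.
  let A : H1Data →L[ℝ] H1Data := ContinuousLinearMap.adjoint S ∘L S +
    ContinuousLinearMap.adjoint (weightedEval hs) ∘L weightedEval hs
  have hA : ∀ x y, inner ℝ (A x) y = inner ℝ x.snd y.snd +
      inner ℝ (weightedEval hs x) (weightedEval hs y) := by
    intro x y
    simp only [A, add_apply, ContinuousLinearMap.comp_apply, inner_add_left,
      ContinuousLinearMap.adjoint_inner_left, hS]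
  have hFm := memLp_Ioc hf
  have key := eq_zero_of_orthogonal_weak_eigenvectors (weightedEval h1c)
    (isCompactOperator_weightedEval h1c) eq_zero_of_inner_weightedEval_one A
    (fun x y => by rw [hA, real_inner_comm (A y), hA, real_inner_comm x.snd,
      real_inner_comm (weightedEval hs x)]) (C := (3 + 2 / m)⁻¹) (by positivity) (by
      intro x
      rw [hA, real_inner_self_eq_norm_sq, inner_weightedEval, mul_assoc, ← sq,
        WithLp.prod_norm_sq_eq_of_L2, inv_mul_le_iff₀ (by positivity)]
      set u : ℝ → ℝ := fun t => x.fst + ∫ y in (0 : ℝ)..t, x.snd y with hu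
      have huc : ContinuousOn u (Icc 0 1) := continuousOn_const.add
        (continuousOn_primitive_unit (L2Unit.intervalIntegrable x.snd))
      -- From `c = u(t) - ∫₀ᵗ g` one gets `c² ≤ 2u² + 2‖g‖² ≤ (2/m) V u² + 2‖g‖²`. Integrating and
      -- adding `‖g‖²` gives coercivity with `(3 + 2/m)⁻¹`.
      have hc : x.fst ^ 2 ≤ ∫ t in (0 : ℝ)..1,
          (2 / m * ((√(V t) * u t) * (√(V t) * u t)) + 2 * ‖x.snd‖ ^ 2) := by
        have : ∫ t in (0 : ℝ)..1, x.fst ^ 2 = x.fst ^ 2 := by simp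
        rw [← this]
        refine intervalIntegral.integral_mono_on zero_le_one (by simp)
          (intervalIntegrable_unit ?_) fun t ht => ?_
        · exact (continuousOn_const.mul ((hs.mul huc).mul (hs.mul huc))).add continuousOn_const
        · have e1 : (√(V t) * u t) * (√(V t) * u t) = V t * u t ^ 2 := by
            rw [mul_mul_mul_comm, Real.mul_self_sqrt (hVpos t ht).le]; ring
          rw [e1]
          have e2 : 2 * u t ^ 2 ≤ 2 / m * (V t * u t ^ 2) := by
            rw [div_mul_eq_mul_div, le_div_iff₀ hm]
            nlinarith [mul_le_mul_of_nonneg_right (hmin' t ht) (sq_nonneg (u t))]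
          have e3 := sq_le_sq' (neg_le_of_abs_le (abs_inner_indicatorL2_le ht x.snd))
            (le_of_abs_le (abs_inner_indicatorL2_le ht x.snd))
          have e4 : x.fst = u t - ∫ y in (0 : ℝ)..t, x.snd y := by simp [hu]
          rw [e4]
          nlinarith [sq_nonneg (u t + ∫ y in (0 : ℝ)..t, x.snd y)]
      rw [intervalIntegral.integral_add (intervalIntegrable_unit
        (continuousOn_const.fun_mul ((hs.fun_mul huc).fun_mul (hs.fun_mul huc)))) (by simp),
        intervalIntegral.integral_const_mul] at hc
      have hI : 0 ≤ ∫ t in (0 : ℝ)..1, (√(V t) * u t) * (√(V t) * u t) :=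
        intervalIntegral.integral_nonneg zero_le_one fun t _ => mul_self_nonneg _
      simp only [intervalIntegral.integral_const, sub_zero, one_smul] at hc
      rw [Real.norm_eq_abs, sq_abs]
      have hp : 0 ≤ 2 / m := by positivity
      nlinarith [mul_nonneg hp (sq_nonneg ‖x.snd‖)])
    (hFm.toLp _) (by
      intro w lam hw
      have hW : IsNeumannEigenfunction V lam (fun t => w.fst + ∫ y in (0 : ℝ)..t, w.snd y) := by
        refine isNeumannEigenfunction_of_weak hV fun d k => ?_
        have := hw (WithLp.toLp 2 (d, k))
        rw [hA, inner_weightedEval, inner_weightedEval, ← sub_eq_zero,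
          ← intervalIntegral.integral_const_mul, add_sub_assoc,
          ← intervalIntegral.integral_sub] at this
        · refine Eq.trans (congrArg₂ _ rfl (integral_unit_congr fun t ht => ?_)) this
          have e := Real.mul_self_sqrt (hVpos t ht).le
          simp only [WithLp.toLp_fst, WithLp.toLp_snd]
          linear_combination (-(w.fst + ∫ y in (0 : ℝ)..t, w.snd y) *
            (d + ∫ y in (0 : ℝ)..t, k y)) * e
        all_goals
          have q1 := continuousOn_primitive_unit (L2Unit.intervalIntegrable w.snd)
          have q2 := continuousOn_primitive_unit (L2Unit.intervalIntegrable k)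
          refine intervalIntegrable_unit ?_
        · exact (hs.mul (continuousOn_const.add q1)).mul (hs.mul (continuousOn_const.add q2))
        · exact continuousOn_const.mul ((continuousOn_const.mul (continuousOn_const.add q1)).mul
            (continuousOn_const.mul (continuousOn_const.add q2)))
      rw [real_inner_comm, integral_weightedEval_left]
      refine Eq.trans (intervalIntegral.integral_congr_ae ?_) (h lam _ hW)
      have hae := (ae_restrict_iff' measurableSet_Ioc).1 hFm.coeFn_toLp
      filter_upwards [hae] with t ht ht'
      rw [uIoc_of_le zero_le_one] at ht'
      rw [ht ht']
      ring)
  refine eq_zero_of_ae_eq_zero hf ?_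
  rw [Lp.eq_zero_iff_ae_eq_zero] at key
  exact hFm.coeFn_toLp.symm.trans key

/-- Being orthogonal to all `e n` means being orthogonal to every eigenfunction: if its eigenvalue
is listed, simplicity makes it a multiple of some `e n`; otherwise it is orthogonal to all `e n` and
exhaustiveness makes it zero. -/
theorem IsNeumannEigensystem.eq_zero_of_orthogonal {V : ℝ → ℝ} {mu : ℕ → ℝ} {e : ℕ → ℝ → ℝ}
    (hE : IsNeumannEigensystem V mu e) (hV : ContinuousOn V (Icc 0 1))
    (hVpos : ∀ x ∈ Icc (0 : ℝ) 1, 0 < V x) {f : ℝ → ℝ} (hf : ContinuousOn f (Icc 0 1))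
    (h : ∀ n, ∫ x in (0 : ℝ)..1, e n x * f x = 0) : ∀ x ∈ Icc (0 : ℝ) 1, f x = 0 := by
  refine eq_zero_of_orthogonal_eigenfunctions hV hVpos hf fun lam φ hφ => ?_
  by_cases hl : ∃ n, mu n = lam
  · obtain ⟨n, rfl⟩ := hl
    have hne : ∃ x ∈ Icc (0 : ℝ) 1, e n x ≠ 0 := by
      by_contra! h0
      have h1 := hE.orthonormal n n
      rw [integral_unit_congr (g := fun _ => 0) (fun x hx => by rw [h0 x hx, mul_zero])] at h1
      simp at h1
    obtain ⟨c, hc⟩ := hφ.exists_eq_mul hV (hE.eigen n) hne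
    rw [integral_unit_congr (g := fun x => c * (e n x * f x))
      (fun x hx => by rw [hc x hx, mul_assoc]), intervalIntegral.integral_const_mul, h n, mul_zero]
  · push Not at hl
    have h0 := hE.exhaustive lam φ hφ fun n =>
      (hE.eigen n).integral_mul_eq_zero hV hφ (hl n)
    rw [integral_unit_congr (g := fun _ => 0) (fun x hx => by rw [h0 x hx, zero_mul])]
    simp


/-! ### Energy estimates -/

/-- The energy `∫ f'² + V f²`. -/
noncomputable def energy (V f f' : ℝ → ℝ) : ℝ :=
  (∫ x in (0 : ℝ)..1, f' x * f' x) + ∫ x in (0 : ℝ)..1, V x * (f x * f x)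

/-- With `G' = f² + f'²` one has `|(f²)'| ≤ G'`, so `G ± f²` are monotone and `f(x)² ≤ f(y)² +
G(1)`. Averaging over `y` gives the bound. -/
lemma sq_le_of_deriv {f f' : ℝ → ℝ}
    (h1 : ∀ x ∈ Icc (0 : ℝ) 1, HasDerivWithinAt f (f' x) (Icc 0 1) x)
    (h2 : ContinuousOn f' (Icc 0 1)) {x : ℝ} (hx : x ∈ Icc (0 : ℝ) 1) :
    f x * f x ≤ 2 * (∫ y in (0 : ℝ)..1, f y * f y) + ∫ y in (0 : ℝ)..1, f' y * f' y := by
  have hf : ContinuousOn f (Icc 0 1) := fun x hx => (h1 x hx).continuousWithinAt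
  set q : ℝ → ℝ := fun y => f y * f y + f' y * f' y with hq
  have hqc : ContinuousOn q (Icc 0 1) := (hf.mul hf).add (h2.mul h2)
  set G : ℝ → ℝ := fun y => ∫ z in (0 : ℝ)..y, q z with hG
  have hGd : ∀ y ∈ Icc (0 : ℝ) 1, HasDerivWithinAt G (q y) (Icc 0 1) y :=
    fun y hy => hasDerivWithinAt_primitive hqc hy
  have hfd : ∀ y ∈ Icc (0 : ℝ) 1, HasDerivWithinAt (fun y => f y * f y)
      (f' y * f y + f y * f' y) (Icc 0 1) y := fun y hy => (h1 y hy).mul (h1 y hy)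
  have hint : interior (Icc (0 : ℝ) 1) ⊆ Icc 0 1 := interior_subset
  have hmono1 : MonotoneOn (fun y => G y - f y * f y) (Icc 0 1) := by
    refine monotoneOn_of_hasDerivWithinAt_nonneg (convex_Icc 0 1)
      (f' := fun y => q y - (f' y * f y + f y * f' y))
      (fun y hy => ((hGd y hy).sub (hfd y hy)).continuousWithinAt)
      (fun y hy => ((hGd y (hint hy)).sub (hfd y (hint hy))).mono hint) fun y _ => ?_
    simp only [hq]
    nlinarith [sq_nonneg (f y - f' y)]
  have hmono2 : MonotoneOn (fun y => G y + f y * f y) (Icc 0 1) := by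
    refine monotoneOn_of_hasDerivWithinAt_nonneg (convex_Icc 0 1)
      (f' := fun y => q y + (f' y * f y + f y * f' y))
      (fun y hy => ((hGd y hy).add (hfd y hy)).continuousWithinAt)
      (fun y hy => ((hGd y (hint hy)).add (hfd y (hint hy))).mono hint) fun y _ => ?_
    simp only [hq]
    nlinarith [sq_nonneg (f y + f' y)]
  have hGm : MonotoneOn G (Icc 0 1) := by
    intro a ha b hb hab
    have e1 := hmono1 ha hb hab
    have e2 := hmono2 ha hb hab
    simp only at e1 e2
    linarith
  have hG0 : G 0 = 0 := by simp [hG]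
  have h01 : (0 : ℝ) ∈ Icc (0 : ℝ) 1 := by simp
  have h11 : (1 : ℝ) ∈ Icc (0 : ℝ) 1 := by simp
  have hpt : ∀ y ∈ Icc (0 : ℝ) 1, f x * f x ≤ f y * f y + G 1 := by
    intro y hy
    have g1 := hGm h01 hx hx.1
    have g2 := hGm hx h11 hx.2
    have g3 := hGm h01 hy hy.1
    have g4 := hGm hy h11 hy.2
    rcases le_total x y with h | h
    · have := hmono2 hx hy h
      simp only at this
      linarith
    · have := hmono1 hy hx h
      simp only at this
      linarith
  have hff := intervalIntegrable_unit (hf.fun_mul hf)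
  have hff' := intervalIntegrable_unit (h2.fun_mul h2)
  have hI := intervalIntegral.integral_mono_on zero_le_one (by simp)
    (hff.add (by simp : IntervalIntegrable (fun _ => G 1) volume 0 1)) hpt
  rw [intervalIntegral.integral_add hff (by simp)] at hI
  have hG1 : G 1 = (∫ y in (0 : ℝ)..1, f y * f y) + ∫ y in (0 : ℝ)..1, f' y * f' y :=
    intervalIntegral.integral_add hff hff'
  simp only [intervalIntegral.integral_const, sub_zero, one_smul] at hI
  linarith

lemma exists_sobolev_const {V : ℝ → ℝ} (hV : ContinuousOn V (Icc 0 1))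
    (hVpos : ∀ x ∈ Icc (0 : ℝ) 1, 0 < V x) :
    ∃ C : ℝ, 0 < C ∧ ∀ f f' : ℝ → ℝ,
      (∀ x ∈ Icc (0 : ℝ) 1, HasDerivWithinAt f (f' x) (Icc 0 1) x) →
      ContinuousOn f' (Icc 0 1) → ∀ x ∈ Icc (0 : ℝ) 1, f x * f x ≤ C * energy V f f' := by
  obtain ⟨x₀, hx₀, hmin⟩ := isCompact_Icc.exists_isMinOn (nonempty_Icc.2 zero_le_one) hV
  have hm := hVpos x₀ hx₀
  set m := V x₀
  have hmin' : ∀ x ∈ Icc (0 : ℝ) 1, m ≤ V x := fun x hx => hmin hx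
  refine ⟨1 + 2 / m, by positivity, fun f f' h1 h2 x hx => ?_⟩
  have hf : ContinuousOn f (Icc 0 1) := fun x hx => (h1 x hx).continuousWithinAt
  have hff := hf.fun_mul hf
  have e1 : m * ∫ y in (0 : ℝ)..1, f y * f y ≤ ∫ y in (0 : ℝ)..1, V y * (f y * f y) := by
    rw [← intervalIntegral.integral_const_mul]
    exact intervalIntegral.integral_mono_on zero_le_one
      ((intervalIntegrable_unit hff).const_mul m) (intervalIntegrable_unit (hV.mul hff))
      fun y hy => mul_le_mul_of_nonneg_right (hmin' y hy) (mul_self_nonneg _)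
  have e2 : 2 * ∫ y in (0 : ℝ)..1, f y * f y ≤
      2 / m * ∫ y in (0 : ℝ)..1, V y * (f y * f y) := by
    rw [div_mul_eq_mul_div, le_div_iff₀ hm]
    linarith
  have e3 : 0 ≤ ∫ y in (0 : ℝ)..1, f' y * f' y :=
    intervalIntegral.integral_nonneg zero_le_one fun y _ => mul_self_nonneg _
  have e4 : 0 ≤ ∫ y in (0 : ℝ)..1, V y * (f y * f y) :=
    intervalIntegral.integral_nonneg zero_le_one fun y hy =>
      mul_nonneg (hVpos y hy).le (mul_self_nonneg _)
  have e5 := sq_le_of_deriv h1 h2 hx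
  have hp : 0 ≤ 2 / m := by positivity
  rw [energy]
  nlinarith [mul_nonneg hp e3]

/-- An orthonormal family of Neumann eigenfunctions. -/
structure IsOrthonormalEigenfamily {ι : Type*} [DecidableEq ι] (V : ℝ → ℝ) (mu : ι → ℝ)
    (e : ι → ℝ → ℝ) : Prop where
  eigen : ∀ i, IsNeumannEigenfunction V (mu i) (e i)
  orthonormal : ∀ i j, ∫ x in (0 : ℝ)..1, e i x * e j x = if i = j then 1 else 0

lemma IsNeumannEigensystem.family {V : ℝ → ℝ} {mu : ℕ → ℝ} {e : ℕ → ℝ → ℝ}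
    (hE : IsNeumannEigensystem V mu e) : IsOrthonormalEigenfamily V mu e :=
  ⟨hE.eigen, hE.orthonormal⟩

namespace IsOrthonormalEigenfamily

variable {ι : Type*} [DecidableEq ι] {V : ℝ → ℝ} {mu : ι → ℝ} {e : ι → ℝ → ℝ}

lemma integral_mul_sum (h : IsOrthonormalEigenfamily V mu e) (s : Finset ι) (a : ι → ℝ)
    {f : ℝ → ℝ} (hf : ContinuousOn f (Icc 0 1)) :
    ∫ x in (0 : ℝ)..1, f x * ∑ i ∈ s, a i * e i x =
      ∑ i ∈ s, a i * ∫ x in (0 : ℝ)..1, e i x * f x := by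
  simp only [Finset.mul_sum, ← intervalIntegral.integral_const_mul]
  rw [intervalIntegral.integral_finsetSum fun i _ =>
    intervalIntegrable_unit (hf.fun_mul (continuousOn_const.fun_mul (h.eigen i).continuousOn))]
  exact Finset.sum_congr rfl fun i _ => integral_unit_congr fun x _ => by ring

lemma continuousOn_sum (h : IsOrthonormalEigenfamily V mu e) (s : Finset ι) (a : ι → ℝ) :
    ContinuousOn (fun x => ∑ i ∈ s, a i * e i x) (Icc 0 1) :=
  continuousOn_finsetSum _ fun i _ => continuousOn_const.mul (h.eigen i).continuousOn

lemma integral_sum_mul_sum (h : IsOrthonormalEigenfamily V mu e) (s : Finset ι) (a b : ι → ℝ) :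
    ∫ x in (0 : ℝ)..1, (∑ i ∈ s, a i * e i x) * ∑ i ∈ s, b i * e i x = ∑ i ∈ s, b i * a i := by
  rw [h.integral_mul_sum s b (h.continuousOn_sum s a)]
  refine Finset.sum_congr rfl fun i hi => ?_
  rw [h.integral_mul_sum s a (h.eigen i).continuousOn]
  simp [h.orthonormal, hi]

/-- One integration by parts turns the energy of `f` into `∫ f (Vf - f'')`, and `V - ∂ₓₓ` multiplies
each `e i` by `mu i`. So the family is orthogonal for the energy as well. -/
lemma energy_sum (h : IsOrthonormalEigenfamily V mu e) (hV : ContinuousOn V (Icc 0 1))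
    (s : Finset ι) (a : ι → ℝ) {e' : ι → ℝ → ℝ}
    (he' : ∀ i, NeumannC2 (e i) (e' i) (fun x => (V x - mu i) * e i x)) :
    energy V (fun x => ∑ i ∈ s, a i * e i x) (fun x => ∑ i ∈ s, a i * e' i x) =
      ∑ i ∈ s, mu i * a i ^ 2 := by
  have hs := NeumannC2.sum s a he'
  have h1 := hs.integral_mul_second hs.deriv_one hs.continuousOn_one
  have hc := h.continuousOn_sum s a
  have h2 := h.integral_sum_mul_sum s a fun i => mu i * a i
  rw [energy, ← neg_neg (∫ x in (0 : ℝ)..1, (∑ i ∈ s, a i * e' i x) * ∑ i ∈ s, a i * e' i x),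
    ← h1, neg_add_eq_sub, ← intervalIntegral.integral_sub
      (intervalIntegrable_unit (hV.fun_mul (hc.fun_mul hc)))
      (intervalIntegrable_unit (hc.fun_mul hs.continuousOn_two))]
  refine Eq.trans (integral_unit_congr fun x _ => ?_)
    (h2.trans (Finset.sum_congr rfl fun i _ => by ring))
  have : ∑ i ∈ s, a i * ((V x - mu i) * e i x) =
      V x * (∑ i ∈ s, a i * e i x) - ∑ i ∈ s, mu i * a i * e i x := by
    rw [Finset.mul_sum, ← Finset.sum_sub_distrib]
    exact Finset.sum_congr rfl fun i _ => by ring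
  rw [this]
  ring

lemma exists_derivs (h : IsOrthonormalEigenfamily V mu e) (hV : ContinuousOn V (Icc 0 1)) :
    ∃ e' : ι → ℝ → ℝ, ∀ i, NeumannC2 (e i) (e' i) (fun x => (V x - mu i) * e i x) := by
  choose e' he' using fun i => (h.eigen i).exists_neumannC2 hV
  exact ⟨e', he'⟩

/-- The trace bound `∑ eᵢ(x)² / μᵢ ≤ C`. -/
lemma exists_trace_bound (hV : ContinuousOn V (Icc 0 1)) (hVpos : ∀ x ∈ Icc (0 : ℝ) 1, 0 < V x) :
    ∃ C : ℝ, 0 < C ∧ ∀ (ι : Type) [DecidableEq ι] (mu : ι → ℝ) (e : ι → ℝ → ℝ),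
      IsOrthonormalEigenfamily V mu e → (∀ i, 0 < mu i) ∧
      (∀ i, ∀ x ∈ Icc (0 : ℝ) 1, e i x ^ 2 ≤ C * mu i) ∧
      (∀ s : Finset ι, ∀ x ∈ Icc (0 : ℝ) 1, ∑ i ∈ s, e i x ^ 2 / mu i ≤ C) ∧
      (∀ s : Finset ι, ∑ i ∈ s, (mu i)⁻¹ ≤ C) := by
  obtain ⟨C, hC, hS⟩ := exists_sobolev_const hV hVpos
  -- The constant is uniform in the index type: the bound is first used for the family indexed by
  -- the set of all eigenvalues, before these are enumerated, and then for `ℕ`.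
  refine ⟨C, hC, fun ι _ mu e h => ?_⟩
  obtain ⟨e', he'⟩ := h.exists_derivs hV
  have hsum : ∀ (s : Finset ι) (a : ι → ℝ), ∀ x ∈ Icc (0 : ℝ) 1,
      (∑ i ∈ s, a i * e i x) * (∑ i ∈ s, a i * e i x) ≤ C * ∑ i ∈ s, mu i * a i ^ 2 := by
    intro s a x hx
    have hs := NeumannC2.sum s a he'
    rw [← h.energy_sum hV s a he']
    exact hS _ _ hs.deriv_one hs.continuousOn_one x hx
  have hone : ∀ i, ∀ x ∈ Icc (0 : ℝ) 1, e i x ^ 2 ≤ C * mu i := by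
    intro i x hx
    have := hsum {i} (fun _ => 1) x hx
    simpa [sq] using this
  have hi2 : ∀ i, ∫ x in (0 : ℝ)..1, e i x ^ 2 = 1 := by
    intro i
    have := h.orthonormal i i
    simpa [sq] using this
  have hpos : ∀ i, 0 < mu i := by
    intro i
    have h1 : ∫ x in (0 : ℝ)..1, e i x ^ 2 ≤ ∫ x in (0 : ℝ)..1, C * mu i :=
      intervalIntegral.integral_mono_on zero_le_one
        (intervalIntegrable_unit ((h.eigen i).continuousOn.pow 2)) (by simp) (hone i)
    rw [hi2] at h1
    simp only [intervalIntegral.integral_const, sub_zero, one_smul] at h1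
    exact pos_of_mul_pos_right (by linarith) hC.le
  have htrace : ∀ s : Finset ι, ∀ x ∈ Icc (0 : ℝ) 1, ∑ i ∈ s, e i x ^ 2 / mu i ≤ C := by
    intro s x hx
    -- With these coefficients both sides involve the same sum `S = ∑ eᵢ(x)²/μᵢ`, and the Sobolev
    -- bound reads `S² ≤ C S`.
    have h1 := hsum s (fun i => e i x / mu i) x hx
    have e1 : ∑ i ∈ s, e i x / mu i * e i x = ∑ i ∈ s, e i x ^ 2 / mu i :=
      Finset.sum_congr rfl fun i _ => by ring
    have e2 : ∑ i ∈ s, mu i * (e i x / mu i) ^ 2 = ∑ i ∈ s, e i x ^ 2 / mu i :=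
      Finset.sum_congr rfl fun i _ => by
        have := (hpos i).ne'
        field_simp
    rw [e1, e2] at h1
    have h2 : 0 ≤ ∑ i ∈ s, e i x ^ 2 / mu i :=
      Finset.sum_nonneg fun i _ => div_nonneg (sq_nonneg _) (hpos i).le
    by_contra! h3
    nlinarith
  refine ⟨hpos, hone, htrace, fun s => ?_⟩
  have hint : ∀ i, IntervalIntegrable (fun x => e i x ^ 2 / mu i) volume 0 1 := fun i =>
    intervalIntegrable_unit (((h.eigen i).continuousOn.pow 2).div_const _)
  have h1 : ∫ x in (0 : ℝ)..1, ∑ i ∈ s, e i x ^ 2 / mu i ≤ ∫ x in (0 : ℝ)..1, C :=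
    intervalIntegral.integral_mono_on zero_le_one
      (intervalIntegrable_unit (continuousOn_finsetSum _ fun i _ =>
        ((h.eigen i).continuousOn.pow 2).div_const _)) (by simp) (htrace s)
  rw [intervalIntegral.integral_finsetSum fun i _ => hint i] at h1
  simpa [intervalIntegral.integral_div, hi2] using h1

/-- Bessel's inequality. -/
lemma bessel (h : IsOrthonormalEigenfamily V mu e) {f : ℝ → ℝ} (hf : ContinuousOn f (Icc 0 1))
    (s : Finset ι) :
    ∑ i ∈ s, (∫ x in (0 : ℝ)..1, e i x * f x) ^ 2 ≤ ∫ x in (0 : ℝ)..1, f x ^ 2 := by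
  set c : ι → ℝ := fun i => ∫ x in (0 : ℝ)..1, e i x * f x with hc
  have hg := h.continuousOn_sum s c
  have h1 : 0 ≤ ∫ x in (0 : ℝ)..1, (f x - ∑ i ∈ s, c i * e i x) ^ 2 :=
    intervalIntegral.integral_nonneg zero_le_one fun x _ => sq_nonneg _
  have i1 := intervalIntegrable_unit (hf.fun_pow 2)
  have i2 := intervalIntegrable_unit (hf.fun_mul hg)
  have i3 := intervalIntegrable_unit (hg.fun_mul hg)
  have h2 : ∫ x in (0 : ℝ)..1, (f x - ∑ i ∈ s, c i * e i x) ^ 2 =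
      (∫ x in (0 : ℝ)..1, f x ^ 2) - 2 * (∫ x in (0 : ℝ)..1, f x * ∑ i ∈ s, c i * e i x) +
      ∫ x in (0 : ℝ)..1, (∑ i ∈ s, c i * e i x) * ∑ i ∈ s, c i * e i x := by
    rw [← intervalIntegral.integral_const_mul, ← intervalIntegral.integral_sub i1 (i2.const_mul 2),
      ← intervalIntegral.integral_add (i1.sub (i2.const_mul 2)) i3]
    exact integral_unit_congr fun x _ => by ring
  rw [h2, h.integral_mul_sum s c hf, h.integral_sum_mul_sum] at h1
  simp only [← sq] at h1
  have : ∑ i ∈ s, c i * ∫ x in (0 : ℝ)..1, e i x * f x = ∑ i ∈ s, c i ^ 2 :=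
    Finset.sum_congr rfl fun i _ => by rw [sq]
  linarith

/-- Bessel's inequality for the energy. -/
lemma energy_bessel (h : IsOrthonormalEigenfamily V mu e) (hV : ContinuousOn V (Icc 0 1))
    (hVpos : ∀ x ∈ Icc (0 : ℝ) 1, 0 < V x) {f g : ℝ → ℝ} {c₀ : ℝ}
    (hf : ∀ x ∈ Icc (0 : ℝ) 1, f x = c₀ + ∫ y in (0 : ℝ)..x, g y)
    (hg : IntervalIntegrable g volume 0 1)
    (hgg : IntervalIntegrable (fun x => g x * g x) volume 0 1) (s : Finset ι) :
    ∑ i ∈ s, mu i * (∫ x in (0 : ℝ)..1, e i x * f x) ^ 2 ≤ energy V f g := by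
  obtain ⟨e', he'⟩ := h.exists_derivs hV
  set c : ι → ℝ := fun i => ∫ x in (0 : ℝ)..1, e i x * f x with hc
  have hs := NeumannC2.sum s c he'
  have hfc : ContinuousOn f (Icc 0 1) :=
    (continuousOn_const.add (continuousOn_primitive_unit hg)).congr hf
  set p : ℝ → ℝ := fun x => ∑ i ∈ s, c i * e i x with hp
  set p' : ℝ → ℝ := fun x => ∑ i ∈ s, c i * e' i x with hp'
  have hpc : ContinuousOn p (Icc 0 1) := hs.continuousOn
  have hpc' : ContinuousOn p' (Icc 0 1) := hs.continuousOn_one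
  -- The energy of `f - p` is nonnegative, where `p` is the partial expansion of `f`.
  have h1 : 0 ≤ (∫ x in (0 : ℝ)..1, (g x - p' x) * (g x - p' x)) +
      ∫ x in (0 : ℝ)..1, V x * ((f x - p x) * (f x - p x)) :=
    add_nonneg (intervalIntegral.integral_nonneg zero_le_one fun x _ => mul_self_nonneg _)
      (intervalIntegral.integral_nonneg zero_le_one fun x hx =>
        mul_nonneg (hVpos x hx).le (mul_self_nonneg _))
  have i1 : IntervalIntegrable (fun x => g x * p' x) volume 0 1 :=
    hg.mul_continuousOn (by simpa using hpc')
  have i2 := intervalIntegrable_unit (hpc'.fun_mul hpc')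
  have e1 : ∫ x in (0 : ℝ)..1, (g x - p' x) * (g x - p' x) =
      (∫ x in (0 : ℝ)..1, g x * g x) - 2 * (∫ x in (0 : ℝ)..1, g x * p' x) +
        ∫ x in (0 : ℝ)..1, p' x * p' x := by
    rw [← intervalIntegral.integral_const_mul,
      ← intervalIntegral.integral_sub hgg (i1.const_mul 2),
      ← intervalIntegral.integral_add (hgg.sub (i1.const_mul 2)) i2]
    exact integral_unit_congr fun x _ => by ring
  have j0 := intervalIntegrable_unit (hV.fun_mul (hfc.fun_mul hfc))
  have j1 := intervalIntegrable_unit (hV.fun_mul (hfc.fun_mul hpc))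
  have j2 := intervalIntegrable_unit (hV.fun_mul (hpc.fun_mul hpc))
  have e2 : ∫ x in (0 : ℝ)..1, V x * ((f x - p x) * (f x - p x)) =
      (∫ x in (0 : ℝ)..1, V x * (f x * f x)) - 2 * (∫ x in (0 : ℝ)..1, V x * (f x * p x)) +
        ∫ x in (0 : ℝ)..1, V x * (p x * p x) := by
    rw [← intervalIntegral.integral_const_mul,
      ← intervalIntegral.integral_sub j0 (j1.const_mul 2),
      ← intervalIntegral.integral_add (j0.sub (j1.const_mul 2)) j2]
    exact integral_unit_congr fun x _ => by ring
  -- The cross term equals the energy of `p`. The derivative is moved onto the smooth factor `p`, so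
  -- only `H¹` regularity of `f` enters.
  have e3 : (∫ x in (0 : ℝ)..1, g x * p' x) + ∫ x in (0 : ℝ)..1, V x * (f x * p x) =
      ∑ i ∈ s, mu i * c i ^ 2 := by
    have k1 := hs.integral_primitive_mul c₀ hg
    have k2 : ∫ x in (0 : ℝ)..1, (c₀ + ∫ y in (0 : ℝ)..x, g y) *
        ∑ i ∈ s, c i * ((V x - mu i) * e i x) =
        ∫ x in (0 : ℝ)..1, (V x * (f x * p x) - f x * ∑ i ∈ s, mu i * c i * e i x) := by
      refine integral_unit_congr fun x hx => ?_
      rw [← hf x hx]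
      have : ∑ i ∈ s, c i * ((V x - mu i) * e i x) =
          V x * p x - ∑ i ∈ s, mu i * c i * e i x := by
        rw [hp, Finset.mul_sum, ← Finset.sum_sub_distrib]
        exact Finset.sum_congr rfl fun i _ => by ring
      rw [this]
      ring
    rw [k2, intervalIntegral.integral_sub j1 (intervalIntegrable_unit
      (hfc.fun_mul (h.continuousOn_sum s fun i => mu i * c i))),
      h.integral_mul_sum s (fun i => mu i * c i) hfc] at k1
    have k3 : ∑ i ∈ s, mu i * c i ^ 2 =
        ∑ i ∈ s, mu i * c i * ∫ x in (0 : ℝ)..1, e i x * f x :=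
      Finset.sum_congr rfl fun i _ => by rw [sq, ← mul_assoc]
    rw [k3]
    linarith
  have e4 := h.energy_sum hV s c he'
  rw [energy] at e4 ⊢
  linarith

end IsOrthonormalEigenfamily


/-! ### Existence of the eigensystem -/

/-- Finite initial pieces make the order locally finite with a least element, and infinitude
excludes a maximum. Eigenvalues being simple, this order isomorphism is their enumeration. -/
lemma exists_orderIso_nat {S : Set ℝ} (hinf : S.Infinite) (hfin : ∀ B, {x ∈ S | x ≤ B}.Finite) :
    Nonempty (ℕ ≃o S) := by
  have hIic : ∀ b : S, (Iic b).Finite := fun b => by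
    refine Finite.of_finite_image ((hfin b).subset ?_) Subtype.val_injective.injOn
    rintro _ ⟨y, hy, rfl⟩
    exact ⟨y.2, hy⟩
  have hIinf : Infinite S := hinf.to_subtype
  let _ : LocallyFiniteOrder S := LocallyFiniteOrder.ofFiniteIcc fun a b =>
    (hIic b).subset fun _ hx => hx.2
  let _ : SuccOrder S := LinearLocallyFiniteOrder.succOrder S
  let _ : PredOrder S := LinearLocallyFiniteOrder.predOrder S
  have hne : Nonempty S := inferInstance
  obtain ⟨a⟩ := hne
  obtain ⟨m, hm, hmin⟩ := exists_min_image (Iic a) id (hIic a) ⟨a, le_refl a⟩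
  let _ : OrderBot S :=
    { bot := m
      bot_le := fun x => by
        rcases le_total x a with h | h
        · exact hmin x h
        · exact le_trans hm h }
  have _ : NoMaxOrder S := ⟨fun b => by
    by_contra! h
    exact infinite_univ ((hIic b).subset fun x _ => h x)⟩
  exact ⟨orderIsoNatOfLinearSuccPredArch.symm⟩

lemma IsNeumannEigenfunction.exists_normalized {V f : ℝ → ℝ} {lam : ℝ}
    (hf : IsNeumannEigenfunction V lam f) (h0 : ∃ x ∈ Icc (0 : ℝ) 1, f x ≠ 0) :
    ∃ g, IsNeumannEigenfunction V lam g ∧ ∫ x in (0 : ℝ)..1, g x * g x = 1 := by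
  set I := ∫ x in (0 : ℝ)..1, f x * f x with hI
  have hI0 : 0 ≤ I := intervalIntegral.integral_nonneg zero_le_one fun x _ => mul_self_nonneg _
  have hI1 : I ≠ 0 := by
    intro h
    obtain ⟨x, hx, hfx⟩ := h0
    exact hfx (eq_zero_of_integral_sq_eq_zero hf.continuousOn h x hx)
  have hpos : 0 < I := lt_of_le_of_ne hI0 hI1.symm
  refine ⟨_, hf.linear_combination hf (√I)⁻¹ 0, ?_⟩
  have h1 : ∫ x in (0 : ℝ)..1, ((√I)⁻¹ * f x + 0 * f x) * ((√I)⁻¹ * f x + 0 * f x) =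
      ∫ x in (0 : ℝ)..1, I⁻¹ * (f x * f x) := by
    refine integral_unit_congr fun x _ => ?_
    have : I⁻¹ = (√I)⁻¹ * (√I)⁻¹ := by rw [← mul_inv, Real.mul_self_sqrt hI0]
    rw [this]
    ring
  rw [h1, intervalIntegral.integral_const_mul, ← hI, inv_mul_cancel₀ hI1]

/-- With finitely many eigenvalues, the map from polynomials to their coefficients would land in a
finite-dimensional space and be injective by totality, which is impossible. -/
lemma infinite_setOf_eigenvalues {V : ℝ → ℝ} (hV : ContinuousOn V (Icc 0 1))
    (hVpos : ∀ x ∈ Icc (0 : ℝ) 1, 0 < V x) {S : Set ℝ} (e : S → ℝ → ℝ)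
    (he : ∀ i : S, IsNeumannEigenfunction V i (e i))
    (hS : ∀ (lam : ℝ) (f : ℝ → ℝ), IsNeumannEigenfunction V lam f →
      (∃ x ∈ Icc (0 : ℝ) 1, f x ≠ 0) → ∃ h : lam ∈ S, ∃ c : ℝ, ∀ x ∈ Icc (0 : ℝ) 1,
        f x = c * e ⟨lam, h⟩ x) : S.Infinite := by
  intro hfin
  have _ : Finite S := hfin
  let T : Polynomial ℝ →ₗ[ℝ] (S → ℝ) := LinearMap.pi fun i =>
    { toFun := fun p => ∫ x in (0 : ℝ)..1, e i x * p.eval x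
      map_add' := fun p q => by
        rw [← intervalIntegral.integral_add
          (intervalIntegrable_unit ((he i).continuousOn.fun_mul p.continuous.continuousOn))
          (intervalIntegrable_unit ((he i).continuousOn.fun_mul q.continuous.continuousOn))]
        exact integral_unit_congr fun x _ => by rw [Polynomial.eval_add, mul_add]
      map_smul' := fun a p => by
        rw [RingHom.id_apply, smul_eq_mul, ← intervalIntegral.integral_const_mul]
        exact integral_unit_congr fun x _ => by rw [Polynomial.eval_smul, smul_eq_mul]; ring }
  have hker : ∀ p, T p = 0 → p = 0 := by
    intro p hp
    have hz : ∀ x ∈ Icc (0 : ℝ) 1, p.eval x = 0 := by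
      refine eq_zero_of_orthogonal_eigenfunctions hV hVpos p.continuous.continuousOn
        fun lam f hf => ?_
      by_cases h0 : ∃ x ∈ Icc (0 : ℝ) 1, f x ≠ 0
      · obtain ⟨h, c, hc⟩ := hS lam f hf h0
        have h1 : ∫ x in (0 : ℝ)..1, e ⟨lam, h⟩ x * p.eval x = 0 := congrFun hp ⟨lam, h⟩
        rw [integral_unit_congr (g := fun x => c * (e ⟨lam, h⟩ x * p.eval x))
          (fun x hx => by rw [hc x hx, mul_assoc]), intervalIntegral.integral_const_mul, h1,
          mul_zero]
      · push Not at h0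
        rw [integral_unit_congr (g := fun _ => 0) (fun x hx => by rw [h0 x hx, zero_mul])]
        simp
    exact Polynomial.eq_zero_of_infinite_isRoot p ((Icc_infinite zero_lt_one).mono hz)
  have hinj : Function.Injective T := (injective_iff_map_eq_zero T).2 hker
  have hfd : Module.Finite ℝ (Polynomial ℝ) := Module.Finite.of_injective T hinj
  have : Finite ℕ := Module.Finite.finite_basis (Polynomial.basisMonomials ℝ)
  exact not_finite ℕ

/-- One normalized eigenfunction per eigenvalue suffices, by simplicity, and these are orthonormal.
The bound `∑ 1/μ ≤ C` leaves finitely many eigenvalues below any level, so they can be listed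
increasingly. -/
theorem exists_isNeumannEigensystem {V : ℝ → ℝ} (hV : ContinuousOn V (Icc 0 1))
    (hVpos : ∀ x ∈ Icc (0 : ℝ) 1, 0 < V x) :
    ∃ (mu : ℕ → ℝ) (e : ℕ → ℝ → ℝ), IsNeumannEigensystem V mu e := by
  classical
  let S : Set ℝ := {lam | ∃ f, IsNeumannEigenfunction V lam f ∧ ∃ x ∈ Icc (0 : ℝ) 1, f x ≠ 0}
  have hSn : ∀ i : S, ∃ g, IsNeumannEigenfunction V i g ∧ ∫ x in (0 : ℝ)..1, g x * g x = 1 :=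
    fun i => by
      obtain ⟨f, hf, h0⟩ := i.2
      exact hf.exists_normalized h0
  choose e he heI using hSn
  have hne : ∀ i : S, ∃ x ∈ Icc (0 : ℝ) 1, e i x ≠ 0 := by
    intro i
    by_contra! h0
    have h1 := heI i
    rw [integral_unit_congr (g := fun _ => 0) (fun x hx => by rw [h0 x hx, mul_zero])] at h1
    simp at h1
  have hfam : IsOrthonormalEigenfamily V (fun i : S => (i : ℝ)) e := ⟨he, fun i j => by
    split_ifs with h
    · rw [h, heI]
    · exact (he i).integral_mul_eq_zero hV (he j) fun h' => h (Subtype.ext h')⟩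
  have hS : ∀ (lam : ℝ) (f : ℝ → ℝ), IsNeumannEigenfunction V lam f →
      (∃ x ∈ Icc (0 : ℝ) 1, f x ≠ 0) → ∃ h : lam ∈ S, ∃ c : ℝ, ∀ x ∈ Icc (0 : ℝ) 1,
        f x = c * e ⟨lam, h⟩ x := by
    intro lam f hf h0
    have h : lam ∈ S := ⟨f, hf, h0⟩
    exact ⟨h, hf.exists_eq_mul hV (he ⟨lam, h⟩) (hne ⟨lam, h⟩)⟩
  have hinf := infinite_setOf_eigenvalues hV hVpos e he hS
  obtain ⟨C, hC, hb⟩ := IsOrthonormalEigenfamily.exists_trace_bound hV hVpos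
  obtain ⟨hpos, -, -, htr⟩ := hb S _ e hfam
  have hfin : ∀ B, {x ∈ S | x ≤ B}.Finite := by
    intro B
    by_contra hB
    -- Having `n + 1` eigenvalues at most `B` would force `(n + 1)/B ≤ C`.
    obtain ⟨n, hn⟩ := exists_nat_gt (C * B)
    obtain ⟨t, ht, hcard⟩ := Set.Infinite.exists_subset_card_eq hB (n + 1)
    have htS : ∀ x ∈ t, x ∈ S := fun x hx => (ht hx).1
    have htB : ∀ x ∈ t, x ≤ B := fun x hx => (ht hx).2
    have h1 := htr (t.attach.map ⟨fun x : t => (⟨x.1, htS x.1 x.2⟩ : S), fun a b hab =>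
      Subtype.ext (congrArg (fun z : S => (z : ℝ)) hab)⟩)
    rw [Finset.sum_map] at h1
    have h2 : ∀ x ∈ t.attach, B⁻¹ ≤ (x : ℝ)⁻¹ := fun x _ =>
      inv_anti₀ (hpos ⟨x, htS x.1 x.2⟩) (htB x.1 x.2)
    have h3 := (Finset.card_nsmul_le_sum _ _ _ h2).trans h1
    rw [Finset.card_attach, hcard, nsmul_eq_mul] at h3
    obtain ⟨y, hy⟩ : t.Nonempty := Finset.card_pos.1 (by omega)
    have hB0 : 0 < B := (hpos ⟨y, htS y hy⟩).trans_le (htB y hy)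
    rw [← div_eq_mul_inv, div_le_iff₀ hB0] at h3
    push_cast at h3
    linarith
  obtain ⟨φ⟩ := exists_orderIso_nat hinf hfin
  refine ⟨fun n => φ n, fun n => e (φ n), fun a b hab => φ.monotone hab, fun n => he _,
    fun m n => ?_, fun lam f hf hort => ?_⟩
  · rw [hfam.orthonormal]
    exact if_congr φ.injective.eq_iff rfl rfl
  · by_contra! h0
    obtain ⟨h, c, hc⟩ := hS lam f hf h0
    have h1 := hort (φ.symm ⟨lam, h⟩)
    rw [φ.apply_symm_apply, integral_unit_congr
      (g := fun x => c * (e ⟨lam, h⟩ x * e ⟨lam, h⟩ x)) (fun x hx => by rw [hc x hx]; ring),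
      intervalIntegral.integral_const_mul, heI, mul_one] at h1
    obtain ⟨x, hx, hfx⟩ := h0
    exact hfx (by rw [hc x hx, h1, zero_mul])


/-! ### Series of eigenfunctions -/

/-- Extending each `f' n` constantly beyond `[0,1]` and integrating reduces one-sided
differentiation at the end points to termwise differentiation on the line. -/
lemma hasDerivWithinAt_tsum_unit {f f' : ℕ → ℝ → ℝ} {u : ℕ → ℝ} (hu : Summable u)
    (h1 : ∀ n, ∀ x ∈ Icc (0 : ℝ) 1, HasDerivWithinAt (f n) (f' n x) (Icc 0 1) x)
    (h2 : ∀ n, ContinuousOn (f' n) (Icc 0 1)) (h3 : ∀ n, ∀ x ∈ Icc (0 : ℝ) 1, |f' n x| ≤ u n)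
    (h4 : Summable fun n => f n 0) {x : ℝ} (hx : x ∈ Icc (0 : ℝ) 1) :
    HasDerivWithinAt (fun x => ∑' n, f n x) (∑' n, f' n x) (Icc 0 1) x := by
  let G : ℕ → ℝ → ℝ := fun n => IccExtend zero_le_one ((Icc (0 : ℝ) 1).domRestrict (f' n))
  have hG : ∀ n, Continuous (G n) := fun n =>
    (continuousOn_iff_continuous_domRestrict.1 (h2 n)).Icc_extend'
  have hGf : ∀ n, ∀ y ∈ Icc (0 : ℝ) 1, G n y = f' n y := fun n y hy => by
    simp only [G, IccExtend_of_mem _ _ hy]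
    rfl
  have hGb : ∀ n y, ‖G n y‖ ≤ u n := fun n y =>
    h3 n _ (projIcc (0 : ℝ) 1 zero_le_one y).2
  have hF : ∀ n y, HasDerivAt (fun z => f n 0 + ∫ w in (0 : ℝ)..z, G n w) (G n y) y := fun n y =>
    ((hG n).integral_hasStrictDerivAt 0 y).hasDerivAt.const_add _
  have hFf : ∀ n, ∀ y ∈ Icc (0 : ℝ) 1, f n y = f n 0 + ∫ w in (0 : ℝ)..y, G n w := by
    intro n y hy
    have hsub : Icc 0 y ⊆ Icc (0 : ℝ) 1 := Icc_subset_Icc_right hy.2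
    have e1 : ∫ w in (0 : ℝ)..y, G n w = ∫ w in (0 : ℝ)..y, f' n w :=
      intervalIntegral.integral_congr fun w hw => hGf n w (hsub (uIcc_of_le hy.1 ▸ hw))
    rw [e1, intervalIntegral.integral_eq_sub_of_hasDerivAt_of_le hy.1
      (fun w hw => ((h1 n w (hsub hw)).continuousWithinAt).mono hsub)
      (fun w hw => (h1 n w (hsub (Ioo_subset_Icc_self hw))).hasDerivAt
        (Icc_mem_nhds hw.1 (hw.2.trans_le hy.2)))
      (((h2 n).mono hsub).intervalIntegrable_of_Icc hy.1)]
    ring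
  have key := (hasDerivAt_tsum hu hF hGb (y₀ := 0) (by simpa using h4) x).hasDerivWithinAt
    (s := Icc (0 : ℝ) 1)
  rw [tsum_congr fun n => hGf n x hx] at key
  exact key.congr (fun y hy => tsum_congr fun n => hFf n y hy) (tsum_congr fun n => hFf n x hx)

section Eigensystem

variable {V : ℝ → ℝ} {mu : ℕ → ℝ} {e : ℕ → ℝ → ℝ}

lemma IsNeumannEigensystem.exists_bounds (hE : IsNeumannEigensystem V mu e)
    (hV : ContinuousOn V (Icc 0 1)) (hVpos : ∀ x ∈ Icc (0 : ℝ) 1, 0 < V x) :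
    ∃ C : ℝ, 0 < C ∧ (∀ n, 0 < mu n) ∧ (∀ n, 1 ≤ C * mu n) ∧
      (∀ n, ∀ x ∈ Icc (0 : ℝ) 1, |e n x| ≤ C * mu n) ∧ (Summable fun n => (mu n)⁻¹) ∧
      ∀ s : Finset ℕ, ∀ x ∈ Icc (0 : ℝ) 1, ∑ i ∈ s, e i x ^ 2 / mu i ≤ C := by
  obtain ⟨C, hC, hb⟩ := IsOrthonormalEigenfamily.exists_trace_bound hV hVpos
  obtain ⟨h1, h2, h3, h4⟩ := hb ℕ mu e hE.family
  have h5 : ∀ n, 1 ≤ C * mu n := by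
    intro n
    have := h4 {n}
    rw [Finset.sum_singleton, inv_le_iff_one_le_mul₀ (h1 n)] at this
    linarith
  refine ⟨C, hC, h1, h5, fun n x hx => ?_, ?_, h3⟩
  · refine abs_le_of_sq_le_sq ?_ (by linarith [h5 n])
    nlinarith [h2 n x hx, h5 n]
  · exact summable_of_sum_le (fun n => (inv_pos.2 (h1 n)).le) h4

/-- A repeated eigenvalue would have two proportional eigenfunctions, which cannot be orthonormal.
-/
lemma IsNeumannEigensystem.strictMono (hE : IsNeumannEigensystem V mu e)
    (hV : ContinuousOn V (Icc 0 1)) : StrictMono mu := by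
  refine hE.monotone.strictMono_of_injective fun m n hmn => ?_
  by_contra hne
  have hn := hE.orthonormal n n
  have hm := hE.orthonormal m m
  have hnm := hE.orthonormal m n
  simp only [hne, if_true, if_false] at hn hm hnm
  have h0 : ∃ x ∈ Icc (0 : ℝ) 1, e n x ≠ 0 := by
    by_contra! h0
    rw [integral_unit_congr (g := fun _ => 0) (fun x hx => by rw [h0 x hx, mul_zero])] at hn
    simp at hn
  obtain ⟨c, hc⟩ := (hmn ▸ hE.eigen m).exists_eq_mul hV (hE.eigen n) h0
  rw [integral_unit_congr (g := fun x => c * (e n x * e n x))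
    (fun x hx => by rw [hc x hx]; ring), intervalIntegral.integral_const_mul, hn, mul_one] at hnm
  rw [integral_unit_congr (g := fun _ => 0) (fun x hx => by rw [hc x hx, hnm]; ring)] at hm
  simp at hm

/-- The weak derivative of the initial value is used here: its energy is finite and bounds all
partial sums. -/
lemma IsNeumannEigensystem.summable_mul_sq_coeff (hE : IsNeumannEigensystem V mu e)
    (hV : ContinuousOn V (Icc 0 1)) (hVpos : ∀ x ∈ Icc (0 : ℝ) 1, 0 < V x) {f : ℝ → ℝ}
    (hf : f ∈ PPlus) : Summable fun n => mu n * coeff e n f ^ 2 := by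
  obtain ⟨hfc, -, -, g, hg, hw⟩ := hf
  have hgi := intervalIntegrable_of_memLp hg
  obtain ⟨c, hc⟩ := hw.exists_eq_primitive hfc hgi
  have hgg : IntervalIntegrable (fun x => g x * g x) volume 0 1 := by
    rw [intervalIntegrable_iff_integrableOn_Icc_of_le zero_le_one]
    have h2 := hg.integrable_sq
    simp only [sq] at h2
    exact h2
  obtain ⟨C, hC, h1, -⟩ := hE.exists_bounds hV hVpos
  exact summable_of_sum_le (fun n => mul_nonneg (h1 n).le (sq_nonneg _))
    fun s => hE.family.energy_bessel hV hVpos hc hgi hgg s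

/-- Compare `|a|` with `μa² + 1/μ`, and use `∑ 1/μ < ∞`. -/
lemma summable_abs_coeff (hE : IsNeumannEigensystem V mu e)
    (hV : ContinuousOn V (Icc 0 1)) (hVpos : ∀ x ∈ Icc (0 : ℝ) 1, 0 < V x) {a : ℕ → ℝ}
    (ha : Summable fun n => mu n * a n ^ 2) : Summable fun n => |a n| := by
  obtain ⟨C, hC, h1, -, -, h2, -⟩ := hE.exists_bounds hV hVpos
  refine Summable.of_nonneg_of_le (fun n => abs_nonneg _) (fun n => ?_) (ha.add h2)
  have h := h1 n
  rw [← sq_abs (a n)]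
  have e1 : mu n * |a n| ^ 2 + (mu n)⁻¹ - |a n| =
      (mu n)⁻¹ * ((mu n * |a n| - 1 / 2) ^ 2 + 3 / 4) := by
    field_simp
    ring
  have e2 : 0 ≤ (mu n)⁻¹ * ((mu n * |a n| - 1 / 2) ^ 2 + 3 / 4) := by positivity
  linarith

/-- `∑ |aₙ eₙ(x)| ≤ δ⁻¹ ∑ μₙ aₙ² + δ C`. -/
lemma summable_mul_eigenfunction (hE : IsNeumannEigensystem V mu e)
    (hV : ContinuousOn V (Icc 0 1)) (hVpos : ∀ x ∈ Icc (0 : ℝ) 1, 0 < V x) :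
    ∃ C : ℝ, 0 < C ∧ ∀ a : ℕ → ℝ, (Summable fun n => mu n * a n ^ 2) →
      ∀ x ∈ Icc (0 : ℝ) 1, (Summable fun n => |a n * e n x|) ∧
      ∀ δ > 0, ∑' n, |a n * e n x| ≤ δ⁻¹ * (∑' n, mu n * a n ^ 2) + δ * C := by
  obtain ⟨C, hC, h1, -, -, -, h2⟩ := hE.exists_bounds hV hVpos
  refine ⟨C, hC, fun a ha x hx => ?_⟩
  have hs : Summable fun n => e n x ^ 2 / mu n :=
    summable_of_sum_le (fun n => div_nonneg (sq_nonneg _) (h1 n).le) fun s => h2 s x hx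
  have hsC : ∑' n, e n x ^ 2 / mu n ≤ C := hs.tsum_le_of_sum_le fun s => h2 s x hx
  -- Young's inequality with a free `δ`: for tails, `δ C` is made small first and then `δ⁻¹ ∑
  -- μₙaₙ²`.
  have hle : ∀ δ > 0, ∀ n, |a n * e n x| ≤ δ⁻¹ * (mu n * a n ^ 2) + δ * (e n x ^ 2 / mu n) := by
    intro δ hδ n
    have h := h1 n
    rw [← sq_abs (a n), ← sq_abs (e n x), abs_mul]
    have e1 : δ⁻¹ * (mu n * |a n| ^ 2) + δ * (|e n x| ^ 2 / mu n) - |a n| * |e n x| =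
        (δ * mu n)⁻¹ * ((mu n * |a n| - δ * |e n x| / 2) ^ 2 + 3 / 4 * (δ * |e n x|) ^ 2) := by
      field_simp
      ring
    have e2 : 0 ≤ (δ * mu n)⁻¹ *
      ((mu n * |a n| - δ * |e n x| / 2) ^ 2 + 3 / 4 * (δ * |e n x|) ^ 2) := by positivity
    linarith
  have hsum : Summable fun n => |a n * e n x| :=
    Summable.of_nonneg_of_le (fun n => abs_nonneg _) (hle 1 one_pos)
      ((ha.mul_left _).add (hs.mul_left _))
  refine ⟨hsum, fun δ hδ => ?_⟩
  calc ∑' n, |a n * e n x| ≤ ∑' n, (δ⁻¹ * (mu n * a n ^ 2) + δ * (e n x ^ 2 / mu n)) :=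
        hsum.tsum_le_tsum (hle δ hδ) ((ha.mul_left _).add (hs.mul_left _))
    _ = δ⁻¹ * (∑' n, mu n * a n ^ 2) + δ * ∑' n, e n x ^ 2 / mu n := by
        rw [(ha.mul_left _).tsum_add (hs.mul_left _), tsum_mul_left, tsum_mul_left]
    _ ≤ _ := by gcongr

/-- Termwise integration. -/
lemma hasSum_integral_series (hE : IsNeumannEigensystem V mu e)
    (hV : ContinuousOn V (Icc 0 1)) (hVpos : ∀ x ∈ Icc (0 : ℝ) 1, 0 < V x) {a : ℕ → ℝ}
    (ha : Summable fun n => mu n * a n ^ 2) {φ : ℝ → ℝ} (hφ : ContinuousOn φ (Icc 0 1)) :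
    HasSum (fun n => a n * ∫ x in (0 : ℝ)..1, e n x * φ x)
      (∫ x in (0 : ℝ)..1, (∑' n, a n * e n x) * φ x) := by
  obtain ⟨K, hK⟩ := isCompact_Icc.exists_bound_of_continuousOn hφ
  have hK0 : 0 ≤ K := (norm_nonneg _).trans (hK 0 (by simp))
  have hc : ∀ n, ContinuousOn (fun x => a n * (e n x * φ x)) (Icc 0 1) := fun n =>
    continuousOn_const.mul ((hE.eigen n).continuousOn.mul hφ)
  have hint : ∀ n, Integrable (fun x => a n * (e n x * φ x)) (volume.restrict (Ioc (0 : ℝ) 1)) :=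
    fun n => (intervalIntegrable_iff_integrableOn_Ioc_of_le zero_le_one).1
      (intervalIntegrable_unit (hc n))
  -- Since `|eₙ| ≤ 1/2 + eₙ²/2`, normalization bounds `∫ |eₙ|` by 1.
  have hle : ∀ n, ∫ x in (0 : ℝ)..1, ‖a n * (e n x * φ x)‖ ≤ K * |a n| := by
    intro n
    have hen := (hE.eigen n).continuousOn
    have h1 : ∫ x in (0 : ℝ)..1, ‖a n * (e n x * φ x)‖ ≤
        ∫ x in (0 : ℝ)..1, K * |a n| * (1 / 2 + e n x * e n x / 2) := by
      refine intervalIntegral.integral_mono_on zero_le_one (intervalIntegrable_unit (hc n)).norm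
        (intervalIntegrable_unit (continuousOn_const.mul
          (continuousOn_const.add ((hen.mul hen).div_const 2)))) fun x hx => ?_
      rw [norm_mul, norm_mul, Real.norm_eq_abs, Real.norm_eq_abs]
      have h2 := hK x hx
      have h3 : |e n x| ≤ 1 / 2 + e n x * e n x / 2 := by
        rw [← abs_mul_abs_self (e n x)]
        nlinarith [sq_nonneg (|e n x| - 1)]
      have h4 : 0 ≤ 1 / 2 + e n x * e n x / 2 := (abs_nonneg _).trans h3
      calc |a n| * (|e n x| * ‖φ x‖) ≤ |a n| * ((1 / 2 + e n x * e n x / 2) * K) := by gcongr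
        _ = _ := by ring
    refine h1.trans (le_of_eq ?_)
    rw [intervalIntegral.integral_const_mul, intervalIntegral.integral_add (by simp)
      (intervalIntegrable_unit ((hen.fun_mul hen).div_const 2)), intervalIntegral.integral_div,
      intervalIntegral.integral_div, hE.orthonormal n n]
    norm_num
  have h := hasSum_integral_of_summable_integral_norm hint (by
    refine Summable.of_nonneg_of_le (fun n => integral_nonneg fun x => norm_nonneg _)
      (fun n => ?_) ((summable_abs_coeff hE hV hVpos ha).mul_left K)
    rw [← intervalIntegral.integral_of_le zero_le_one]
    exact hle n)
  simp only [← intervalIntegral.integral_of_le (zero_le_one' ℝ),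
    intervalIntegral.integral_const_mul] at h
  have e1 : ∫ x in (0 : ℝ)..1, (∑' n, a n * e n x) * φ x =
      ∫ x in (0 : ℝ)..1, ∑' n, a n * (e n x * φ x) := by
    refine integral_unit_congr fun x _ => ?_
    rw [← tsum_mul_right]
    exact tsum_congr fun n => by ring
  rw [e1]
  exact h

end Eigensystem


/-! ### The linear heat equation -/

/-- The series `∑ e^{-μₙ t} cₙ eₙ(x)`. -/
noncomputable def heatSeries (mu : ℕ → ℝ) (e : ℕ → ℝ → ℝ) (c : ℕ → ℝ) (t x : ℝ) : ℝ :=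
  ∑' n, Real.exp (-mu n * t) * c n * e n x

section Heat

variable {V : ℝ → ℝ} {mu : ℕ → ℝ} {e : ℕ → ℝ → ℝ} {c : ℕ → ℝ}

lemma abs_exp_mul_le {m t a : ℝ} (hm : 0 ≤ m) (ht : 0 ≤ t) : |Real.exp (-m * t) * a| ≤ |a| := by
  rw [abs_mul, Real.abs_exp]
  refine mul_le_of_le_one_left (abs_nonneg _) (Real.exp_le_one_iff.2 ?_)
  nlinarith [mul_nonneg hm ht]

lemma summable_mul_sq_exp (hmu : ∀ n, 0 < mu n) (hc : Summable fun n => mu n * c n ^ 2) {t : ℝ}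
    (ht : 0 ≤ t) : Summable fun n => mu n * (Real.exp (-mu n * t) * c n) ^ 2 :=
  Summable.of_nonneg_of_le (fun n => mul_nonneg (hmu n).le (sq_nonneg _))
    (fun n => mul_le_mul_of_nonneg_left (sq_le_sq.2 (abs_exp_mul_le (hmu n).le ht)) (hmu n).le) hc

lemma hasSum_ite_mem_finset (s : Finset ℕ) (f : ℕ → ℝ) :
    HasSum (fun n => if n ∈ s then f n else 0) (∑ n ∈ s, f n) := by
  have h : HasSum (fun n => if n ∈ s then f n else 0) (∑ n ∈ s, if n ∈ s then f n else 0) :=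
    hasSum_sum_of_ne_finset_zero fun n hn => if_neg hn
  rwa [Finset.sum_congr rfl fun n hn => if_pos hn] at h

/-- The tail is at most `δ⁻¹ ∑_{n≥N} μₙcₙ² + δ C`, independently of `t ≥ 0` and `x`. Taking `δ =
ε/(2C)` gives uniform convergence including the initial time. -/
lemma continuousOn_heatSeries (hE : IsNeumannEigensystem V mu e)
    (hV : ContinuousOn V (Icc 0 1)) (hVpos : ∀ x ∈ Icc (0 : ℝ) 1, 0 < V x)
    (hc : Summable fun n => mu n * c n ^ 2) :
    ContinuousOn (fun p : ℝ × ℝ => heatSeries mu e c p.1 p.2) (Ici 0 ×ˢ Icc 0 1) := by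
  obtain ⟨-, -, hmu, -⟩ := hE.exists_bounds hV hVpos
  obtain ⟨C, hC, hsum⟩ := summable_mul_eigenfunction hE hV hVpos
  have hcont : ∀ n, ContinuousOn (fun p : ℝ × ℝ => Real.exp (-mu n * p.1) * c n * e n p.2)
      (Ici 0 ×ˢ Icc 0 1) := fun n =>
    (by fun_prop : Continuous fun p : ℝ × ℝ => Real.exp (-mu n * p.1) * c n).continuousOn.mul
      ((hE.eigen n).continuousOn.comp continuousOn_snd fun p hp => hp.2)
  have hunif : TendstoUniformlyOn (fun (N : ℕ) (p : ℝ × ℝ) => ∑ n ∈ Finset.range N,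
      Real.exp (-mu n * p.1) * c n * e n p.2) (fun p => heatSeries mu e c p.1 p.2) atTop
      (Ici 0 ×ˢ Icc 0 1) := by
    rw [Metric.tendstoUniformlyOn_iff]
    intro ε hε
    have hlim : Tendsto (fun N : ℕ => (ε / (2 * C))⁻¹ *
        ((∑' n, mu n * c n ^ 2) - ∑ n ∈ Finset.range N, mu n * c n ^ 2)) atTop (𝓝 0) := by
      have := (hc.hasSum.tendsto_sum_nat.const_sub (∑' n, mu n * c n ^ 2)).const_mul
        (ε / (2 * C))⁻¹
      rwa [sub_self, mul_zero] at this
    filter_upwards [hlim.eventually (gt_mem_nhds (half_pos hε))] with N hN p hp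
    obtain ⟨ht, hx⟩ := hp
    let b : ℕ → ℝ := fun n => if n < N then 0 else Real.exp (-mu n * p.1) * c n
    have hble : ∀ n, mu n * b n ^ 2 ≤ mu n * c n ^ 2 - if n ∈ Finset.range N then
        mu n * c n ^ 2 else 0 := by
      intro n
      simp only [b, Finset.mem_range]
      split_ifs
      · simp
      · rw [sub_zero]
        exact mul_le_mul_of_nonneg_left (sq_le_sq.2 (abs_exp_mul_le (hmu n).le ht)) (hmu n).le
    have hfin : HasSum (fun n => if n ∈ Finset.range N then mu n * c n ^ 2 else 0)
        (∑ n ∈ Finset.range N, mu n * c n ^ 2) :=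
      hasSum_ite_mem_finset _ fun n => mu n * c n ^ 2
    have htail := hc.hasSum.sub hfin
    have hb : Summable fun n => mu n * b n ^ 2 := Summable.of_nonneg_of_le
      (fun n => mul_nonneg (hmu n).le (sq_nonneg _)) hble htail.summable
    have hb1 : ∑' n, mu n * b n ^ 2 ≤
        (∑' n, mu n * c n ^ 2) - ∑ n ∈ Finset.range N, mu n * c n ^ 2 := by
      rw [← htail.tsum_eq]
      exact hb.tsum_le_tsum hble htail.summable
    obtain ⟨hbs, hbδ⟩ := hsum b hb p.2 hx
    have hbδ := hbδ (ε / (2 * C)) (by positivity)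
    have hu := ((hsum _ (summable_mul_sq_exp hmu hc ht) p.2 hx).1.of_abs).hasSum
    have hfin2 : HasSum (fun n => if n ∈ Finset.range N then
        Real.exp (-mu n * p.1) * c n * e n p.2 else 0)
        (∑ n ∈ Finset.range N, Real.exp (-mu n * p.1) * c n * e n p.2) :=
      hasSum_ite_mem_finset _ fun n => Real.exp (-mu n * p.1) * c n * e n p.2
    have hdiff := hu.sub hfin2
    have hbe : (fun n => Real.exp (-mu n * p.1) * c n * e n p.2 - if n ∈ Finset.range N then
        Real.exp (-mu n * p.1) * c n * e n p.2 else 0) = fun n => b n * e n p.2 := by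
      funext n
      simp only [b, Finset.mem_range]
      split_ifs <;> simp
    rw [hbe] at hdiff
    rw [Real.dist_eq]
    change |(∑' n, Real.exp (-mu n * p.1) * c n * e n p.2) - _| < ε
    rw [← hdiff.tsum_eq]
    have h1 : |∑' n, b n * e n p.2| ≤ ∑' n, |b n * e n p.2| := by
      simpa only [Real.norm_eq_abs] using norm_tsum_le_tsum_norm (f := fun n => b n * e n p.2)
        (by simpa only [Real.norm_eq_abs] using hbs)
    have h2 : ε / (2 * C) * C = ε / 2 := by field_simp
    have h3 : (ε / (2 * C))⁻¹ * (∑' n, mu n * b n ^ 2) ≤ (ε / (2 * C))⁻¹ *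
        ((∑' n, mu n * c n ^ 2) - ∑ n ∈ Finset.range N, mu n * c n ^ 2) := by gcongr
    linarith
  exact hunif.continuousOn (Frequently.of_forall fun N =>
    continuousOn_finsetSum _ fun n _ => hcont n)

lemma hasSum_integral_heatSeries (hE : IsNeumannEigensystem V mu e)
    (hV : ContinuousOn V (Icc 0 1)) (hVpos : ∀ x ∈ Icc (0 : ℝ) 1, 0 < V x)
    (hc : Summable fun n => mu n * c n ^ 2) {t : ℝ} (ht : 0 ≤ t) {φ : ℝ → ℝ}
    (hφ : ContinuousOn φ (Icc 0 1)) :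
    HasSum (fun n => Real.exp (-mu n * t) * c n * ∫ x in (0 : ℝ)..1, e n x * φ x)
      (∫ x in (0 : ℝ)..1, heatSeries mu e c t x * φ x) := by
  obtain ⟨-, -, hmu, -⟩ := hE.exists_bounds hV hVpos
  exact hasSum_integral_series hE hV hVpos (summable_mul_sq_exp hmu hc ht) hφ

lemma continuousOn_heatSeries_right (hE : IsNeumannEigensystem V mu e)
    (hV : ContinuousOn V (Icc 0 1)) (hVpos : ∀ x ∈ Icc (0 : ℝ) 1, 0 < V x)
    (hc : Summable fun n => mu n * c n ^ 2) {t : ℝ} (ht : 0 ≤ t) :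
    ContinuousOn (heatSeries mu e c t) (Icc 0 1) :=
  (continuousOn_heatSeries hE hV hVpos hc).comp
    (by fun_prop : Continuous fun x : ℝ => (t, x)).continuousOn fun _ hx => ⟨ht, hx⟩

lemma integral_mul_heatSeries (hE : IsNeumannEigensystem V mu e)
    (hV : ContinuousOn V (Icc 0 1)) (hVpos : ∀ x ∈ Icc (0 : ℝ) 1, 0 < V x)
    (hc : Summable fun n => mu n * c n ^ 2) {t : ℝ} (ht : 0 ≤ t) (m : ℕ) :
    ∫ x in (0 : ℝ)..1, e m x * heatSeries mu e c t x = Real.exp (-mu m * t) * c m := by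
  have h := hasSum_integral_heatSeries hE hV hVpos hc ht (hE.eigen m).continuousOn
  have h2 : HasSum (fun n => Real.exp (-mu n * t) * c n * ∫ x in (0 : ℝ)..1, e n x * e m x)
      (Real.exp (-mu m * t) * c m) := by
    convert hasSum_ite_eq m (Real.exp (-mu m * t) * c m) using 2 with n
    rw [hE.orthonormal]
    split_ifs with hnm
    · rw [hnm, mul_one]
    · rw [mul_zero]
  rw [← h.unique h2]
  exact integral_unit_congr fun x _ => mul_comm _ _

/-- A continuous function is determined by its coefficients. -/
lemma eq_heatSeries_of_coeff (hE : IsNeumannEigensystem V mu e)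
    (hV : ContinuousOn V (Icc 0 1)) (hVpos : ∀ x ∈ Icc (0 : ℝ) 1, 0 < V x)
    (hc : Summable fun n => mu n * c n ^ 2) {t : ℝ} (ht : 0 ≤ t) {f : ℝ → ℝ} {b : ℝ}
    (hf : ContinuousOn f (Icc 0 1))
    (h : ∀ n, coeff e n f = b * (Real.exp (-mu n * t) * c n)) :
    ∀ x ∈ Icc (0 : ℝ) 1, f x = b * heatSeries mu e c t x := by
  have hu := continuousOn_heatSeries_right hE hV hVpos hc ht
  have := hE.eq_zero_of_orthogonal hV hVpos (hf.sub (continuousOn_const.mul hu)) (fun n => by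
    have hn := (hE.eigen n).continuousOn
    have e1 : ∫ x in (0 : ℝ)..1, e n x * (f x - b * heatSeries mu e c t x) =
        coeff e n f - b * ∫ x in (0 : ℝ)..1, e n x * heatSeries mu e c t x := by
      rw [coeff, ← intervalIntegral.integral_const_mul, ← intervalIntegral.integral_sub
        (intervalIntegrable_unit (hn.fun_mul hf))
        ((intervalIntegrable_unit (hn.fun_mul hu)).const_mul b)]
      exact integral_unit_congr fun x _ => by ring
    exact e1.trans (by rw [integral_mul_heatSeries hE hV hVpos hc ht, h n, sub_self]))
  exact fun x hx => sub_eq_zero.1 (this x hx)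

lemma heatSeries_zero (hE : IsNeumannEigensystem V mu e)
    (hV : ContinuousOn V (Icc 0 1)) (hVpos : ∀ x ∈ Icc (0 : ℝ) 1, 0 < V x) {f : ℝ → ℝ}
    (hf : f ∈ PPlus) : ∀ x ∈ Icc (0 : ℝ) 1, heatSeries mu e (fun n => coeff e n f) 0 x = f x := by
  intro x hx
  have := eq_heatSeries_of_coeff hE hV hVpos (hE.summable_mul_sq_coeff hV hVpos hf) le_rfl
    (b := 1) hf.1 (fun n => by simp) x hx
  rw [this, one_mul]

/-- From `s³/6 ≤ e^s` at `s = μt₀` one gets `μ² e^{-μt₀} ≤ 6/(t₀³μ)`, which is summable. Growth of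
order `μ²` covers the eigenfunctions, their two space derivatives and the factor `μ` of the time
derivative. -/
lemma exists_majorant (hE : IsNeumannEigensystem V mu e)
    (hV : ContinuousOn V (Icc 0 1)) (hVpos : ∀ x ∈ Icc (0 : ℝ) 1, 0 < V x)
    (hc : Summable fun n => mu n * c n ^ 2) {K t₀ : ℝ} (ht₀ : 0 < t₀) :
    ∃ u : ℕ → ℝ, Summable u ∧ ∀ n t y, t₀ ≤ t → |y| ≤ K * mu n ^ 2 →
      |Real.exp (-mu n * t) * c n * y| ≤ u n := by
  obtain ⟨-, -, hmu, -, -, hs, -⟩ := hE.exists_bounds hV hVpos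
  have hcs := summable_abs_coeff hE hV hVpos hc
  set D := ∑' n, |c n|
  have hD : ∀ n, |c n| ≤ D := fun n => hcs.le_tsum n fun _ _ => abs_nonneg _
  have hD0 : 0 ≤ D := (abs_nonneg _).trans (hD 0)
  refine ⟨fun n => D * |K| * (6 / t₀ ^ 3) * (mu n)⁻¹, hs.mul_left _, fun n t y ht hy => ?_⟩
  have hm := hmu n
  have h1 := Real.pow_div_factorial_le_exp (mu n * t₀) (by positivity) 3
  have h2 : Real.exp (-mu n * t) ≤ Real.exp (-(mu n * t₀)) := by
    apply Real.exp_le_exp.2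
    nlinarith
  have h3 : mu n ^ 2 * Real.exp (-(mu n * t₀)) ≤ 6 / t₀ ^ 3 * (mu n)⁻¹ := by
    rw [Real.exp_neg, ← div_eq_mul_inv, ← div_eq_mul_inv, div_le_div_iff₀ (Real.exp_pos _) hm,
      div_mul_eq_mul_div, le_div_iff₀ (by positivity)]
    have h4 : (mu n * t₀) ^ 3 ≤ 6 * Real.exp (mu n * t₀) := by
      rw [div_le_iff₀ (by positivity)] at h1
      norm_num [Nat.factorial] at h1
      linarith
    nlinarith
  rw [abs_mul, abs_mul, Real.abs_exp]
  have hy' : |y| ≤ |K| * mu n ^ 2 := hy.trans (by gcongr; exact le_abs_self K)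
  calc Real.exp (-mu n * t) * |c n| * |y|
      ≤ Real.exp (-(mu n * t₀)) * D * (|K| * mu n ^ 2) := by gcongr; exact hD n
    _ = D * |K| * (mu n ^ 2 * Real.exp (-(mu n * t₀))) := by ring
    _ ≤ D * |K| * (6 / t₀ ^ 3 * (mu n)⁻¹) := by gcongr
    _ = _ := by ring

lemma continuousOn_positive_time (hE : IsNeumannEigensystem V mu e)
    (hV : ContinuousOn V (Icc 0 1)) (hVpos : ∀ x ∈ Icc (0 : ℝ) 1, 0 < V x)
    (hc : Summable fun n => mu n * c n ^ 2) {K : ℝ} {g : ℕ → ℝ → ℝ}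
    (hg : ∀ n, ContinuousOn (g n) (Icc 0 1))
    (hK : ∀ n, ∀ x ∈ Icc (0 : ℝ) 1, |g n x| ≤ K * mu n ^ 2) :
    ContinuousOn (fun p : ℝ × ℝ => ∑' n, Real.exp (-mu n * p.1) * c n * g n p.2)
      (Ioi 0 ×ˢ Icc 0 1) := by
  intro p hp
  have hp1 : 0 < p.1 := hp.1
  obtain ⟨u, hu, hub⟩ := exists_majorant hE hV hVpos hc (K := K) (half_pos hp1)
  have hon : ContinuousOn (fun p : ℝ × ℝ => ∑' n, Real.exp (-mu n * p.1) * c n * g n p.2)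
      (Ioi (p.1 / 2) ×ˢ Icc 0 1) := by
    refine continuousOn_tsum (fun n => ?_) hu fun n q hq => ?_
    · exact (by fun_prop : Continuous fun p : ℝ × ℝ =>
        Real.exp (-mu n * p.1) * c n).continuousOn.mul
        ((hg n).comp continuousOn_snd fun p hp => hp.2)
    · exact hub n q.1 _ (le_of_lt hq.1) (hK n q.2 hq.2)
  refine (hon p ⟨half_lt_self hp1, hp.2⟩).mono_of_mem_nhdsWithin ?_
  rw [mem_nhdsWithin]
  exact ⟨Ioi (p.1 / 2) ×ˢ univ, isOpen_Ioi.prod isOpen_univ, ⟨half_lt_self hp1, mem_univ _⟩,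
    fun q hq => ⟨hq.1.1, hq.2.2⟩⟩

/-- The heat series solves the linear heat equation. -/
theorem heatSeries_solution (hE : IsNeumannEigensystem V mu e)
    (hV : ContinuousOn V (Icc 0 1)) (hVpos : ∀ x ∈ Icc (0 : ℝ) 1, 0 < V x)
    (hc : Summable fun n => mu n * c n ^ 2) :
    ∃ ut ux uxx : ℝ → ℝ → ℝ,
      ContinuousOn (fun p : ℝ × ℝ => ut p.1 p.2) (Ioi 0 ×ˢ Icc 0 1) ∧
      ContinuousOn (fun p : ℝ × ℝ => ux p.1 p.2) (Ioi 0 ×ˢ Icc 0 1) ∧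
      ContinuousOn (fun p : ℝ × ℝ => uxx p.1 p.2) (Ioi 0 ×ˢ Icc 0 1) ∧
      ∀ t : ℝ, 0 < t → NeumannC2 (heatSeries mu e c t) (ux t) (uxx t) ∧
        ∀ x ∈ Icc (0 : ℝ) 1, HasDerivAt (fun s => heatSeries mu e c s x) (ut t x) t ∧
          ut t x = uxx t x - V x * heatSeries mu e c t x := by
  obtain ⟨C, hC, hmu, hmu1, heb, -, -⟩ := hE.exists_bounds hV hVpos
  obtain ⟨e', he'⟩ := hE.family.exists_derivs hV
  obtain ⟨M, hM⟩ := isCompact_Icc.exists_bound_of_continuousOn hV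
  have hM0 : 0 ≤ M := (norm_nonneg _).trans (hM 0 (by simp))
  have b0 : ∀ n, ∀ x ∈ Icc (0 : ℝ) 1, |e n x| ≤ C * C * mu n ^ 2 := fun n x hx =>
    (heb n x hx).trans (by nlinarith [hmu1 n, hmu n, mul_pos hC (hmu n)])
  have bt : ∀ n, ∀ x ∈ Icc (0 : ℝ) 1, |-mu n * e n x| ≤ C * mu n ^ 2 := fun n x hx => by
    rw [abs_mul, abs_neg, abs_of_pos (hmu n)]
    nlinarith [heb n x hx, hmu n]
  have b2 : ∀ n, ∀ x ∈ Icc (0 : ℝ) 1, |(V x - mu n) * e n x| ≤ (M * C + 1) * C * mu n ^ 2 := by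
    intro n x hx
    have h1 : |V x - mu n| ≤ M * (C * mu n) + mu n := by
      refine (abs_sub _ _).trans ?_
      rw [abs_of_pos (hmu n)]
      have := hM x hx
      rw [Real.norm_eq_abs] at this
      nlinarith [hmu1 n]
    rw [abs_mul]
    have := hmu n
    calc |V x - mu n| * |e n x| ≤ (M * (C * mu n) + mu n) * (C * mu n) := by
          gcongr
          exact heb n x hx
      _ = _ := by ring
  -- The Neumann condition at 0 lets the bound on the second derivative integrate to the same bound
  -- on the first.
  have b1 : ∀ n, ∀ x ∈ Icc (0 : ℝ) 1, |e' n x| ≤ (M * C + 1) * C * mu n ^ 2 := by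
    intro n x hx
    have h := (convex_Icc (0 : ℝ) 1).norm_image_sub_le_of_norm_hasDerivWithin_le
      (he' n).deriv_two (b2 n) (x := 0) (y := x) (by simp) hx
    rw [(he' n).left, sub_zero, sub_zero, Real.norm_eq_abs, Real.norm_eq_abs,
      abs_of_nonneg hx.1] at h
    refine h.trans (mul_le_of_le_one_right ?_ hx.2)
    have := hmu n
    positivity
  have hce : ∀ n, ContinuousOn (e n) (Icc 0 1) := fun n => (hE.eigen n).continuousOn
  refine ⟨fun t x => ∑' n, Real.exp (-mu n * t) * c n * (-mu n * e n x),
    fun t x => ∑' n, Real.exp (-mu n * t) * c n * e' n x,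
    fun t x => ∑' n, Real.exp (-mu n * t) * c n * ((V x - mu n) * e n x),
    continuousOn_positive_time hE hV hVpos hc (fun n => continuousOn_const.mul (hce n)) bt,
    continuousOn_positive_time hE hV hVpos hc (fun n => (he' n).continuousOn_one) b1,
    continuousOn_positive_time hE hV hVpos hc (fun n => (he' n).continuousOn_two) b2,
    fun t ht => ?_⟩
  have h00 : (0 : ℝ) ∈ Icc (0 : ℝ) 1 := by simp
  have hslice : ∀ {K : ℝ} {g : ℕ → ℝ → ℝ}, (∀ n, ContinuousOn (g n) (Icc 0 1)) →
      (∀ n, ∀ x ∈ Icc (0 : ℝ) 1, |g n x| ≤ K * mu n ^ 2) →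
      ContinuousOn (fun x => ∑' n, Real.exp (-mu n * t) * c n * g n x) (Icc 0 1) :=
    fun hg hK => (continuousOn_positive_time hE hV hVpos hc hg hK).comp
      (by fun_prop : Continuous fun x : ℝ => (t, x)).continuousOn fun _ hx => ⟨ht, hx⟩
  have hsm : ∀ {K : ℝ} {g : ℕ → ℝ → ℝ}, (∀ n, ∀ x ∈ Icc (0 : ℝ) 1, |g n x| ≤ K * mu n ^ 2) →
      ∀ x ∈ Icc (0 : ℝ) 1, Summable fun n => Real.exp (-mu n * t) * c n * g n x := by
    intro K g hK x hx
    obtain ⟨u, hu, hub⟩ := exists_majorant hE hV hVpos hc (K := K) ht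
    exact Summable.of_norm_bounded hu fun n => hub n t _ le_rfl (hK n x hx)
  have hdx : ∀ {K : ℝ} {g g' : ℕ → ℝ → ℝ} (L : ℝ),
      (∀ n, ∀ x ∈ Icc (0 : ℝ) 1, HasDerivWithinAt (g n) (g' n x) (Icc 0 1) x) →
      (∀ n, ContinuousOn (g' n) (Icc 0 1)) →
      (∀ n, ∀ x ∈ Icc (0 : ℝ) 1, |g n x| ≤ L * mu n ^ 2) →
      (∀ n, ∀ x ∈ Icc (0 : ℝ) 1, |g' n x| ≤ K * mu n ^ 2) → ∀ x ∈ Icc (0 : ℝ) 1,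
      HasDerivWithinAt (fun x => ∑' n, Real.exp (-mu n * t) * c n * g n x)
        (∑' n, Real.exp (-mu n * t) * c n * g' n x) (Icc 0 1) x := by
    intro K g g' L h1 h2 h3 h4 x hx
    obtain ⟨u, hu, hub⟩ := exists_majorant hE hV hVpos hc (K := K) ht
    exact hasDerivWithinAt_tsum_unit hu (fun n y hy => (h1 n y hy).const_mul _)
      (fun n => continuousOn_const.mul (h2 n)) (fun n y hy => hub n t _ le_rfl (h4 n y hy))
      (hsm h3 0 h00) hx
  refine ⟨⟨hdx _ (fun n => (he' n).deriv_one) (fun n => (he' n).continuousOn_one) b0 b1,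
    hdx _ (fun n => (he' n).deriv_two) (fun n => (he' n).continuousOn_two) b1 b2,
    hslice (fun n => (he' n).continuousOn_two) b2, by simp [(he' _).left],
    by simp [(he' _).right]⟩, fun x hx => ⟨?_, ?_⟩⟩
  · obtain ⟨u, hu, hub⟩ := exists_majorant hE hV hVpos hc (K := C) (half_pos ht)
    refine hasDerivAt_tsum_of_isPreconnected hu (isOpen_Ioi (a := t / 2)) isPreconnected_Ioi
      (g := fun n s => Real.exp (-mu n * s) * c n * e n x)
      (g' := fun n s => Real.exp (-mu n * s) * c n * (-mu n * e n x)) (fun n s _ => ?_)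
      (fun n s hs => hub n s _ (le_of_lt hs) (bt n x hx)) (y₀ := t) (half_lt_self ht)
      (hsm b0 x hx) (half_lt_self ht)
    have h1 : HasDerivAt (fun s => Real.exp (-mu n * s)) (Real.exp (-mu n * s) * (-mu n)) s := by
      simpa using ((hasDerivAt_id s).const_mul (-mu n)).exp
    refine ((h1.mul_const (c n)).mul_const (e n x)).congr_deriv ?_
    ring
  · simp only [heatSeries]
    rw [← tsum_mul_left, ← (hsm b2 x hx).tsum_sub ((hsm b0 x hx).mul_left _)]
    exact tsum_congr fun n => by ring

end Heat


/-! ### The minimum principle and positivity -/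

lemma deriv_nonpos_of_left_min {f : ℝ → ℝ} {d t : ℝ} (ht : 0 < t) (hf : HasDerivAt f d t)
    (hmin : ∀ s ∈ Icc 0 t, f t ≤ f s) : d ≤ 0 := by
  have h1 := hasDerivWithinAt_iff_tendsto_slope' (s := Iio t) (by simp) |>.1
    hf.hasDerivWithinAt
  refine le_of_tendsto h1 ?_
  filter_upwards [Ioo_mem_nhdsLT ht] with s hs
  rw [slope_def_field]
  exact div_nonpos_of_nonneg_of_nonpos (by linarith [hmin s ⟨hs.1.le, hs.2.le⟩])
    (by linarith [hs.2])

/-- The minimum principle for supersolutions of the linear heat equation with Neumann boundary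
conditions. -/
lemma minimum_principle {V : ℝ → ℝ} (hVpos : ∀ x ∈ Icc (0 : ℝ) 1, 0 < V x)
    {s st sx sxx : ℝ → ℝ → ℝ}
    (hc : ContinuousOn (fun p : ℝ × ℝ => s p.1 p.2) (Ici 0 ×ˢ Icc 0 1))
    (h0 : ∀ x ∈ Icc (0 : ℝ) 1, 0 ≤ s 0 x)
    (h1 : ∀ t : ℝ, 0 < t → NeumannC2 (s t) (sx t) (sxx t))
    (h2 : ∀ t : ℝ, 0 < t → ∀ x ∈ Icc (0 : ℝ) 1, HasDerivAt (fun τ => s τ x) (st t x) t)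
    (h3 : ∀ t : ℝ, 0 < t → ∀ x ∈ Icc (0 : ℝ) 1, sxx t x - V x * s t x ≤ st t x) :
    ∀ t : ℝ, 0 ≤ t → ∀ x ∈ Icc (0 : ℝ) 1, 0 ≤ s t x := by
  intro T hT x hx
  by_contra! hneg
  have hsub : Icc 0 T ×ˢ Icc (0 : ℝ) 1 ⊆ Ici 0 ×ˢ Icc 0 1 :=
    prod_mono Icc_subset_Ici_self subset_rfl
  obtain ⟨p, hp, hmin⟩ := (isCompact_Icc.prod isCompact_Icc).exists_isMinOn
    ⟨(T, x), ⟨⟨hT, le_rfl⟩, hx⟩⟩ (hc.mono hsub)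
  have hmin' : ∀ t ∈ Icc 0 T, ∀ y ∈ Icc (0 : ℝ) 1, s p.1 p.2 ≤ s t y :=
    fun t ht y hy => hmin (show (t, y) ∈ Icc 0 T ×ˢ Icc (0 : ℝ) 1 from ⟨ht, hy⟩)
  -- At a negative minimum `st ≤ 0`, `sxx ≥ 0` and `-V s > 0`, contradicting the inequality. Strict
  -- positivity of `V` makes a perturbation of `s` unnecessary, and at the end points `sx = 0` holds
  -- by the Neumann condition.
  have hlt : s p.1 p.2 < 0 := (hmin' T ⟨hT, le_rfl⟩ x hx).trans_lt hneg
  have hp0 : 0 < p.1 := by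
    refine lt_of_le_of_ne hp.1.1 fun h => ?_
    rw [← h] at hlt
    exact absurd (h0 p.2 hp.2) (not_le.2 hlt)
  have e1 : st p.1 p.2 ≤ 0 := deriv_nonpos_of_left_min hp0 (h2 p.1 hp0 p.2 hp.2)
    fun t ht => hmin' t ⟨ht.1, ht.2.trans hp.1.2⟩ p.2 hp.2
  have hN := h1 p.1 hp0
  have hmx : ∀ y ∈ Icc (0 : ℝ) 1, s p.1 p.2 ≤ s p.1 y := hmin' p.1 hp.1
  have e2 : 0 ≤ sxx p.1 p.2 := by
    refine second_deriv_nonneg_of_min hN.deriv_one hp.2 (hN.deriv_two p.2 hp.2) ?_ hmx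
    rcases eq_or_lt_of_le hp.2.1 with h | h
    · rw [← h]; exact hN.left
    rcases eq_or_lt_of_le hp.2.2 with h' | h'
    · rw [h']; exact hN.right
    have hn := Icc_mem_nhds h h'
    refine IsLocalMin.hasDerivAt_eq_zero ?_ ((hN.deriv_one p.2 hp.2).hasDerivAt hn)
    filter_upwards [hn] with y hy using hmx y hy
  have e3 := h3 p.1 hp0 p.2 hp.2
  nlinarith [hVpos p.2 hp.2]

section Positivity

variable {V : ℝ → ℝ} {mu : ℕ → ℝ} {e : ℕ → ℝ → ℝ}

/-- With `ε = min f` and `M` an upper bound of `|V|`, the function `ε e^{-Mt}` is a subsolution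
below `f` at time 0, so the minimum principle applies to the difference and gives strict positivity.
-/
lemma heatSeries_pos (hE : IsNeumannEigensystem V mu e)
    (hV : ContinuousOn V (Icc 0 1)) (hVpos : ∀ x ∈ Icc (0 : ℝ) 1, 0 < V x) {f : ℝ → ℝ}
    (hf : f ∈ PPlus) : ∀ t : ℝ, 0 ≤ t → ∀ x ∈ Icc (0 : ℝ) 1,
      0 < heatSeries mu e (fun n => coeff e n f) t x := by
  have hc := hE.summable_mul_sq_coeff hV hVpos hf
  obtain ⟨ut, ux, uxx, -, -, -, hu⟩ := heatSeries_solution hE hV hVpos hc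
  obtain ⟨M, hM⟩ := isCompact_Icc.exists_bound_of_continuousOn hV
  obtain ⟨x₀, hx₀, hmin⟩ := isCompact_Icc.exists_isMinOn (nonempty_Icc.2 zero_le_one) hf.1
  have hε := hf.2.1 x₀ hx₀
  set ε := f x₀
  set u := heatSeries mu e (fun n => coeff e n f) with hudef
  have key := minimum_principle hVpos (s := fun t x => u t x - ε * Real.exp (-M * t))
    (st := fun t x => ut t x - ε * (Real.exp (-M * t) * (-M))) (sx := ux) (sxx := uxx)
    ((continuousOn_heatSeries hE hV hVpos hc).sub (by fun_prop))
    (fun x hx => by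
      simp only [hudef, heatSeries_zero hE hV hVpos hf x hx, mul_zero, Real.exp_zero, mul_one]
      exact sub_nonneg.2 (hmin hx))
    (fun t ht => ⟨fun x hx => ((hu t ht).1.deriv_one x hx).sub_const _, (hu t ht).1.deriv_two,
      (hu t ht).1.continuousOn_two, (hu t ht).1.left, (hu t ht).1.right⟩)
    (fun t ht x hx => by
      refine ((hu t ht).2 x hx).1.sub (HasDerivAt.const_mul ε ?_)
      simpa using ((hasDerivAt_id t).const_mul (-M)).exp)
    (fun t ht x hx => by
      rw [((hu t ht).2 x hx).2]
      have h1 : V x ≤ M := (le_abs_self _).trans (hM x hx)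
      have h2 : 0 < ε * Real.exp (-M * t) := by positivity
      nlinarith [mul_nonneg (sub_nonneg.2 h1) h2.le])
  intro t ht x hx
  have h1 := key t ht x hx
  have h2 : 0 < ε * Real.exp (-M * t) := by positivity
  linarith

/-- Large time asymptotics of the heat flow. -/
lemma coeff_mul_eigenfunction_nonneg (hE : IsNeumannEigensystem V mu e)
    (hV : ContinuousOn V (Icc 0 1)) (hVpos : ∀ x ∈ Icc (0 : ℝ) 1, 0 < V x) {f : ℝ → ℝ}
    (hf : f ∈ PPlus) {x : ℝ} (hx : x ∈ Icc (0 : ℝ) 1) : 0 ≤ coeff e 0 f * e 0 x := by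
  have hc := hE.summable_mul_sq_coeff hV hVpos hf
  have hpos := heatSeries_pos hE hV hVpos hf
  have hmono := hE.strictMono hV
  obtain ⟨C, -, hsum⟩ := summable_mul_eigenfunction hE hV hVpos
  have hs := (hsum _ hc x hx).1
  -- The rescaled flow `e^{μ₀t} u` tends to `c₀ e₀` by dominated convergence, as `μₙ > μ₀` for `n ≥
  -- 1`. A limit of positive values is nonnegative.
  have hlim : Tendsto (fun t : ℝ => ∑' n, Real.exp (-(mu n - mu 0) * t) * (coeff e n f * e n x))
      atTop (𝓝 (∑' n, if n = 0 then coeff e 0 f * e 0 x else 0)) := by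
    refine tendsto_tsum_of_dominated_convergence hs (fun n => ?_) ?_
    · rcases Nat.eq_zero_or_pos n with rfl | hn
      · simp
      · rw [if_neg hn.ne', ← zero_mul (coeff e n f * e n x)]
        refine Tendsto.mul_const _ (Real.tendsto_exp_atBot.comp ?_)
        exact tendsto_id.const_mul_atTop_of_neg (by linarith [hmono hn])
    · filter_upwards [eventually_ge_atTop 0] with t ht n
      exact abs_exp_mul_le (sub_nonneg.2 (hE.monotone (Nat.zero_le n))) ht
  rw [tsum_ite_eq] at hlim
  refine ge_of_tendsto hlim ?_
  filter_upwards [eventually_ge_atTop 0] with t ht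
  have h1 : ∑' n, Real.exp (-(mu n - mu 0) * t) * (coeff e n f * e n x) =
      Real.exp (mu 0 * t) * heatSeries mu e (fun n => coeff e n f) t x := by
    rw [heatSeries, ← tsum_mul_left]
    refine tsum_congr fun n => ?_
    rw [← mul_assoc, ← mul_assoc, ← mul_assoc, ← Real.exp_add]
    ring_nf
  rw [h1]
  exact mul_nonneg (Real.exp_pos _).le (hpos t ht x hx).le

lemma one_mem_PPlus : (fun _ : ℝ => (1 : ℝ)) ∈ PPlus :=
  mem_PPlus_of_deriv (f' := fun _ => 0) (fun _ _ => hasDerivWithinAt_const _ _ _)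
    continuousOn_const fun _ _ => one_pos

/-- The constant 1 works unless `e 0` has mean zero; then a perturbation of 1 by a multiple of `e
0`, small enough to stay positive, does. -/
lemma exists_coeff_ne_zero (hE : IsNeumannEigensystem V mu e)
    (hV : ContinuousOn V (Icc 0 1)) : ∃ f ∈ PPlus, coeff e 0 f ≠ 0 := by
  by_cases h0 : ∫ x in (0 : ℝ)..1, e 0 x = 0
  · obtain ⟨e', he'⟩ := hE.family.exists_derivs hV
    obtain ⟨K, hK⟩ := isCompact_Icc.exists_bound_of_continuousOn (he' 0).continuousOn
    have hK0 : 0 ≤ K := (norm_nonneg _).trans (hK 0 (by simp))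
    refine ⟨fun x => 1 + (K + 1)⁻¹ * e 0 x, mem_PPlus_of_deriv
      (fun x hx => ((he' 0).deriv_one x hx).const_mul _ |>.const_add _)
      (continuousOn_const.mul (he' 0).continuousOn_one) fun x hx => ?_, ?_⟩
    · have h1 := neg_le_of_abs_le (hK x hx)
      have h2 : (K + 1)⁻¹ * (K + 1) = 1 := inv_mul_cancel₀ (by positivity)
      have h3 : 0 < (K + 1)⁻¹ := by positivity
      nlinarith
    · have hc := (he' 0).continuousOn
      have h1 : coeff e 0 (fun x => 1 + (K + 1)⁻¹ * e 0 x) = (K + 1)⁻¹ := by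
        have : ∫ x in (0 : ℝ)..1, e 0 x * (1 + (K + 1)⁻¹ * e 0 x) =
            (∫ x in (0 : ℝ)..1, e 0 x) + (K + 1)⁻¹ * ∫ x in (0 : ℝ)..1, e 0 x * e 0 x := by
          rw [← intervalIntegral.integral_const_mul, ← intervalIntegral.integral_add
            (intervalIntegrable_unit hc) ((intervalIntegrable_unit (hc.fun_mul hc)).const_mul _)]
          exact integral_unit_congr fun x _ => by ring
        rw [coeff, this, h0, hE.orthonormal]
        simp
      rw [h1]
      positivity
  · exact ⟨_, one_mem_PPlus, by simpa [coeff] using h0⟩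

/-- The first eigenfunction has a constant sign. -/
lemma exists_mul_first_eigenfunction_pos (hE : IsNeumannEigensystem V mu e)
    (hV : ContinuousOn V (Icc 0 1)) (hVpos : ∀ x ∈ Icc (0 : ℝ) 1, 0 < V x) :
    ∃ a : ℝ, ∀ x ∈ Icc (0 : ℝ) 1, 0 < a * e 0 x := by
  obtain ⟨f, hf, ha⟩ := exists_coeff_ne_zero hE hV
  have hnn : ∀ x ∈ Icc (0 : ℝ) 1, 0 ≤ coeff e 0 f * e 0 x :=
    fun x hx => coeff_mul_eigenfunction_nonneg hE hV hVpos hf hx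
  set a := coeff e 0 f
  obtain ⟨e', he'⟩ := hE.family.exists_derivs hV
  refine ⟨a, fun x hx => lt_of_le_of_ne (hnn x hx) fun h => ?_⟩
  have hx0 : e 0 x = 0 := by
    rcases mul_eq_zero.1 h.symm with h' | h'
    · exact absurd h' ha
    · exact h'
  -- A zero is a minimum of the nonnegative function `a e₀`, so the derivative vanishes there too,
  -- at the end points by the Neumann condition. Vanishing Cauchy data would give `e₀ = 0`.
  have hd : e' 0 x = 0 := by
    rcases eq_or_lt_of_le hx.1 with h1 | h1
    · rw [← h1]; exact (he' 0).left
    rcases eq_or_lt_of_le hx.2 with h2 | h2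
    · rw [h2]; exact (he' 0).right
    have hn := Icc_mem_nhds h1 h2
    have hmin : IsLocalMin (fun y => a * e 0 y) x := by
      filter_upwards [hn] with y hy
      rw [← h]
      exact hnn y hy
    have := hmin.hasDerivAt_eq_zero ((((he' 0).deriv_one x hx).hasDerivAt hn).const_mul a)
    exact (mul_eq_zero.1 this).resolve_left ha
  have hz := IsNeumannEigenfunction.eq_zero_of_cauchy_data hV (he' 0) (fun _ _ => rfl) hx hx0 hd
  have h1 := hE.orthonormal 0 0
  rw [integral_unit_congr (g := fun _ => 0) (fun x hx => by rw [hz x hx, mul_zero])] at h1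
  simp at h1

/-- Both factors become positive after multiplication by `a`, and `a²` drops out. Hence the sign
chosen for `e 0` is immaterial. -/
lemma coeff_mul_integral_pos (hE : IsNeumannEigensystem V mu e)
    (hV : ContinuousOn V (Icc 0 1)) (hVpos : ∀ x ∈ Icc (0 : ℝ) 1, 0 < V x) {f : ℝ → ℝ}
    (hf : f ∈ PPlus) : 0 < coeff e 0 f * ∫ x in (0 : ℝ)..1, e 0 x := by
  obtain ⟨a, ha⟩ := exists_mul_first_eigenfunction_pos hE hV hVpos
  have hc := (hE.eigen 0).continuousOn
  have hpos : ∀ g ∈ PPlus, 0 < a * coeff e 0 g := by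
    intro g hg
    have h1 : a * coeff e 0 g = ∫ x in (0 : ℝ)..1, a * e 0 x * g x := by
      rw [coeff, ← intervalIntegral.integral_const_mul]
      exact integral_unit_congr fun x _ => by ring
    rw [h1]
    exact intervalIntegral.intervalIntegral_pos_of_pos_on
      (intervalIntegrable_unit ((continuousOn_const.mul hc).mul hg.1))
      (fun x hx => mul_pos (ha x (Ioo_subset_Icc_self hx)) (hg.2.1 x (Ioo_subset_Icc_self hx)))
      zero_lt_one
  have h1 := hpos f hf
  have h2 := hpos _ one_mem_PPlus
  have h3 : coeff e 0 (fun _ => 1) = ∫ x in (0 : ℝ)..1, e 0 x := by simp [coeff]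
  rw [h3] at h2
  have h4 := mul_pos h1 h2
  have h5 : a * coeff e 0 f * (a * ∫ x in (0 : ℝ)..1, e 0 x) =
      a ^ 2 * (coeff e 0 f * ∫ x in (0 : ℝ)..1, e 0 x) := by ring
  rw [h5] at h4
  exact pos_of_mul_pos_right h4 (sq_nonneg a)

end Positivity


/-! ### Parameter integrals -/

lemma continuousOn_integral_unit {F : ℝ → ℝ → ℝ}
    (hF : ContinuousOn (fun p : ℝ × ℝ => F p.1 p.2) (Ici 0 ×ˢ Icc 0 1)) :
    ContinuousOn (fun t => ∫ x in (0 : ℝ)..1, F t x) (Ici 0) := by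
  have hc : Continuous (Function.uncurry fun t x : ℝ =>
      F (max t 0) (projIcc 0 1 zero_le_one x)) := by
    refine hF.comp_continuous (f := fun p : ℝ × ℝ =>
      (max p.1 0, (projIcc (0 : ℝ) 1 zero_le_one p.2 : ℝ))) ?_
      fun p => ⟨mem_Ici.2 (le_max_right _ _), (projIcc (0 : ℝ) 1 zero_le_one p.2).2⟩
    exact (continuous_fst.max continuous_const).prodMk
      (continuous_subtype_val.comp (continuous_projIcc.comp continuous_snd))
  have h := (intervalIntegral.continuous_parametric_intervalIntegral_of_continuous'
    (μ := volume) hc 0 1).continuousOn (s := Ici 0)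
  refine h.congr fun t ht => integral_unit_congr fun x hx => ?_
  rw [max_eq_left ht, projIcc_of_mem _ hx]

lemma continuousOn_slice {F : ℝ → ℝ → ℝ} {S : Set ℝ}
    (hF : ContinuousOn (fun p : ℝ × ℝ => F p.1 p.2) (S ×ˢ Icc 0 1)) {t : ℝ} (ht : t ∈ S) :
    ContinuousOn (F t) (Icc 0 1) :=
  hF.comp (by fun_prop : Continuous fun x : ℝ => (t, x)).continuousOn fun _ hx => ⟨ht, hx⟩

lemma hasDerivAt_integral_mul {w wt : ℝ → ℝ → ℝ} {φ : ℝ → ℝ} (hφ : ContinuousOn φ (Icc 0 1))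
    (hw : ContinuousOn (fun p : ℝ × ℝ => w p.1 p.2) (Ici 0 ×ˢ Icc 0 1))
    (hwt : ContinuousOn (fun p : ℝ × ℝ => wt p.1 p.2) (Ioi 0 ×ˢ Icc 0 1))
    (hd : ∀ t : ℝ, 0 < t → ∀ x ∈ Icc (0 : ℝ) 1, HasDerivAt (fun s => w s x) (wt t x) t)
    {t : ℝ} (ht : 0 < t) :
    HasDerivAt (fun s => ∫ x in (0 : ℝ)..1, φ x * w s x) (∫ x in (0 : ℝ)..1, φ x * wt t x) t := by
  have hsub : Icc (t / 2) (2 * t) ×ˢ Icc (0 : ℝ) 1 ⊆ Ioi 0 ×ˢ Icc 0 1 :=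
    prod_mono (fun s hs => lt_of_lt_of_le (half_pos ht) hs.1) subset_rfl
  obtain ⟨K, hK⟩ := (isCompact_Icc.prod isCompact_Icc).exists_bound_of_continuousOn
    (((hφ.comp continuousOn_snd fun p hp => hp.2).mul hwt).mono hsub)
  have hpos : ∀ s ∈ Icc (t / 2) (2 * t), 0 < s := fun s hs => lt_of_lt_of_le (half_pos ht) hs.1
  have hI : ∀ x, x ∈ uIoc (0 : ℝ) 1 → x ∈ Icc (0 : ℝ) 1 := fun x hx => by
    rw [uIoc_of_le zero_le_one] at hx
    exact Ioc_subset_Icc_self hx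
  have hmeas : ∀ {f : ℝ → ℝ}, ContinuousOn f (Icc 0 1) →
      AEStronglyMeasurable f (volume.restrict (uIoc 0 1)) := fun hf => by
    rw [uIoc_of_le zero_le_one]
    exact (hf.mono Ioc_subset_Icc_self).aestronglyMeasurable measurableSet_Ioc
  have hnhds : Icc (t / 2) (2 * t) ∈ 𝓝 t := Icc_mem_nhds (half_lt_self ht) (by linarith)
  refine (intervalIntegral.hasDerivAt_integral_of_dominated_loc_of_deriv_le
    (F := fun s x => φ x * w s x) (F' := fun s x => φ x * wt s x)
    (s := Icc (t / 2) (2 * t)) (bound := fun _ => K) hnhds ?_ ?_ ?_ ?_ (by simp) ?_).2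
  · filter_upwards [hnhds] with s hs
    exact hmeas (hφ.mul (continuousOn_slice hw (hpos s hs).le))
  · exact intervalIntegrable_unit (hφ.mul (continuousOn_slice hw ht.le))
  · exact hmeas (hφ.mul (continuousOn_slice hwt ht))
  · exact Eventually.of_forall fun x hx s hs => hK (s, x) ⟨hs, hI x hx⟩
  · exact Eventually.of_forall fun x hx s hs => (hd s (hpos s hs) x (hI x hx)).const_mul _

lemma eq_of_hasDerivAt_zero {f : ℝ → ℝ} (hf : ContinuousOn f (Ici 0))
    (hd : ∀ t : ℝ, 0 < t → HasDerivAt f 0 t) : ∀ t : ℝ, 0 ≤ t → f t = f 0 := by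
  intro t ht
  rcases eq_or_lt_of_le ht with rfl | ht
  · rfl
  obtain ⟨c, hc, h⟩ := exists_hasDerivAt_eq_slope f (fun _ => 0) ht
    (hf.mono Icc_subset_Ici_self) fun s hs => hd s hs.1
  rw [eq_comm, div_eq_zero_iff] at h
  rcases h with h | h <;> linarith

/-! ### The nonlinear equation -/

section Nonlinear

variable {V : ℝ → ℝ} {mu : ℕ → ℝ} {e : ℕ → ℝ → ℝ} {v₀ : ℝ → ℝ}

/-- Every solution is a multiple of the linear heat flow, and has integral one. -/
lemma IsSolution.exists_eq_mul {w : ℝ → ℝ → ℝ} (hw : IsSolution V v₀ w)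
    (hE : IsNeumannEigensystem V mu e) (hV : ContinuousOn V (Icc 0 1))
    (hVpos : ∀ x ∈ Icc (0 : ℝ) 1, 0 < V x) (hv₀ : v₀ ∈ POne) {t : ℝ} (ht : 0 ≤ t) :
    (∃ b : ℝ, ∀ x ∈ Icc (0 : ℝ) 1, w t x = b * heatSeries mu e (fun n => coeff e n v₀) t x) ∧
      ∫ x in (0 : ℝ)..1, w t x = 1 := by
  obtain ⟨hwc, hw0, wt, wx, wxx, hwt, hwx, hwxx, heq⟩ := hw
  have hwN : ∀ t : ℝ, 0 < t → NeumannC2 (w t) (wx t) (wxx t) := fun t ht =>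
    ⟨fun x hx => ((heq t ht).1 x hx).2.1, fun x hx => ((heq t ht).1 x hx).2.2.1,
      continuousOn_slice hwxx ht, (heq t ht).2.1, (heq t ht).2.2⟩
  have hd : ∀ t : ℝ, 0 < t → ∀ x ∈ Icc (0 : ℝ) 1, HasDerivAt (fun s => w s x) (wt t x) t :=
    fun t ht x hx => ((heq t ht).1 x hx).1
  set g : ℝ → ℝ := fun t => ∫ ξ in (0 : ℝ)..1, V ξ * w t ξ with hg
  have hpde : ∀ t : ℝ, 0 < t → ∀ x ∈ Icc (0 : ℝ) 1,
      wt t x = wxx t x - V x * w t x + g t * w t x :=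
    fun t ht x hx => ((heq t ht).1 x hx).2.2.2
  have hmulc : ∀ {φ : ℝ → ℝ}, ContinuousOn φ (Icc 0 1) →
      ContinuousOn (fun t => ∫ x in (0 : ℝ)..1, φ x * w t x) (Ici 0) := fun hφ =>
    continuousOn_integral_unit (F := fun t x => _ * w t x)
      ((hφ.comp continuousOn_snd fun p hp => hp.2).mul hwc)
  have hgc : ContinuousOn g (Ici 0) := hmulc hV
  have hgc' : Continuous fun s => g (max s 0) :=
    hgc.comp_continuous (continuous_id.max continuous_const) fun s => mem_Ici.2 (le_max_right _ _)
  -- `e^G` is the integrating factor of the nonlocal term. The argument `max s 0` extends `g`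
  -- continuously to the line.
  set G : ℝ → ℝ := fun t => ∫ s in (0 : ℝ)..t, g (max s 0) with hG
  have hGd : ∀ t : ℝ, 0 < t → HasDerivAt G (g t) t := fun t ht => by
    have := (hgc'.integral_hasStrictDerivAt 0 t).hasDerivAt
    rwa [max_eq_left ht.le] at this
  have hGc : Continuous G := intervalIntegral.continuous_primitive
    (fun a b => hgc'.intervalIntegrable a b) 0
  have hG0 : G 0 = 0 := by simp [hG]
  have hφt : ∀ {φ : ℝ → ℝ}, ContinuousOn φ (Icc 0 1) → ∀ t : ℝ, 0 < t →
      ∫ x in (0 : ℝ)..1, φ x * wt t x = (∫ x in (0 : ℝ)..1, φ x * wxx t x) -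
        (∫ x in (0 : ℝ)..1, φ x * (V x * w t x)) + g t * ∫ x in (0 : ℝ)..1, φ x * w t x := by
    intro φ hφ t ht
    have c1 := hφ.fun_mul (hwN t ht).continuousOn_two
    have c2 := hφ.fun_mul (hV.fun_mul (hwN t ht).continuousOn)
    have c3 := hφ.fun_mul (hwN t ht).continuousOn
    rw [← intervalIntegral.integral_const_mul, ← intervalIntegral.integral_sub
      (intervalIntegrable_unit c1) (intervalIntegrable_unit c2), ← intervalIntegral.integral_add
      ((intervalIntegrable_unit c1).sub (intervalIntegrable_unit c2))
      ((intervalIntegrable_unit c3).const_mul _)]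
    refine integral_unit_congr fun x hx => ?_
    rw [hpde t ht x hx]
    ring
  have h1c : ContinuousOn (fun _ : ℝ => (1 : ℝ)) (Icc 0 1) := continuousOn_const
  constructor
  · refine ⟨Real.exp (G t), eq_heatSeries_of_coeff hE hV hVpos
      (hE.summable_mul_sq_coeff hV hVpos hv₀.1) ht (continuousOn_slice hwc ht) fun n => ?_⟩
    obtain ⟨e', he'⟩ := (hE.eigen n).exists_neumannC2 hV
    have hcn := (hE.eigen n).continuousOn
    -- Each coefficient satisfies `cₙ' = (g - μₙ) cₙ`, so `e^{μₙt - G} cₙ` is constant; the factor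
    -- `e^G` does not depend on `n`.
    have hF := eq_of_hasDerivAt_zero
      (f := fun t => Real.exp (mu n * t - G t) * ∫ x in (0 : ℝ)..1, e n x * w t x)
      ((by fun_prop : Continuous fun t => Real.exp (mu n * t - G t)).continuousOn.mul (hmulc hcn))
      (fun t ht => by
        have d1 := (((hasDerivAt_id t).const_mul (mu n)).sub (hGd t ht)).exp
        have d2 := hasDerivAt_integral_mul hcn hwc hwt hd ht
        refine (d1.mul d2).congr_deriv ?_
        have e1 := (hwN t ht).integral_symm he'
        have e2 : ∫ x in (0 : ℝ)..1, w t x * ((V x - mu n) * e n x) =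
            (∫ x in (0 : ℝ)..1, e n x * (V x * w t x)) -
              mu n * ∫ x in (0 : ℝ)..1, e n x * w t x := by
          have c2 := hcn.fun_mul (hV.fun_mul (hwN t ht).continuousOn)
          have c3 := hcn.fun_mul (hwN t ht).continuousOn
          rw [← intervalIntegral.integral_const_mul, ← intervalIntegral.integral_sub
            (intervalIntegrable_unit c2) ((intervalIntegrable_unit c3).const_mul _)]
          exact integral_unit_congr fun x _ => by ring
        rw [hφt hcn t ht, e1, e2]
        simp only [id, mul_one, Pi.sub_apply]
        ring) t ht
    have e0 : ∫ x in (0 : ℝ)..1, e n x * w 0 x = coeff e n v₀ :=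
      integral_unit_congr fun x hx => by rw [hw0 x hx]
    rw [mul_zero, hG0, sub_zero, Real.exp_zero, one_mul, e0] at hF
    rw [← hF, coeff, ← mul_assoc, ← mul_assoc, ← Real.exp_add, ← Real.exp_add]
    ring_nf
    simp
  -- The mass satisfies `m' = g (m - 1)`, since `∫ wxx = 0` and `∫ V w = g`. So `e^{-G}(m - 1)`
  -- keeps its initial value 0.
  · have hF := eq_of_hasDerivAt_zero
      (f := fun t => Real.exp (-G t) * ((∫ x in (0 : ℝ)..1, 1 * w t x) - 1))
      ((by fun_prop : Continuous fun t => Real.exp (-G t)).continuousOn.mul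
        ((hmulc h1c).sub continuousOn_const))
      (fun t ht => by
        have d1 := (hGd t ht).neg.exp
        have d2 := (hasDerivAt_integral_mul h1c hwc hwt hd ht).sub_const 1
        refine (d1.mul d2).congr_deriv ?_
        have e1 := (hwN t ht).integral_second
        rw [hφt h1c t ht]
        simp only [one_mul, e1]
        change _ + Real.exp (-G t) * (0 - g t + _) = 0
        simp only [Pi.neg_apply]
        ring) t ht
    have e0 : ∫ x in (0 : ℝ)..1, w 0 x = 1 := (integral_unit_congr hw0).trans hv₀.2
    simp only [one_mul, e0, sub_self, mul_zero, mul_eq_zero, Real.exp_ne_zero, false_or] at hF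
    linarith

lemma integral_heatSeries_pos (hE : IsNeumannEigensystem V mu e)
    (hV : ContinuousOn V (Icc 0 1)) (hVpos : ∀ x ∈ Icc (0 : ℝ) 1, 0 < V x) {f : ℝ → ℝ}
    (hf : f ∈ PPlus) {t : ℝ} (ht : 0 ≤ t) :
    0 < ∫ x in (0 : ℝ)..1, heatSeries mu e (fun n => coeff e n f) t x :=
  intervalIntegral.intervalIntegral_pos_of_pos_on (intervalIntegrable_unit
    (continuousOn_heatSeries_right hE hV hVpos (hE.summable_mul_sq_coeff hV hVpos hf) ht))
    (fun x hx => heatSeries_pos hE hV hVpos hf t ht x (Ioo_subset_Icc_self hx)) zero_lt_one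

/-- The normalized heat flow. -/
noncomputable def normalizedHeat (mu : ℕ → ℝ) (e : ℕ → ℝ → ℝ) (v₀ : ℝ → ℝ) (t x : ℝ) : ℝ :=
  heatSeries mu e (fun n => coeff e n v₀) t x /
    ∫ ξ in (0 : ℝ)..1, heatSeries mu e (fun n => coeff e n v₀) t ξ

/-- Unit mass determines the unknown factor. As `w` does not involve the eigensystem, normalized
flows built from different eigensystems coincide. -/
lemma IsSolution.eq_normalizedHeat {w : ℝ → ℝ → ℝ} (hw : IsSolution V v₀ w)
    (hE : IsNeumannEigensystem V mu e) (hV : ContinuousOn V (Icc 0 1))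
    (hVpos : ∀ x ∈ Icc (0 : ℝ) 1, 0 < V x) (hv₀ : v₀ ∈ POne) {t : ℝ} (ht : 0 ≤ t) :
    ∀ x ∈ Icc (0 : ℝ) 1, w t x = normalizedHeat mu e v₀ t x := by
  obtain ⟨⟨b, hb⟩, h1⟩ := hw.exists_eq_mul hE hV hVpos hv₀ ht
  have hI := integral_heatSeries_pos hE hV hVpos hv₀.1 ht
  rw [integral_unit_congr hb, intervalIntegral.integral_const_mul] at h1
  intro x hx
  rw [hb x hx, normalizedHeat, eq_div_iff hI.ne', mul_assoc, mul_comm (heatSeries _ _ _ _ _),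
    ← mul_assoc, h1, one_mul]

/-- With `I = ∫u` and `J = ∫Vu` one has `I' = -J`, so the quotient rule creates exactly the nonlocal
term `(J/I)(u/I)`. -/
lemma isSolution_normalizedHeat (hE : IsNeumannEigensystem V mu e)
    (hV : ContinuousOn V (Icc 0 1)) (hVpos : ∀ x ∈ Icc (0 : ℝ) 1, 0 < V x) (hv₀ : v₀ ∈ POne) :
    IsSolution V v₀ (normalizedHeat mu e v₀) ∧
      ∀ t : ℝ, 0 ≤ t → normalizedHeat mu e v₀ t ∈ POne := by
  have hc := hE.summable_mul_sq_coeff hV hVpos hv₀.1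
  obtain ⟨ut, ux, uxx, hut, hux, huxx, hu⟩ := heatSeries_solution hE hV hVpos hc
  have huc := continuousOn_heatSeries hE hV hVpos hc
  have hpos := heatSeries_pos hE hV hVpos hv₀.1
  have hIpos := fun t (ht : (0 : ℝ) ≤ t) => integral_heatSeries_pos hE hV hVpos hv₀.1 ht
  have hu0 := heatSeries_zero hE hV hVpos hv₀.1
  have hvdef : ∀ t x, normalizedHeat mu e v₀ t x = heatSeries mu e (fun n => coeff e n v₀) t x /
    ∫ ξ in (0 : ℝ)..1, heatSeries mu e (fun n => coeff e n v₀) t ξ := fun _ _ => rfl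
  set u := heatSeries mu e (fun n => coeff e n v₀) with hudef
  set I : ℝ → ℝ := fun t => ∫ x in (0 : ℝ)..1, u t x with hI
  set J : ℝ → ℝ := fun t => ∫ x in (0 : ℝ)..1, V x * u t x with hJ
  have hIc : ContinuousOn I (Ici 0) := continuousOn_integral_unit huc
  have hJc : ContinuousOn J (Ici 0) := continuousOn_integral_unit (F := fun t x => V x * u t x)
    ((hV.comp continuousOn_snd fun p hp => hp.2).mul huc)
  have hI0 : I 0 = 1 := by
    rw [← hv₀.2]
    exact integral_unit_congr hu0
  have hinit : ∀ x ∈ Icc (0 : ℝ) 1, normalizedHeat mu e v₀ 0 x = v₀ x := fun x hx => by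
    rw [hvdef, hu0 x hx]
    change _ / I 0 = _
    rw [hI0, div_one]
  have hId : ∀ t : ℝ, 0 < t → HasDerivAt I (-J t) t := by
    intro t ht
    have h1 := hasDerivAt_integral_mul (φ := fun _ => 1) continuousOn_const huc hut
      (fun t ht x hx => ((hu t ht).2 x hx).1) ht
    simp only [one_mul] at h1
    refine h1.congr_deriv ?_
    have h2 : ContinuousOn (fun x => V x * u t x) (Icc 0 1) := hV.mul (hu t ht).1.continuousOn
    rw [integral_unit_congr fun x hx => ((hu t ht).2 x hx).2, intervalIntegral.integral_sub
      (intervalIntegrable_unit (hu t ht).1.continuousOn_two)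
      (intervalIntegrable_unit h2), (hu t ht).1.integral_second,
      zero_sub]
  have hfst : ∀ {f : ℝ → ℝ}, ContinuousOn f (Ici 0) →
      ContinuousOn (fun p : ℝ × ℝ => f p.1) (Ici 0 ×ˢ Icc 0 1) := fun hf =>
    hf.comp continuousOn_fst fun p hp => hp.1
  have hsub : Ioi (0 : ℝ) ×ˢ Icc (0 : ℝ) 1 ⊆ Ici 0 ×ˢ Icc 0 1 :=
    prod_mono Ioi_subset_Ici_self subset_rfl
  have hIne : ∀ p ∈ Ici (0 : ℝ) ×ˢ Icc (0 : ℝ) 1, I p.1 ≠ 0 := fun p hp => (hIpos p.1 hp.1).ne'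
  have hIne' : ∀ p ∈ Ioi (0 : ℝ) ×ˢ Icc (0 : ℝ) 1, I p.1 ≠ 0 := fun p hp => hIne p (hsub hp)
  have hI' := (hfst hIc).mono hsub
  have hJ' := (hfst hJc).mono hsub
  have hu' := huc.mono hsub
  refine ⟨⟨huc.div (hfst hIc) hIne, hinit,
    fun t x => (ut t x * I t - u t x * -J t) / I t ^ 2, fun t x => ux t x / I t,
    fun t x => uxx t x / I t,
    ((hut.mul hI').sub (hu'.mul hJ'.neg)).div (hI'.pow 2) fun p hp => pow_ne_zero 2 (hIne' p hp),
    hux.div hI' hIne', huxx.div hI' hIne', fun t ht => ⟨fun x hx => ⟨?_, ?_, ?_, ?_⟩, ?_, ?_⟩⟩,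
    fun t ht => ?_⟩
  · exact ((hu t ht).2 x hx).1.div (hId t ht) (hIpos t ht.le).ne'
  · exact ((hu t ht).1.deriv_one x hx).div_const _
  · exact ((hu t ht).1.deriv_two x hx).div_const _
  · have h1 : ∫ ξ in (0 : ℝ)..1, V ξ * normalizedHeat mu e v₀ t ξ = J t / I t := by
      rw [← intervalIntegral.integral_div]
      exact integral_unit_congr fun ξ _ => by rw [hvdef, mul_div_assoc]
    have h2 : I t ≠ 0 := (hIpos t ht.le).ne'
    rw [h1, hvdef]
    change (ut t x * I t - u t x * -J t) / I t ^ 2 =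
      uxx t x / I t - V x * (u t x / I t) + J t / I t * (u t x / I t)
    rw [((hu t ht).2 x hx).2]
    field_simp
    ring
  · simp [(hu t ht).1.left]
  · simp [(hu t ht).1.right]
  · rcases eq_or_lt_of_le ht with rfl | ht'
    · exact mem_POne_congr hv₀ hinit
    · have h2 : I t ≠ 0 := (hIpos t ht).ne'
      refine ⟨mem_PPlus_of_deriv (fun x hx => ((hu t ht').1.deriv_one x hx).div_const _)
        ((hu t ht').1.continuousOn_one.div_const _)
        fun x hx => div_pos (hpos t ht x hx) (hIpos t ht), ?_⟩
      change ∫ x in (0 : ℝ)..1, u t x / I t = 1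
      rw [intervalIntegral.integral_div, div_self h2]

end Nonlinear


/-! ### Powers of series and sums over positive indices. -/

section Sums

/-- Powers of an absolutely convergent series as sums over tuples. -/
lemma hasSum_prod_tuple {ι : Type*} {a : ι → ℝ} {A : ℝ} (ha : Summable fun i => |a i|)
    (hA : HasSum a A) (m : ℕ) :
    (Summable fun q : Fin m → ι => |∏ i, a (q i)|) ∧
      HasSum (fun q : Fin m → ι => ∏ i, a (q i)) (A ^ m) := by
  induction m with
  | zero =>
    have h : HasSum (fun q : Fin 0 → ι => ∏ i, a (q i)) 1 := by
      convert hasSum_unique (fun q : Fin 0 → ι => ∏ i, a (q i)) using 1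
      simp
    exact ⟨h.summable.abs, by rwa [pow_zero]⟩
  | succ m ih =>
    obtain ⟨h1, h2⟩ := ih
    have h3 : Summable fun p : ι × (Fin m → ι) => |a p.1| * |∏ i, a (p.2 i)| :=
      Summable.mul_of_nonneg (f := fun i => |a i|) (g := fun q : Fin m → ι => |∏ i, a (q i)|)
        ha h1 (fun _ => abs_nonneg _) fun _ => abs_nonneg _
    have h4 : Summable fun p : ι × (Fin m → ι) => a p.1 * ∏ i, a (p.2 i) :=
      Summable.of_abs (h3.congr fun p => (abs_mul _ _).symm)
    have h5 := hA.mul h2 h4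
    rw [← pow_succ'] at h5
    refine ⟨?_, ?_⟩
    · rw [← (Fin.consEquiv fun _ : Fin (m + 1) => ι).summable_iff]
      refine h3.congr fun p => ?_
      simp [Fin.consEquiv, Fin.prod_univ_succ, abs_mul]
    · rw [← (Fin.consEquiv fun _ : Fin (m + 1) => ι).hasSum_iff]
      refine Eq.mp (congrArg (HasSum · _) (funext fun p => ?_)) h5
      simp [Fin.consEquiv, Fin.prod_univ_succ]

lemma hasSum_pnat {f : ℕ → ℝ} {a : ℝ} (h : HasSum f a) :
    HasSum (fun n : ℕ+ => f n) (a - f 0) := by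
  rw [← Equiv.pnatEquivNat.symm.hasSum_iff]
  have h1 := (hasSum_nat_add_iff' 1).2 h
  rw [Finset.sum_range_one] at h1
  exact h1

end Sums

/-! ### The Koopman decomposition and its threshold time. -/

section Koopman

variable {V : ℝ → ℝ} {mu : ℕ → ℝ} {e : ℕ → ℝ → ℝ} {w : ℝ → ℝ} {t x : ℝ}

/-- Bessel's inequality for the coefficients of positive index. -/
lemma sum_sq_coeff_pnat_le (hE : IsNeumannEigensystem V mu e) (hw : ContinuousOn w (Icc 0 1))
    (s : Finset ℕ+) : ∑ n ∈ s, coeff e n w ^ 2 ≤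
      ∫ x in (0 : ℝ)..1, (w x - coeff e 0 w * e 0 x) ^ 2 := by
  have h0 := (hE.eigen 0).continuousOn
  have hb := hE.family.bessel (hw.sub (continuousOn_const (c := coeff e 0 w) |>.mul h0))
    (s.map ⟨fun n : ℕ+ => (n : ℕ), PNat.coe_injective⟩)
  rw [Finset.sum_map] at hb
  refine le_trans (le_of_eq (Finset.sum_congr rfl fun n _ => ?_)) hb
  have hn := (hE.eigen n).continuousOn
  congr 1
  have h1 := hE.orthonormal n 0
  rw [if_neg n.ne_zero] at h1
  have h2 : ∫ x in (0 : ℝ)..1, e n x * (w x - coeff e 0 w * e 0 x) =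
      coeff e n w - coeff e 0 w * ∫ x in (0 : ℝ)..1, e n x * e 0 x := by
    rw [← intervalIntegral.integral_const_mul]
    unfold coeff
    rw [← intervalIntegral.integral_sub (intervalIntegrable_unit (hn.fun_mul hw))
      (intervalIntegrable_unit (continuousOn_const.fun_mul (hn.fun_mul h0)))]
    exact integral_unit_congr fun x _ => by ring
  rw [h1, mul_zero, sub_zero] at h2
  exact h2.symm

/-- Cauchy–Schwarz, then Bessel for `w` and for the constant 1, each with its `e 0` component
removed. This is the origin of the numerator of `sinkRatio`. -/
lemma sum_abs_coeff_mul_le (hE : IsNeumannEigensystem V mu e) (hw : ContinuousOn w (Icc 0 1))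
    (s : Finset ℕ+) : ∑ n ∈ s, |coeff e n w| * |∫ x in (0 : ℝ)..1, e n x| ≤
      l2Norm (fun x => w x - coeff e 0 w * e 0 x) *
        l2Norm (fun x => 1 - coeff e 0 (fun _ => 1) * e 0 x) := by
  refine (Real.sum_mul_le_sqrt_mul_sqrt s _ _).trans (mul_le_mul (Real.sqrt_le_sqrt ?_)
    (Real.sqrt_le_sqrt ?_) (Real.sqrt_nonneg _) (Real.sqrt_nonneg _))
  · simpa only [sq_abs] using sum_sq_coeff_pnat_le hE hw s
  · simpa only [sq_abs, coeff, mul_one] using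
      sum_sq_coeff_pnat_le hE (w := fun _ => 1) continuousOn_const s

lemma sinkRatio_nonneg (h : 0 < coeff e 0 w * ∫ x in (0 : ℝ)..1, e 0 x) : 0 ≤ sinkRatio e w :=
  div_nonneg (mul_nonneg (Real.sqrt_nonneg _) (Real.sqrt_nonneg _)) h.le

lemma sum_abs_ratio_le (hE : IsNeumannEigensystem V mu e) (hw : ContinuousOn w (Icc 0 1))
    (hpos : 0 < coeff e 0 w * ∫ x in (0 : ℝ)..1, e 0 x) (ht : 0 ≤ t) (s : Finset ℕ+) :
    ∑ n ∈ s, |Real.exp (-(mu n - mu 0) * t) * (coeff e n w / coeff e 0 w) * meanRatio e n| ≤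
      sinkRatio e w * Real.exp (-(mu 1 - mu 0) * t) := by
  have h1 := div_le_div_of_nonneg_right (sum_abs_coeff_mul_le hE hw s) hpos.le
  rw [Finset.sum_div] at h1
  refine le_trans ?_ (mul_le_mul_of_nonneg_right h1 (Real.exp_pos _).le)
  rw [Finset.sum_mul]
  refine Finset.sum_le_sum fun n _ => ?_
  have h2 : |Real.exp (-(mu n - mu 0) * t) * (coeff e n w / coeff e 0 w) * meanRatio e n| =
      |coeff e n w| * |∫ x in (0 : ℝ)..1, e n x| / (coeff e 0 w * ∫ x in (0 : ℝ)..1, e 0 x) *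
        Real.exp (-(mu n - mu 0) * t) := by
    rw [← abs_of_pos hpos, meanRatio, abs_mul, abs_mul, abs_div, abs_div, abs_mul, Real.abs_exp]
    ring
  rw [h2]
  refine mul_le_mul_of_nonneg_left (Real.exp_le_exp.2 ?_) (by positivity)
  have h3 : mu 1 ≤ mu n := hE.monotone n.pos
  nlinarith

/-- The terms of the Koopman decomposition as products. -/
lemma koopman_term (mu : ℕ → ℝ) (e : ℕ → ℝ → ℝ) (w : ℝ → ℝ) (t x : ℝ) (q₀ : ℕ) {m : ℕ}
    (q : Fin m → ℕ+) :
    Real.exp (-koopmanExponent mu (multiIndex q₀ q) * t) * koopmanObservable e (multiIndex q₀ q) w *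
        koopmanMode e (multiIndex q₀ q) x =
      Real.exp (-(mu q₀ - mu 0) * t) * (coeff e q₀ w / coeff e 0 w) *
          (e q₀ x / ∫ ξ in (0 : ℝ)..1, e 0 ξ) * (-1) ^ m *
        ∏ i, Real.exp (-(mu (q i) - mu 0) * t) * (coeff e (q i) w / coeff e 0 w) *
          meanRatio e (q i) := by
  have h1 : Real.exp (-koopmanExponent mu (multiIndex q₀ q) * t) =
      Real.exp (-(mu q₀ - mu 0) * t) * ∏ i, Real.exp (-(mu (q i) - mu 0) * t) := by
    rw [← Real.exp_sum, ← Real.exp_add, koopmanExponent, Fin.sum_univ_succ]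
    simp only [multiIndex, Fin.cons_zero, Fin.cons_succ]
    rw [← Finset.sum_mul, Finset.sum_neg_distrib]
    congr 1
    ring
  rw [h1, koopmanObservable, koopmanMode, Fin.prod_univ_succ]
  simp only [multiIndex, Fin.cons_zero, Fin.cons_succ, Finset.prod_mul_distrib]
  ring

/-- Scaling by `K` gives `K U = ∑ bₙ` with `b₀ = 1` and `K u = ∑ gₙ`. Hence `u/U = (∑ g_{q₀})/(1 -
A)` with `A = -∑_{n≥1} bₙ` and `|A| < 1`. -/
theorem hasKoopmanSum_normalizedHeat (hE : IsNeumannEigensystem V mu e)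
    (hV : ContinuousOn V (Icc 0 1)) (hVpos : ∀ x ∈ Icc (0 : ℝ) 1, 0 < V x) (hw : w ∈ PPlus)
    (ht : 0 ≤ t) (hlt : sinkRatio e w * Real.exp (-(mu 1 - mu 0) * t) < 1)
    (hx : x ∈ Icc (0 : ℝ) 1) : HasKoopmanSum mu e w t x (normalizedHeat mu e w t x) := by
  have hpos := coeff_mul_integral_pos hE hV hVpos hw
  have hc := hE.summable_mul_sq_coeff hV hVpos hw
  have hU := integral_heatSeries_pos hE hV hVpos hw ht
  have hc0 : coeff e 0 w ≠ 0 := left_ne_zero_of_mul hpos.ne'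
  have hi0 : ∫ x in (0 : ℝ)..1, e 0 x ≠ 0 := right_ne_zero_of_mul hpos.ne'
  have hexp : ∀ n, Real.exp (-(mu n - mu 0) * t) =
      Real.exp (mu 0 * t) * Real.exp (-mu n * t) := fun n => by
    rw [← Real.exp_add]; congr 1; ring
  set U := ∫ ξ in (0 : ℝ)..1, heatSeries mu e (fun n => coeff e n w) t ξ with hUdef
  set u := heatSeries mu e (fun n => coeff e n w) t x with hu
  set K := Real.exp (mu 0 * t) / (coeff e 0 w * ∫ x in (0 : ℝ)..1, e 0 x) with hK
  set b : ℕ → ℝ := fun n =>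
    Real.exp (-(mu n - mu 0) * t) * (coeff e n w / coeff e 0 w) * meanRatio e n with hb
  set g : ℕ → ℝ := fun n => Real.exp (-(mu n - mu 0) * t) * (coeff e n w / coeff e 0 w) *
    (e n x / ∫ ξ in (0 : ℝ)..1, e 0 ξ) with hg
  have hbs : HasSum b (K * U) := by
    have h := (hasSum_integral_heatSeries hE hV hVpos hc ht (φ := fun _ => 1)
      continuousOn_const).mul_left K
    simp only [mul_one] at h
    refine (funext fun n => ?_ : _ = b) ▸ h
    simp only [hb, hK, meanRatio, hexp]
    field_simp
  have hgs : HasSum g (K * u) := by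
    obtain ⟨-, -, hmu, -⟩ := hE.exists_bounds hV hVpos
    obtain ⟨C, -, hsum⟩ := summable_mul_eigenfunction hE hV hVpos
    have h := ((hsum _ (summable_mul_sq_exp hmu hc ht) x hx).1.of_abs.hasSum).mul_left K
    refine (funext fun n => ?_ : _ = g) ▸ h
    simp only [hg, hK, hexp]
    field_simp
  have hb0 : b 0 = 1 := by
    simp only [hb, meanRatio, sub_self, neg_zero, zero_mul, Real.exp_zero, one_mul, div_self hc0,
      div_self hi0]
  have ha := hasSum_pnat hbs
  have hle := sum_abs_ratio_le (mu := mu) hE hw.1 hpos ht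
  have habs : Summable fun n : ℕ+ => |b n| := summable_of_sum_le (fun _ => abs_nonneg _) hle
  rw [hb0] at ha
  have hA : |-(K * U - 1)| < 1 := by
    rw [abs_neg]
    refine lt_of_le_of_lt ?_ hlt
    refine le_of_tendsto ha.abs (Eventually.of_forall fun s => ?_)
    exact (Finset.abs_sum_le_sum_abs _ _).trans (hle s)
  have hneg : HasSum (fun n : ℕ+ => -b n) (-(K * U - 1)) := ha.neg
  -- The inner sum is `g_{q₀} A^m`, the sum over `m` is the geometric series `g_{q₀}/(1 - A)`, and
  -- the sign `(-1)^m` of the modes comes from the minus in `A`.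
  refine ⟨fun q₀ m => g q₀ * (-(K * U - 1)) ^ m, fun q₀ => g q₀ * (1 - -(K * U - 1))⁻¹,
    fun q₀ m => ?_, fun q₀ => ?_, ?_⟩
  · have h := (hasSum_prod_tuple (by simpa only [abs_neg] using habs) hneg m).2.mul_left (g q₀)
    refine Eq.mp (congrArg (HasSum · _) (funext fun q => ?_)) h
    rw [eq_comm, koopman_term, Finset.prod_neg, Finset.card_univ, Fintype.card_fin, mul_assoc]
  · exact ((hasSum_geometric_of_abs_lt_one hA).mul_left (g q₀)).tendsto_sum_nat
  · convert (hgs.mul_right (1 - -(K * U - 1))⁻¹).tendsto_sum_nat using 2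
    have hK0 : K ≠ 0 := (div_pos (Real.exp_pos _) hpos).ne'
    have e1 : 1 - -(K * U - 1) = K * U := by ring
    rw [e1, normalizedHeat, ← hUdef, ← hu]
    have := hU.ne'
    field_simp

lemma tauN_of_sinkRatio_eq_zero (hd : mu 0 < mu 1) (h : sinkRatio e w = 0) : tauN mu e w = ⊥ := by
  rw [tauN, h, ENNReal.ofReal_zero, ENNReal.log_zero]
  exact EReal.coe_mul_bot_of_pos (one_div_pos.2 (sub_pos.2 hd))

lemma tauN_of_sinkRatio_pos (h : 0 < sinkRatio e w) :
    tauN mu e w = ((Real.log (sinkRatio e w) / (mu 1 - mu 0) : ℝ) : EReal) := by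
  rw [tauN, ENNReal.log_ofReal_of_pos h, ← EReal.coe_mul, one_div_mul_eq_div]

/-- Exponentiating the threshold condition gives `ρ < e^{(μ₁-μ₀)t}`; for `ρ = 0`, where the
threshold is `⊥`, the conclusion is trivial. -/
lemma sinkRatio_mul_exp_lt_one (hd : mu 0 < mu 1) (h0 : 0 ≤ sinkRatio e w)
    (h : tauN mu e w < (t : EReal)) : sinkRatio e w * Real.exp (-(mu 1 - mu 0) * t) < 1 := by
  rcases h0.eq_or_lt with h0 | h0
  · rw [← h0, zero_mul]
    exact one_pos
  · rw [tauN_of_sinkRatio_pos h0, EReal.coe_lt_coe_iff, div_lt_iff₀ (sub_pos.2 hd),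
      Real.log_lt_iff_lt_exp h0] at h
    rw [neg_mul, Real.exp_neg, ← div_eq_mul_inv, div_lt_one (Real.exp_pos _), mul_comm _ t]
    exact h

lemma tauN_neg (hd : mu 0 < mu 1) (h0 : 0 ≤ sinkRatio e w) (h1 : sinkRatio e w < 1) :
    tauN mu e w < 0 := by
  rcases h0.eq_or_lt with h0 | h0
  · rw [tauN_of_sinkRatio_eq_zero hd h0.symm]
    exact EReal.bot_lt_zero
  · rw [tauN_of_sinkRatio_pos h0, ← EReal.coe_zero, EReal.coe_lt_coe_iff]
    exact div_neg_of_neg_of_pos (Real.log_neg h0 h1) (sub_pos.2 hd)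

end Koopman

/-! ### The neighbourhood of the sink. -/

section Sink

variable {V : ℝ → ℝ} {mu : ℕ → ℝ} {e : ℕ → ℝ → ℝ} {w : ℝ → ℝ}

lemma l2Norm_congr {f g : ℝ → ℝ} (h : ∀ x ∈ Icc (0 : ℝ) 1, f x = g x) : l2Norm f = l2Norm g := by
  rw [l2Norm, l2Norm, integral_unit_congr fun x hx => by rw [h x hx]]

lemma l2Norm_sub_le (hE : IsNeumannEigensystem V mu e) (hw : ContinuousOn w (Icc 0 1)) :
    l2Norm (fun x => w x - coeff e 0 w * e 0 x) ≤ l2Norm w := by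
  have h0 := (hE.eigen 0).continuousOn
  have i1 := intervalIntegrable_unit (hw.fun_pow 2)
  have i2 := intervalIntegrable_unit (h0.fun_mul hw)
  have i3 := intervalIntegrable_unit (h0.fun_mul h0)
  have h1 : ∫ x in (0 : ℝ)..1, (w x - coeff e 0 w * e 0 x) ^ 2 =
      (∫ x in (0 : ℝ)..1, w x ^ 2) - 2 * coeff e 0 w * coeff e 0 w +
      coeff e 0 w ^ 2 * ∫ x in (0 : ℝ)..1, e 0 x * e 0 x := by
    conv_rhs => rw [show 2 * coeff e 0 w * coeff e 0 w =
      2 * coeff e 0 w * ∫ x in (0 : ℝ)..1, e 0 x * w x from rfl]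
    rw [← intervalIntegral.integral_const_mul, ← intervalIntegral.integral_const_mul,
      ← intervalIntegral.integral_sub i1 (i2.const_mul _),
      ← intervalIntegral.integral_add (i1.sub (i2.const_mul _)) (i3.const_mul _)]
    exact integral_unit_congr fun x _ => by ring
  rw [hE.orthonormal, if_pos rfl] at h1
  refine Real.sqrt_le_sqrt ?_
  rw [h1]
  nlinarith [sq_nonneg (coeff e 0 w)]

lemma abs_coeff_zero_le (hE : IsNeumannEigensystem V mu e) (hw : ContinuousOn w (Icc 0 1)) :
    |coeff e 0 w| ≤ l2Norm w := by
  have h := hE.family.bessel hw {0}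
  rw [Finset.sum_singleton] at h
  exact Real.abs_le_sqrt h

lemma l2Norm_one : l2Norm (fun _ => 1) = 1 := by simp [l2Norm]

lemma sink_mem_POne (hE : IsNeumannEigensystem V mu e)
    (hV : ContinuousOn V (Icc 0 1)) (hVpos : ∀ x ∈ Icc (0 : ℝ) 1, 0 < V x) : sink e ∈ POne := by
  obtain ⟨a, ha⟩ := exists_mul_first_eigenfunction_pos hE hV hVpos
  obtain ⟨e', he'⟩ := hE.family.exists_derivs hV
  have hI : 0 < a * ∫ x in (0 : ℝ)..1, e 0 x := by
    rw [← intervalIntegral.integral_const_mul]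
    exact intervalIntegral.intervalIntegral_pos_of_pos_on (intervalIntegrable_unit
      (continuousOn_const.mul (he' 0).continuousOn)) (fun x hx => ha x (Ioo_subset_Icc_self hx))
      zero_lt_one
  refine ⟨mem_PPlus_of_deriv (fun x hx => ((he' 0).deriv_one x hx).div_const _)
    ((he' 0).continuousOn_one.div_const _) fun x hx => ?_, ?_⟩
  · rw [sink, ← mul_div_mul_left _ _ (left_ne_zero_of_mul hI.ne')]
    exact div_pos (ha x hx) hI
  · change ∫ x in (0 : ℝ)..1, e 0 x / (∫ ξ in (0 : ℝ)..1, e 0 ξ) = 1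
    rw [intervalIntegral.integral_div, div_self (right_ne_zero_of_mul hI.ne')]

/-- The sink is a multiple of `e 0`, so the component of `w` orthogonal to `e 0` is that of `w -
sink e`, and the numerator is below `1/3`. The denominator differs by less than `1/3` from its value
1 at the sink, so it exceeds `2/3`. -/
lemma mem_OmegaN_of_l2Norm_lt (hE : IsNeumannEigensystem V mu e)
    (hV : ContinuousOn V (Icc 0 1)) (hVpos : ∀ x ∈ Icc (0 : ℝ) 1, 0 < V x) (hw : w ∈ POne)
    (h : l2Norm (fun x => w x - sink e x) < 1 / 3) : w ∈ OmegaN e := by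
  refine ⟨hw, ?_⟩
  have hpos := coeff_mul_integral_pos hE hV hVpos hw.1
  have hi0 : ∫ x in (0 : ℝ)..1, e 0 x ≠ 0 := right_ne_zero_of_mul hpos.ne'
  have hs := (sink_mem_POne hE hV hVpos).1.1
  have h0 := (hE.eigen 0).continuousOn
  have hd : ContinuousOn (fun x => w x - sink e x) (Icc 0 1) := hw.1.1.sub hs
  have hcs : coeff e 0 (sink e) * ∫ x in (0 : ℝ)..1, e 0 x = 1 := by
    have h1 : coeff e 0 (sink e) = (∫ x in (0 : ℝ)..1, e 0 x * e 0 x) / ∫ x in (0 : ℝ)..1, e 0 x := by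
      rw [coeff, ← intervalIntegral.integral_div]
      exact integral_unit_congr fun x _ => by rw [sink, mul_div_assoc]
    rw [h1, hE.orthonormal, if_pos rfl, one_div_mul_cancel hi0]
  have hcd : coeff e 0 (fun x => w x - sink e x) = coeff e 0 w - coeff e 0 (sink e) := by
    rw [coeff, coeff, coeff, ← intervalIntegral.integral_sub
      (intervalIntegrable_unit (h0.fun_mul hw.1.1)) (intervalIntegrable_unit (h0.fun_mul hs))]
    exact integral_unit_congr fun x _ => by ring
  have h1 := abs_coeff_zero_le hE hd
  have h2 : |∫ x in (0 : ℝ)..1, e 0 x| ≤ 1 := by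
    have := abs_coeff_zero_le hE (w := fun _ => 1) continuousOn_const
    simpa only [coeff, mul_one, l2Norm_one] using this
  have h3 := l2Norm_sub_le hE hd
  have h4 := l2Norm_sub_le hE (w := fun _ => 1) continuousOn_const
  rw [l2Norm_one] at h4
  have h5 : l2Norm (fun x => w x - coeff e 0 w * e 0 x) =
      l2Norm fun x => w x - sink e x - coeff e 0 (fun x => w x - sink e x) * e 0 x := by
    refine l2Norm_congr fun x _ => ?_
    rw [hcd, sink, eq_div_of_mul_eq hi0 hcs]
    ring
  have h6 : 2 / 3 < coeff e 0 w * ∫ x in (0 : ℝ)..1, e 0 x := by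
    have h7 : |(coeff e 0 w - coeff e 0 (sink e)) * ∫ x in (0 : ℝ)..1, e 0 x| < 1 / 3 := by
      rw [abs_mul, ← hcd]
      exact (mul_le_of_le_one_right (abs_nonneg _) h2).trans_lt (h1.trans_lt h)
    rw [sub_mul, hcs] at h7
    have := (abs_lt.1 h7).1
    linarith
  rw [sinkRatio, div_lt_one hpos]
  refine lt_of_le_of_lt (mul_le_of_le_one_right (Real.sqrt_nonneg _) h4) ?_
  rw [h5]
  linarith

lemma sink_mem_OmegaN (hE : IsNeumannEigensystem V mu e)
    (hV : ContinuousOn V (Icc 0 1)) (hVpos : ∀ x ∈ Icc (0 : ℝ) 1, 0 < V x) : sink e ∈ OmegaN e :=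
  mem_OmegaN_of_l2Norm_lt hE hV hVpos (sink_mem_POne hE hV hVpos) (by simp [l2Norm])

end Sink

end KoopmanHeat

/-! ### Assembly of the theorem. -/

theorem mainTheorem5 (V : ℝ → ℝ) (hV : ContinuousOn V (Icc 0 1))
    (hVpos : ∀ x ∈ Icc (0 : ℝ) 1, 0 < V x) :
    -- the eigenvalues and eigenfunctions exist
    (∃ (mu : ℕ → ℝ) (e : ℕ → ℝ → ℝ), IsNeumannEigensystem V mu e) ∧
    -- for every choice of the orthonormal eigenfunctions, `Ω` is a neighbourhood of the sink
    (∀ (mu : ℕ → ℝ) (e : ℕ → ℝ → ℝ), IsNeumannEigensystem V mu e →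
      sink e ∈ OmegaN e ∧
      ∃ δ : ℝ, 0 < δ ∧ ∀ w ∈ POne, l2Norm (fun x => w x - sink e x) < δ → w ∈ OmegaN e) ∧
    -- every initial value has a unique solution, which stays in `POne`
    ∀ v₀ ∈ POne, ∃ v : ℝ → ℝ → ℝ,
      IsSolution V v₀ v ∧
      (∀ t : ℝ, 0 ≤ t → v t ∈ POne) ∧
      (∀ w : ℝ → ℝ → ℝ, IsSolution V v₀ w →
        ∀ t : ℝ, 0 ≤ t → ∀ x ∈ Icc (0 : ℝ) 1, w t x = v t x) ∧
      -- and that solution has the Koopman decomposition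
      ∀ (mu : ℕ → ℝ) (e : ℕ → ℝ → ℝ), IsNeumannEigensystem V mu e →
        mu 0 < mu 1 ∧
        0 < coeff e 0 v₀ * ∫ x in (0 : ℝ)..1, e 0 x ∧
        (∀ t : ℝ, 0 ≤ t → tauN mu e v₀ < (t : EReal) →
          ∀ x ∈ Icc (0 : ℝ) 1, HasKoopmanSum mu e v₀ t x (v t x)) ∧
        (v₀ ∈ OmegaN e →
          tauN mu e v₀ < 0 ∧
          ∀ t : ℝ, 0 ≤ t → ∀ x ∈ Icc (0 : ℝ) 1, HasKoopmanSum mu e v₀ t x (v t x)) := by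
  obtain ⟨mu, e, hE⟩ := exists_isNeumannEigensystem hV hVpos
  refine ⟨⟨mu, e, hE⟩, fun mu e hE => ⟨sink_mem_OmegaN hE hV hVpos, 1 / 3, by norm_num,
    fun w hw h => mem_OmegaN_of_l2Norm_lt hE hV hVpos hw h⟩, fun v₀ hv₀ => ?_⟩
  obtain ⟨hsol, hmem⟩ := isSolution_normalizedHeat hE hV hVpos hv₀
  refine ⟨normalizedHeat mu e v₀, hsol, hmem,
    fun w hw t ht => hw.eq_normalizedHeat hE hV hVpos hv₀ ht, fun mu' e' hE' => ?_⟩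
  have hd : mu' 0 < mu' 1 := hE'.strictMono hV zero_lt_one
  have hpos := coeff_mul_integral_pos hE' hV hVpos hv₀.1
  have hsum : ∀ t : ℝ, 0 ≤ t → tauN mu' e' v₀ < (t : EReal) →
      ∀ x ∈ Icc (0 : ℝ) 1, HasKoopmanSum mu' e' v₀ t x (normalizedHeat mu e v₀ t x) := by
    intro t ht hlt x hx
    -- The solution was built from one eigensystem, whereas the decomposition concerns an arbitrary
    -- other one; uniqueness identifies the two normalized flows.
    rw [hsol.eq_normalizedHeat hE' hV hVpos hv₀ ht x hx]
    exact hasKoopmanSum_normalizedHeat hE' hV hVpos hv₀.1 ht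
      (sinkRatio_mul_exp_lt_one hd (sinkRatio_nonneg hpos) hlt) hx
  refine ⟨hd, hpos, hsum, fun hO => ?_⟩
  have hneg := tauN_neg hd (sinkRatio_nonneg hpos) hO.2
  exact ⟨hneg, fun t ht => hsum t ht (hneg.trans_le (EReal.coe_nonneg.2 ht))⟩
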